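/- Setting. Let $d\ge 1$, $\beta_0\in(0,1)$. Let $\gamma:\mathbb R^d\to[0,\infty]$ be symmetric, locally integrable, tempered and continuous (into $[0,\infty]$ with its usual topology), and assume that its Fourier transform as a tempered distribution is a measurable, a.e. nonnegative function $\widehat\gamma$, i.e. $\mu(d\xi)=\widehat\gamma(\xi)\,d\xi$ is a tempered measure and $\int\gamma\varphi\,dx=(2\pi)^{-d}\int\widehat\varphi\,d\mu$ for all Schwartz $\varphi$, where $\widehat\varphi(\xi)=\int e^{-i\xi\cdot x}\varphi(x)\,dx$. Assume also that either ($\gamma(x)<\infty$ if and only if $x\ne0$), or ($\widehat\gamma\in L^\infty$ and $\gamma(x)<\infty$ for all $x\neq 0$). Let $W$ be the isonormal Gaussian process, on a probability space $(\Omega,P)$, for the inner product $$\langle\varphi,\psi\rangle_{\mathcal H}=\int_{\mathbb R_+^2}\int_{\mathbb R^{2d}}\varphi(s,x)\psi(r,y)|r-s|^{-\beta_0}\gamma(x-y)\,dx\,dy\,ds\,dr ,$$ that is, a centred Gaussian family with $E[W(\varphi)W(\psi)]=\langle\varphi,\psi\rangle_{\mathcal H}$, indexed by the measurable $\varphi$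 with $\langle|\varphi|,|\varphi|\rangle_{\mathcal H}<\infty$. Let $X$ be a symmetric Lévy process in $\mathbb R^d$ with $X_0=0$, independent of $W$ (realized on a second factor $(\Omega',P')$ of a product space), such that $X_s$ has a density for every $s>0$, and let $\Psi$ be its characteristic exponent, $E\,e^{i\xi\cdot X_s}=e^{-s\Psi(\xi)}$. Let $u_0:\mathbb R^d\to\mathbb R$ be bounded and continuous. Let $\rho\in C_c^\infty(\mathbb R^d)$ be a symmetric probability density with $\widehat\rho\ge0$, and put $\rho_\varepsilon(x)=\varepsilon^{-d}\rho(x/\varepsilon)$, $g_\delta=\delta^{-1}1_{[0,\delta]}$ and $$\Phi^{\varepsilon,\delta}_{t,x}(r,y)=1_{[0,t]}(r)\int_0^t g_\delta(t-s-r)\,\rho_\varepsilon(X_s+x-y)\,ds .$$ Theorem. Assume $$\int_{\mathbb R^d}\frac{\mu(d\xi)}{1+\Psi(\xi)^{1-\beta_0}}<\infty .$$ Let $t\ge0$ and $x\in\mathbb R^d$. Then the limit in $L^2(\Omega\times\Omega')$ $$V_{t,x}=\int_0^t\!\int_{\mathbb R^d}\delta_0(X_{t-r}+x-y)\,W(dr,dy):=\lim_{(\varepsilon,\delta)\to0}W(\Phi^{\varepsilon,\delta}_{t,x})$$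 exists; for almost every realization of $W$ the variable $u_0(X_t+x)e^{V_{t,x}}$ is integrable with respect to the law of $X$; and $$u(t,x)=E^X\big[u_0(X_t+x)\,e^{V_{t,x}}\big]$$ (expectation over $X$ only) has finite moments of all orders, $E|u(t,x)|^q<\infty$ for all $q\in(0,\infty)$. Moreover, for every integer $p\ge1$ and independent copies $X^1,\dots,X^p$ of $X$, $$E[u(t,x)^p]=E\Big[\prod_{j=1}^p u_0(X^j_t+x)\,\exp\Big(\tfrac12\sum_{j,k=1}^p\int_0^t\!\int_0^t|r-s|^{-\beta_0}\gamma(X^j_r-X^k_s)\,dr\,ds\Big)\Big],$$ where the double integrals on the right are almost surely finite and the random variable inside the expectation is integrable. -/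

import Mathlib

open MeasureTheory ProbabilityTheory Filter Topology Set
open scoped NNReal ENNReal BoundedContinuousFunction SchwartzMap

noncomputable section

/-- The space `ℝ^d` with its Euclidean norm. -/
abbrev Space (d : ℕ) : Type := EuclideanSpace ℝ (Fin d)

/-- The Fourier transform `∫ e^{-i ξ·x} f(x) dx` (no `2π` in the exponent). -/
def fourierTransform {d : ℕ} (f : Space d → ℂ) (ξ : Space d) : ℂ :=
  ∫ x, Complex.exp (-(Complex.I * ((inner ℝ ξ x : ℝ) : ℂ))) * f x

/-! ### The spatial covariance -/

/-- A measure is tempered if it integrates some negative power of `1 + |ξ|²`. -/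
def IsTempered {d : ℕ} (ν : Measure (Space d)) : Prop :=
  ∃ k : ℕ, ∫⁻ ξ, ENNReal.ofReal (((1 + ‖ξ‖ ^ 2) ^ k)⁻¹) ∂ν < ∞

/-- The spectral measure `μ(dξ) = γ̂(ξ) dξ`. -/
def spectralMeasure {d : ℕ} (γhat : Space d → ℝ) : Measure (Space d) :=
  volume.withDensity fun ξ => ENNReal.ofReal (γhat ξ)

/-- `γ` is an admissible spatial covariance function, and the measurable function `γhat` is its
Fourier transform as a tempered distribution. -/
structure IsSpatialCovariance {d : ℕ} (γ : Space d → ℝ≥0∞) (γhat : Space d → ℝ) : Prop where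
  symmetric : ∀ x, γ (-x) = γ x
  locallyIntegrable : ∀ K : Set (Space d), IsCompact K → ∫⁻ x in K, γ x < ∞
  tempered : IsTempered (volume.withDensity γ)
  measurable_hat : Measurable γhat
  nonneg_hat : ∀ᵐ ξ, 0 ≤ γhat ξ
  tempered_hat : IsTempered (spectralMeasure γhat)
  fourier_eq : ∀ φ : 𝓢(Space d, ℂ),
    ∫ x, ((γ x).toReal : ℂ) * φ x =
      (((2 * Real.pi) ^ d : ℝ) : ℂ)⁻¹ * ∫ ξ, fourierTransform (fun x => φ x) ξ * (γhat ξ : ℂ)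
  continuous : Continuous γ
  finite_off_zero : (∀ x, γ x < ∞ ↔ x ≠ 0) ∨
    ((∃ C : ℝ, ∀ᵐ ξ, |γhat ξ| ≤ C) ∧ ∀ x, x ≠ 0 → γ x < ∞)

/-! ### The Gaussian noise -/

/-- Lebesgue measure on `ℝ₊ × ℝ^d`, as a measure on `ℝ × ℝ^d`. -/
def spaceTime (d : ℕ) : Measure (ℝ × Space d) :=
  ((volume : Measure ℝ).restrict (Ici 0)).prod volume

/-- The measurable functions `φ` with
`∫∫∫∫ |φ(s,x)| |φ(t,y)| |t-s|^{-β₀} γ(x-y) ds dt dx dy < ∞`. They form a dense subspace of the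
Hilbert space of the noise, namely of the completion of `C_c^∞(ℝ₊ × ℝ^d)` for `noiseInner`. -/
def noiseDomain {d : ℕ} (β₀ : ℝ) (γ : Space d → ℝ≥0∞) : Set (ℝ × Space d → ℝ) :=
  {φ | Measurable φ ∧
    ∫⁻ z, ‖φ z.1‖ₑ * ‖φ z.2‖ₑ * ENNReal.ofReal (|z.1.1 - z.2.1| ^ (-β₀)) * γ (z.1.2 - z.2.2)
      ∂((spaceTime d).prod (spaceTime d)) < ∞}

/-- The inner product
`∫∫∫∫ φ(s,x) ψ(t,y) |t-s|^{-β₀} γ(x-y) ds dt dx dy`. -/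
def noiseInner {d : ℕ} (β₀ : ℝ) (γ : Space d → ℝ≥0∞) (φ ψ : ℝ × Space d → ℝ) : ℝ :=
  ∫ z, φ z.1 * ψ z.2 * |z.1.1 - z.2.1| ^ (-β₀) * (γ (z.1.2 - z.2.2)).toReal
    ∂((spaceTime d).prod (spaceTime d))

/-- `W` is the isonormal Gaussian process of the noise: a centred Gaussian family with
`E[W(φ) W(ψ)] = ⟨φ, ψ⟩`. Values of `W` outside `noiseDomain` are irrelevant. -/
structure IsNoise {d : ℕ} {Ω : Type*} [MeasurableSpace Ω] (β₀ : ℝ) (γ : Space d → ℝ≥0∞)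
    (W : (ℝ × Space d → ℝ) → Ω → ℝ) (P : Measure Ω) : Prop where
  gaussian : IsGaussianProcess (fun φ : noiseDomain β₀ γ => W φ) P
  centred : ∀ φ ∈ noiseDomain β₀ γ, ∫ ω, W φ ω ∂P = 0
  covariance : ∀ φ ∈ noiseDomain β₀ γ, ∀ ψ ∈ noiseDomain β₀ γ,
    ∫ ω, W φ ω * W ψ ω ∂P = noiseInner β₀ γ φ ψ

/-! ### The Lévy process -/

/-- A path `[0,∞) → ℝ^d` which is right-continuous with left limits. -/
def IsCadlagPath {d : ℕ} (f : ℝ≥0 → Space d) : Prop :=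
  ∀ t, ContinuousWithinAt f (Ici t) t ∧ ∃ l, Tendsto f (𝓝[<] t) (𝓝 l)

/-- A Lévy process in `ℝ^d`. -/
structure IsLevyProcess {d : ℕ} {Ω : Type*} [MeasurableSpace Ω] (X : ℝ≥0 → Ω → Space d)
    (P : Measure Ω) : Prop where
  measurable : ∀ t, Measurable (X t)
  start : ∀ᵐ ω ∂P, X 0 ω = 0
  indep : HasIndepIncrements X P
  stationary : ∀ s t, IdentDistrib (fun ω => X (s + t) ω - X s ω) (X t) P P
  cadlag : ∀ᵐ ω ∂P, IsCadlagPath fun t => X t ω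

/-- A symmetric Lévy process with transition densities and characteristic exponent `Ψ`:
`E exp(i ξ·X_t) = exp(-t Ψ(ξ))`. -/
structure IsSymmetricLevyProcess {d : ℕ} {Ω : Type*} [MeasurableSpace Ω] (X : ℝ≥0 → Ω → Space d)
    (Ψ : Space d → ℝ) (P : Measure Ω) : Prop extends IsLevyProcess X P where
  symmetric : ∀ t, IdentDistrib (fun ω => -X t ω) (X t) P P
  density : ∀ t, 0 < t → P.map (X t) ≪ volume
  exponent : ∀ (t : ℝ≥0) (ξ : Space d),
    charFun (P.map (X t)) ξ = Complex.exp (-((t : ℝ) * Ψ ξ : ℝ))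

/-- `Y 0, …, Y (p-1)` are independent copies of the Lévy process `X`. -/
structure AreIndependentCopies {d p : ℕ} {Ω Ω' : Type*} [MeasurableSpace Ω] [MeasurableSpace Ω']
    (Y : Fin p → ℝ≥0 → Ω' → Space d) (Q : Measure Ω') (X : ℝ≥0 → Ω → Space d)
    (P : Measure Ω) : Prop where
  levy : ∀ j, IsLevyProcess (Y j) Q
  law : ∀ j, Q.map (fun ω s => Y j s ω) = P.map (fun ω s => X s ω)
  indep : iIndepFun (fun (j : Fin p) ω (s : ℝ≥0) => Y j s ω) Q

/-- The integrability condition `∫ (1 + Ψ(ξ)^{1-β₀})⁻¹ μ(dξ) < ∞`. -/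
def SpectralCondition {d : ℕ} (β₀ : ℝ) (Ψ : Space d → ℝ) (μ : Measure (Space d)) : Prop :=
  ∫⁻ ξ, ENNReal.ofReal (1 / (1 + Ψ ξ ^ (1 - β₀))) ∂μ < ∞

/-! ### The Feynman–Kac functional -/

/-- `p` is a smooth, compactly supported, symmetric probability density whose Fourier transform
(real, by symmetry) is nonnegative. -/
structure IsMollifier {d : ℕ} (p : Space d → ℝ) : Prop where
  smooth : ContDiff ℝ ((⊤ : ℕ∞) : WithTop ℕ∞) p
  compactSupport : HasCompactSupport p
  symmetric : ∀ x, p (-x) = p x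
  nonneg : ∀ x, 0 ≤ p x
  integral_eq_one : ∫ x, p x = 1
  fourier_nonneg : ∀ ξ, 0 ≤ (fourierTransform (fun x => (p x : ℂ)) ξ).re

/-- `g_δ = δ⁻¹ 1_{[0,δ]}`. -/
def timeMollifier (δ r : ℝ) : ℝ := (Icc 0 δ).indicator (fun _ => δ⁻¹) r

/-- `p_ε(x) = ε^{-d} p(x/ε)`. -/
def spaceMollifier {d : ℕ} (p : Space d → ℝ) (ε : ℝ) (x : Space d) : ℝ :=
  (ε ^ d)⁻¹ * p (ε⁻¹ • x)

/-- The function `(r,y) ↦ ∫_0^t g_δ(t-s-r) p_ε(f(s)+x-y) ds · 1_{[0,t]}(r)`, for a path `f`. It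
approximates `δ_0(f(t-r)+x-y) 1_{[0,t]}(r)`. -/
def approxDelta {d : ℕ} (p : Space d → ℝ) (ε δ : ℝ) (t : ℝ≥0) (x : Space d)
    (f : ℝ≥0 → Space d) : ℝ × Space d → ℝ := fun z =>
  (Icc (0 : ℝ) t).indicator
    (fun r => ∫ s in (0 : ℝ)..t,
      timeMollifier δ (t - s - r) * spaceMollifier p ε (f s.toNNReal + x - z.2)) z.1

/-- `F` is (a jointly measurable version of) the random variable `W(Φ)` on `Ω × Ω'`, where the
random integrand `Φ` lives on `Ω'` and is independent of `W`, which lives on `Ω`. -/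
structure IsNoiseIntegral {d : ℕ} {Ω Ω' : Type*} [MeasurableSpace Ω] [MeasurableSpace Ω']
    (β₀ : ℝ) (γ : Space d → ℝ≥0∞) (W : (ℝ × Space d → ℝ) → Ω → ℝ) (P : Measure Ω)
    (P' : Measure Ω') (Φ : Ω' → ℝ × Space d → ℝ) (F : Ω × Ω' → ℝ) : Prop where
  measurable : AEStronglyMeasurable F (P.prod P')
  domain : ∀ᵐ ω' ∂P', Φ ω' ∈ noiseDomain β₀ γ
  eq : ∀ᵐ ω' ∂P', (fun ω => F (ω, ω')) =ᵐ[P] W (Φ ω')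

/-- `V` is the stochastic integral `∫_0^t ∫ δ_0(X_{t-r} + x - y) W(dr,dy)`, the limit in
`L²(Ω × Ω')` of `W(Φ^{ε,δ}_{t,x})` as `(ε,δ) → 0`. -/
def IsDeltaIntegral {d : ℕ} {Ω Ω' : Type*} [MeasurableSpace Ω] [MeasurableSpace Ω']
    (β₀ : ℝ) (γ : Space d → ℝ≥0∞) (W : (ℝ × Space d → ℝ) → Ω → ℝ) (P : Measure Ω)
    (X : ℝ≥0 → Ω' → Space d) (P' : Measure Ω') (p : Space d → ℝ) (t : ℝ≥0) (x : Space d)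
    (V : Ω × Ω' → ℝ) : Prop :=
  MemLp V 2 (P.prod P') ∧
  ∃ F : ℝ → ℝ → Ω × Ω' → ℝ,
    (∀ ε δ : ℝ, 0 < ε → 0 < δ →
      IsNoiseIntegral β₀ γ W P P' (fun ω' => approxDelta p ε δ t x fun s => X s ω') (F ε δ) ∧
      MemLp (F ε δ) 2 (P.prod P')) ∧
    Tendsto (fun e : ℝ × ℝ => eLpNorm (F e.1 e.2 - V) 2 (P.prod P'))
      (𝓝[>] 0 ×ˢ 𝓝[>] 0) (𝓝 0)

/-- `E^X[u₀(X_t + x) exp V]`: the expectation over the second factor `Ω'` only. -/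
def feynmanKac {d : ℕ} {Ω Ω' : Type*} [MeasurableSpace Ω'] (X : ℝ≥0 → Ω' → Space d)
    (P' : Measure Ω') (u₀ : Space d →ᵇ ℝ) (t : ℝ≥0) (x : Space d) (V : Ω × Ω' → ℝ) (ω : Ω) : ℝ :=
  ∫ ω', u₀ (X t ω' + x) * Real.exp (V (ω, ω')) ∂P'

/-- `∫_0^t ∫_0^t |r-s|^{-β₀} γ(f(r) - g(s)) dr ds`, for paths `f` and `g`. -/
def mutualEnergy {d : ℕ} (β₀ : ℝ) (γ : Space d → ℝ≥0∞) (t : ℝ≥0) (f g : ℝ≥0 → Space d) : ℝ≥0∞ :=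
  ∫⁻ r in Icc (0 : ℝ) t, ∫⁻ s in Icc (0 : ℝ) t,
    ENNReal.ofReal (|r - s| ^ (-β₀)) * γ (f r.toNNReal - g s.toNNReal)

end

/-!
# Feynman–Kac moments for a Lévy process in a Gaussian noise

The argument rests on one identity: for `v > 0` the mean of `γ(z + X_v)` equals, at *every* point
`z`, the function `potential γhat Ψ v z = (2π)^{-d} ∫ cos(ξ·z) e^{-vΨ(ξ)} μ(dξ)`. Testing against
smooth functions gives the identity for almost every `z` (`IsSpatialCovariance.ae_lintegral_add_eq`);
splitting the time in two halves and integrating against the absolutely continuous law of the second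
half removes the exceptional set (`IsSpatialCovariance.lintegral_add_conv_eq`). The potential is
largest at `z = 0`, and the spectral condition makes `u^{-β₀} · potential u 0` integrable at `u = 0`
(`SpectralCondition.lintegral_rpow_mul_potential_lt_top`). Hence the mean of the mutual energy
`∫∫ |r-s|^{-β₀} γ(A_r - B_s)` is finite when `A = B = X`, and also when `A` and `B` are independent
copies of `X`, because the difference then has the law of `X_{s+r}` and `s + r ≥ |s - r|`. The
structure `IsPotentialPair` treats both cases at once.

*Existence of the integral.* The inner product of two approximating integrands is the mutual energy
with mollified kernels (`IsMollifier.noiseLIntegral_approxDelta`), and its mean converges, by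
dominated convergence, to the mean energy of `X`, however the parameters of the two integrands tend
to `0` (`IsPotentialPair.tendsto_lintegral_noise`). So the variables `W(Φ^{ε,δ})` are Cauchy in
`L²(Ω × Ω')` (`IsNoise.exists_isDeltaIntegral`). As `W` is only a family of random variables, a
jointly measurable version of `W(Φ)` has to be produced first: `ω' ↦ W(Φ_{ω'})` is a strongly
measurable `L²(P)`-valued map, because it is a limit of maps that depend on a path through finitely
many rounded values (`IsNoise.stronglyMeasurable_toLp`, `exists_joint_version`).

*Conditional law.* For almost every choice of paths the slices `V(·, ω')` are `L²(P)` limits of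
jointly Gaussian variables. By Fatou's lemma their covariances are at least the mutual energies of
the paths; the means over the paths agree, so the covariances equal the mutual energies almost
surely (`IsPotentialPair.ae_covariance_eq`). Thus sums of slices are centred Gaussian with the
expected variance (`IsDeltaIntegral.ae_map_sum_eq_gaussianReal`).

*Exponential moments.* Half the energy of a path is the integral of the rate
`energyRate r = ∫_0^r |r-s|^{-β₀} γ(X_r - X_s) ds`. Given the past up to time `u`, the mean of the
rate integrated over `(u, v]` is bounded by a deterministic quantity which is small with `v - u`,
as the increments are independent of the past and the potential is largest at the origin. This is
Khasminskii's condition. It bounds the iterated integrals of the rate by a geometric sequence on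
short intervals (`IsSymmetricLevyProcess.lintegral_mul_iterIntegral_le`), and finitely many short
intervals cover `[0, t]` (`IsSymmetricLevyProcess.lintegral_exp_mutualEnergy_lt_top`).

*Moments.* By the Gaussian law of the slices, `e^{qV}` is integrable for every `q`, and `E u(t,x)^p`
is computed by Fubini's theorem on `Ω × Ω'^p` (`IsDeltaIntegral.integral_feynmanKac_pow`). Arbitrary
independent copies have the same joint law on path space as the coordinates of `Ω'^p`; as the energy
is not measurable for the product `σ`-algebra on all paths, it is replaced by the energy of a
measurable regularization that fixes càdlàg paths (`pathRegularization`).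
-/

/-! ### Fourier analysis of the spatial covariance -/

theorem fourierTransform_eq_fourier {d : ℕ} (f : Space d → ℂ) (ξ : Space d) :
    fourierTransform f ξ = FourierTransform.fourier f ((2 * Real.pi)⁻¹ • ξ) := by
  rw [fourierTransform, Real.fourier_eq]
  refine integral_congr_ae (ae_of_all _ fun x => ?_)
  simp only [Real.fourierChar_apply', Circle.smul_def, Circle.coe_exp, smul_eq_mul, inner_smul_right]
  congr 2
  have h : (Real.pi : ℂ) ≠ 0 := by exact_mod_cast Real.pi_ne_zero
  rw [real_inner_comm]
  push_cast
  field_simp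

theorem fourierTransform_comp_sub {d : ℕ} (f : Space d → ℂ) (y ξ : Space d) :
    fourierTransform (fun x => f (x - y)) ξ =
      Complex.exp (-(Complex.I * ((inner ℝ ξ y : ℝ) : ℂ))) * fourierTransform f ξ := by
  rw [fourierTransform, fourierTransform, ← integral_const_mul,
    ← integral_add_right_eq_self (μ := volume) _ y]
  refine integral_congr_ae (ae_of_all _ fun x => ?_)
  simp only [add_sub_cancel_right, inner_add_right]
  rw [← mul_assoc, ← Complex.exp_add]
  push_cast
  ring_nf

theorem continuous_fourierTransform {d : ℕ} (φ : 𝓢(Space d, ℂ)) :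
    Continuous (fourierTransform fun x => φ x) := by
  have : (fourierTransform fun x => φ x) =
      fun ξ => (FourierTransform.fourier φ : 𝓢(Space d, ℂ)) ((2 * Real.pi)⁻¹ • ξ) := by
    funext ξ
    rw [fourierTransform_eq_fourier, SchwartzMap.fourier_coe]
  rw [this]
  exact (SchwartzMap.continuous _).comp (continuous_const_smul _)

/-- The Fourier transform of a Schwartz function is integrable for every tempered measure: it decays
faster than the power that the measure integrates. -/
theorem integrable_fourierTransform {d : ℕ} {ν : Measure (Space d)} (hν : IsTempered ν)
    (φ : 𝓢(Space d, ℂ)) : Integrable (fourierTransform fun x => φ x) ν := by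
  obtain ⟨k, hk⟩ := hν
  set ψ : 𝓢(Space d, ℂ) := FourierTransform.fourier φ
  set C := 2 ^ (2 * k) * ((Finset.Iic (2 * k, 0)).sup fun m => SchwartzMap.seminorm ℝ m.1 m.2) ψ
  have hψ : ∀ x, (1 + ‖x‖) ^ (2 * k) * ‖ψ x‖ ≤ C := fun x => by
    simpa using SchwartzMap.one_add_le_sup_seminorm_apply (𝕜 := ℝ) (m := (2 * k, 0)) le_rfl le_rfl
      ψ x
  have hC : 0 ≤ C := le_trans (by positivity) (hψ 0)
  have hint : Integrable (fun ξ : Space d => ((1 + ‖ξ‖ ^ 2) ^ k)⁻¹) ν := by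
    refine ⟨by fun_prop, ?_⟩
    rw [hasFiniteIntegral_iff_ofReal (ae_of_all _ fun ξ => by positivity)]
    exact hk
  refine (hint.const_mul ((2 * Real.pi) ^ (2 * k) * C)).mono'
    (continuous_fourierTransform φ).aestronglyMeasurable (ae_of_all _ fun ξ => ?_)
  have h1 : fourierTransform (fun x => φ x) ξ = ψ ((2 * Real.pi)⁻¹ • ξ) := by
    rw [fourierTransform_eq_fourier, SchwartzMap.fourier_coe]
  have hpi : (1 : ℝ) ≤ 2 * Real.pi := by nlinarith [Real.pi_gt_three]
  have h2 : 1 + ‖ξ‖ ≤ (2 * Real.pi) * (1 + ‖(2 * Real.pi)⁻¹ • ξ‖) := by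
    rw [norm_smul, Real.norm_of_nonneg (by positivity), mul_add, ← mul_assoc,
      mul_inv_cancel₀ (by positivity), one_mul, mul_one]
    linarith
  have h3 : (1 + ‖ξ‖ ^ 2) ^ k ≤
      (2 * Real.pi) ^ (2 * k) * (1 + ‖(2 * Real.pi)⁻¹ • ξ‖) ^ (2 * k) := by
    rw [← mul_pow]
    refine le_trans ?_ (pow_le_pow_left₀ (by positivity) h2 _)
    rw [pow_mul]
    gcongr
    nlinarith [norm_nonneg ξ]
  rw [h1, ← div_eq_mul_inv, le_div_iff₀ (by positivity)]
  calc ‖ψ ((2 * Real.pi)⁻¹ • ξ)‖ * (1 + ‖ξ‖ ^ 2) ^ k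
      ≤ ‖ψ ((2 * Real.pi)⁻¹ • ξ)‖ *
        ((2 * Real.pi) ^ (2 * k) * (1 + ‖(2 * Real.pi)⁻¹ • ξ‖) ^ (2 * k)) := by gcongr
    _ = (2 * Real.pi) ^ (2 * k) *
        ((1 + ‖(2 * Real.pi)⁻¹ • ξ‖) ^ (2 * k) * ‖ψ ((2 * Real.pi)⁻¹ • ξ)‖) := by ring
    _ ≤ _ := by gcongr; exact hψ _

theorem integral_spectralMeasure {d : ℕ} {γhat : Space d → ℝ} (hm : Measurable γhat)
    (h0 : ∀ᵐ ξ, 0 ≤ γhat ξ) (f : Space d → ℂ) :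
    ∫ ξ, f ξ ∂(spectralMeasure γhat) = ∫ ξ, f ξ * (γhat ξ : ℂ) := by
  rw [spectralMeasure, integral_withDensity_eq_integral_toReal_smul (by fun_prop)
    (ae_of_all _ fun _ => ENNReal.ofReal_lt_top)]
  refine integral_congr_ae ?_
  filter_upwards [h0] with ξ hξ
  rw [ENNReal.toReal_ofReal hξ, Complex.real_smul, mul_comm]

instance {d : ℕ} (γhat : Space d → ℝ) : SFinite (spectralMeasure γhat) := by
  unfold spectralMeasure; infer_instance

/-- The Fourier identity for `γ`, tested against the translate of a test function. -/
theorem IsSpatialCovariance.integral_translate {d : ℕ} {γ : Space d → ℝ≥0∞} {γhat : Space d → ℝ}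
    (h : IsSpatialCovariance γ γhat) {φ : Space d → ℝ}
    (hφ : ContDiff ℝ ((⊤ : ℕ∞) : WithTop ℕ∞) φ) (hc : HasCompactSupport φ) (y : Space d) :
    ((∫ z, (γ (z + y)).toReal * φ z : ℝ) : ℂ) =
      (((2 * Real.pi) ^ d : ℝ) : ℂ)⁻¹ * ∫ ξ, Complex.exp (-(Complex.I * ((inner ℝ ξ y : ℝ) : ℂ))) *
        fourierTransform (fun x => (φ x : ℂ)) ξ ∂(spectralMeasure γhat) := by
  have hc' : HasCompactSupport fun x => ((φ (x - y) : ℝ) : ℂ) :=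
    (hc.comp_homeomorph (Homeomorph.subRight y)).comp_left (g := fun r : ℝ => (r : ℂ)) rfl
  have hs' : ContDiff ℝ ((⊤ : ℕ∞) : WithTop ℕ∞) fun x => ((φ (x - y) : ℝ) : ℂ) :=
    Complex.ofRealCLM.contDiff.comp (hφ.comp (contDiff_id.sub contDiff_const))
  have := h.fourier_eq (hc'.toSchwartzMap hs')
  have he : ∀ z, hc'.toSchwartzMap hs' z = ((φ (z - y) : ℝ) : ℂ) := fun _ => rfl
  simp only [he] at this
  rw [integral_spectralMeasure h.measurable_hat h.nonneg_hat]
  simp only [fourierTransform_comp_sub fun x => (φ x : ℂ)] at this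
  rw [← this, ← integral_complex_ofReal,
    ← integral_add_right_eq_self (fun z => ((γ z).toReal : ℂ) * ((φ (z - y) : ℝ) : ℂ)) y]
  simp

theorem IsSpatialCovariance.measurable {d : ℕ} {γ : Space d → ℝ≥0∞} {γhat : Space d → ℝ}
    (h : IsSpatialCovariance γ γhat) : Measurable γ := h.continuous.measurable

/-! ### The potential of the Lévy process -/

theorem IsSpatialCovariance.setLIntegral_translate_lt_top {d : ℕ} {γ : Space d → ℝ≥0∞}
    {γhat : Space d → ℝ} (h : IsSpatialCovariance γ γhat) {K : Set (Space d)} (hK : IsCompact K)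
    (y : Space d) : ∫⁻ z in K, γ (z + y) < ∞ := by
  have := (measurePreserving_add_right (volume : Measure (Space d)) y).setLIntegral_comp_emb
    (measurableEmbedding_addRight y) γ K
  rw [this]
  exact h.locallyIntegrable _ (hK.image (continuous_add_const y))

/-- The mass that a translate of `γ` puts on a fixed test function is bounded uniformly in the
translation: `γ` being positive definite, its translates pair with a test function like bounded
characters. -/
theorem IsSpatialCovariance.exists_lintegral_translate_le {d : ℕ} {γ : Space d → ℝ≥0∞}
    {γhat : Space d → ℝ} (h : IsSpatialCovariance γ γhat) {φ : Space d → ℝ}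
    (hφ : ContDiff ℝ ((⊤ : ℕ∞) : WithTop ℕ∞) φ) (hc : HasCompactSupport φ) (h0 : ∀ z, 0 ≤ φ z) :
    ∃ C : ℝ≥0∞, C < ∞ ∧ ∀ y, ∫⁻ z, γ (z + y) * ENNReal.ofReal (φ z) ≤ C := by
  obtain ⟨M, hM⟩ := hφ.continuous.bounded_above_of_compact_support hc
  refine ⟨ENNReal.ofReal (((2 * Real.pi) ^ d)⁻¹ *
    ∫ ξ, ‖fourierTransform (fun x => ((φ x : ℝ) : ℂ)) ξ‖ ∂(spectralMeasure γhat)),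
    ENNReal.ofReal_lt_top, fun y => ?_⟩
  have hmeas : Measurable fun z => γ (z + y) := h.measurable.comp (by fun_prop)
  have hfin : ∫⁻ z, γ (z + y) * ENNReal.ofReal (φ z) < ∞ := by
    calc ∫⁻ z, γ (z + y) * ENNReal.ofReal (φ z)
        ≤ ∫⁻ z, (tsupport φ).indicator (fun z => γ (z + y)) z * ENNReal.ofReal M := by
          refine lintegral_mono fun z => ?_
          by_cases hz : z ∈ tsupport φ
          · rw [indicator_of_mem hz]
            gcongr
            exact (le_abs_self _).trans (hM z)
          · simp [image_eq_zero_of_notMem_tsupport hz]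
      _ < ∞ := by
          rw [lintegral_mul_const _ (hmeas.indicator (isClosed_tsupport φ).measurableSet),
            lintegral_indicator (isClosed_tsupport φ).measurableSet]
          exact ENNReal.mul_lt_top (h.setLIntegral_translate_lt_top hc y) ENNReal.ofReal_lt_top
  have hre : ∀ z, ((γ (z + y)).toReal * φ z) = (γ (z + y) * ENNReal.ofReal (φ z)).toReal :=
    fun z => by rw [ENNReal.toReal_mul, ENNReal.toReal_ofReal (h0 z)]
  have hkey : ∫ z, (γ (z + y)).toReal * φ z ≤ ((2 * Real.pi) ^ d)⁻¹ *
      ∫ ξ, ‖fourierTransform (fun x => ((φ x : ℝ) : ℂ)) ξ‖ ∂(spectralMeasure γhat) := by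
    refine (le_abs_self _).trans ?_
    rw [← Real.norm_eq_abs, ← Complex.norm_real, h.integral_translate hφ hc y, norm_mul, norm_inv,
      Complex.norm_real, Real.norm_of_nonneg (by positivity)]
    gcongr
    refine (norm_integral_le_integral_norm _).trans_eq (integral_congr_ae (ae_of_all _ fun ξ => ?_))
    simp only [norm_mul, Complex.norm_exp]
    simp
  have hmeas' : Measurable fun z => γ (z + y) * ENNReal.ofReal (φ z) :=
    hmeas.mul hφ.continuous.measurable.ennreal_ofReal
  have hfae : ∀ᵐ z, γ (z + y) * ENNReal.ofReal (φ z) < ∞ :=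
    MeasureTheory.ae_lt_top hmeas' hfin.ne
  simp only [hre] at hkey
  rw [integral_toReal hmeas'.aemeasurable hfae] at hkey
  rw [← ENNReal.ofReal_toReal hfin.ne]
  exact ENNReal.ofReal_le_ofReal hkey

/-- The function `v, z ↦ (2π)^{-d} ∫ cos(ξ·z) e^{-vΨ(ξ)} μ(dξ)`. It is the mean of `γ(z + X_v)`
when `X` is a symmetric Lévy process with exponent `Ψ`. -/
noncomputable def potential {d : ℕ} (γhat Ψ : Space d → ℝ) (v : ℝ) (z : Space d) : ℝ :=
  ((2 * Real.pi) ^ d)⁻¹ *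
    ∫ ξ, Real.cos (inner ℝ ξ z) * Real.exp (-(v * Ψ ξ)) ∂(spectralMeasure γhat)

section Potential

variable {d : ℕ} {γhat Ψ : Space d → ℝ} {v : ℝ}

theorem integrable_cos_mul_exp (hint : Integrable (fun ξ => Real.exp (-(v * Ψ ξ)))
    (spectralMeasure γhat)) (z : Space d) :
    Integrable (fun ξ => Real.cos (inner ℝ ξ z) * Real.exp (-(v * Ψ ξ))) (spectralMeasure γhat) :=
  hint.mono ((by fun_prop :
    Continuous fun ξ : Space d => Real.cos (inner ℝ ξ z)).aestronglyMeasurable.mul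
    hint.aestronglyMeasurable) (ae_of_all _ fun ξ => by
      rw [norm_mul]
      exact mul_le_of_le_one_left (norm_nonneg _) (Real.abs_cos_le_one _))

theorem potential_neg (z : Space d) : potential γhat Ψ v (-z) = potential γhat Ψ v z := by
  simp [potential]

theorem potential_le_zero (hint : Integrable (fun ξ => Real.exp (-(v * Ψ ξ)))
    (spectralMeasure γhat)) (z : Space d) : potential γhat Ψ v z ≤ potential γhat Ψ v 0 := by
  refine mul_le_mul_of_nonneg_left (integral_mono (integrable_cos_mul_exp hint z)
    (integrable_cos_mul_exp hint 0) fun ξ => ?_) (by positivity)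
  simpa using mul_le_of_le_one_left (Real.exp_pos _).le (Real.cos_le_one _)

theorem abs_potential_le (hint : Integrable (fun ξ => Real.exp (-(v * Ψ ξ)))
    (spectralMeasure γhat)) (z : Space d) : |potential γhat Ψ v z| ≤ potential γhat Ψ v 0 := by
  unfold potential
  rw [abs_mul, abs_of_nonneg (by positivity : 0 ≤ ((2 * Real.pi) ^ d)⁻¹)]
  refine mul_le_mul_of_nonneg_left ((abs_integral_le_integral_abs).trans
    (integral_mono (integrable_cos_mul_exp hint z).abs
    (integrable_cos_mul_exp hint 0) fun ξ => ?_)) (by positivity)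
  simp only [abs_mul, inner_zero_right, Real.cos_zero, one_mul, Real.abs_exp]
  exact mul_le_of_le_one_left (Real.exp_pos _).le (Real.abs_cos_le_one _)

theorem continuous_potential (hint : Integrable (fun ξ => Real.exp (-(v * Ψ ξ)))
    (spectralMeasure γhat)) : Continuous (potential γhat Ψ v) := by
  refine continuous_const.mul (continuous_of_dominated
    (fun z => (integrable_cos_mul_exp hint z).aestronglyMeasurable)
    (fun z => ae_of_all _ fun ξ => ?_) hint (ae_of_all _ fun ξ => by fun_prop))
  rw [norm_mul, Real.norm_of_nonneg (Real.exp_pos _).le]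
  exact mul_le_of_le_one_left (Real.exp_pos _).le (Real.abs_cos_le_one _)

/-- Averaging `potential` against a law with exponent `wΨ` advances its time by `w`. -/
theorem integral_potential_add (hint : Integrable (fun ξ => Real.exp (-(v * Ψ ξ)))
    (spectralMeasure γhat)) {ν : Measure (Space d)} [IsProbabilityMeasure ν] {w : ℝ}
    (hν : ∀ ξ, charFun ν ξ = Complex.exp (-(w * Ψ ξ : ℝ))) (z : Space d) :
    ∫ y, potential γhat Ψ v (z + y) ∂ν = potential γhat Ψ (v + w) z := by
  have hprod : Integrable (Function.uncurry fun (y : Space d) (ξ : Space d) =>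
      Real.cos (inner ℝ ξ (z + y)) * Real.exp (-(v * Ψ ξ))) (ν.prod (spectralMeasure γhat)) := by
    refine (hint.comp_snd ν).mono (AEStronglyMeasurable.mul
      (by fun_prop : Continuous fun p : Space d × Space d =>
        Real.cos (inner ℝ p.2 (z + p.1))).aestronglyMeasurable
      (hint.comp_snd ν).aestronglyMeasurable) (ae_of_all _ fun ξ => ?_)
    simp only [Function.uncurry, norm_mul]
    exact mul_le_of_le_one_left (norm_nonneg _) (Real.abs_cos_le_one _)
  unfold potential
  rw [integral_const_mul, integral_integral_swap hprod]
  congr 1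
  refine integral_congr_ae (ae_of_all _ fun ξ => ?_)
  simp only
  rw [integral_mul_const]
  have h1 : ∫ y, Complex.exp (Complex.I * (inner ℝ ξ (z + y) : ℝ)) ∂ν =
      Complex.exp (Complex.I * (inner ℝ ξ z : ℝ)) * Complex.exp (-(w * Ψ ξ : ℝ)) := by
    rw [← hν ξ, charFun_apply, ← integral_const_mul]
    refine integral_congr_ae (ae_of_all _ fun y => ?_)
    simp only
    rw [← Complex.exp_add, inner_add_right, real_inner_comm y ξ]
    push_cast
    ring_nf
  have hi : Integrable (fun y => Complex.exp (Complex.I * (inner ℝ ξ (z + y) : ℝ))) ν := by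
    refine (integrable_const (1 : ℝ)).mono' (by fun_prop) (ae_of_all _ fun y => ?_)
    rw [Complex.norm_exp]; simp
  have h2 := congrArg Complex.re h1
  rw [← Complex.reCLM_apply, ← Complex.reCLM.integral_comp_comm hi] at h2
  have h3 : ∀ a : ℝ, (Complex.exp (Complex.I * a)).re = Real.cos a := fun a => by
    rw [mul_comm, Complex.exp_ofReal_mul_I_re]
  simp only [Complex.reCLM_apply, h3] at h2
  rw [h2, ← Complex.ofReal_neg, ← Complex.ofReal_exp, Complex.re_mul_ofReal, h3, mul_assoc,
    ← Real.exp_add]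
  ring_nf

end Potential

section Smoothing

variable {d : ℕ} {γ : Space d → ℝ≥0∞} {γhat Ψ : Space d → ℝ}

/-- A nonnegative smooth compactly supported function equal to `1` on a given ball. -/
theorem exists_smooth_cutoff (d : ℕ) (R : ℝ) : ∃ φ : Space d → ℝ,
    ContDiff ℝ ((⊤ : ℕ∞) : WithTop ℕ∞) φ ∧ HasCompactSupport φ ∧ (∀ z, 0 ≤ φ z) ∧
      ∀ z, ‖z‖ ≤ R → φ z = 1 := by
  let b : ContDiffBump (0 : Space d) := ⟨|R| + 1, |R| + 2, by positivity, by linarith⟩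
  refine ⟨b, b.contDiff, b.hasCompactSupport, fun z => b.nonneg, fun z hz => ?_⟩
  refine b.one_of_mem_closedBall ?_
  simp only [mem_closedBall_zero_iff]
  show ‖z‖ ≤ |R| + 1
  linarith [le_abs_self R]

theorem IsSpatialCovariance.measurable_const_add (h : IsSpatialCovariance γ γhat) (z : Space d) :
    Measurable fun y => γ (z + y) := h.measurable.comp (by fun_prop)

theorem IsSpatialCovariance.measurable_lintegral_add (h : IsSpatialCovariance γ γhat)
    (ν : Measure (Space d)) [SFinite ν] : Measurable fun z => ∫⁻ y, γ (z + y) ∂ν :=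
  Measurable.lintegral_prod_right' (f := fun p : Space d × Space d => γ (p.1 + p.2))
    (h.measurable.comp (by fun_prop))

/-- The convolution of `γ` with a probability measure is locally integrable, as the mass that the
translates of `γ` put on a ball is bounded uniformly. -/
theorem IsSpatialCovariance.setLIntegral_ball_lt_top (h : IsSpatialCovariance γ γhat)
    (ν : Measure (Space d)) [IsProbabilityMeasure ν] (R : ℝ) :
    ∫⁻ z in Metric.closedBall (0 : Space d) R, ∫⁻ y, γ (z + y) ∂ν < ∞ := by
  obtain ⟨φ, hφ, hc, h0, h1⟩ := exists_smooth_cutoff d R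
  obtain ⟨C, hC, hCb⟩ := h.exists_lintegral_translate_le hφ hc h0
  have hm : Measurable fun p : Space d × Space d => γ (p.1 + p.2) :=
    h.measurable.comp (by fun_prop)
  calc ∫⁻ z in Metric.closedBall (0 : Space d) R, ∫⁻ y, γ (z + y) ∂ν
      = ∫⁻ z, (Metric.closedBall (0 : Space d) R).indicator
          (fun z => ∫⁻ y, γ (z + y) ∂ν) z := by
        rw [lintegral_indicator Metric.isClosed_closedBall.measurableSet]
    _ ≤ ∫⁻ z, ∫⁻ y, γ (z + y) * ENNReal.ofReal (φ z) ∂ν := by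
        refine lintegral_mono fun z => ?_
        rw [lintegral_mul_const _ (h.measurable_const_add z)]
        by_cases hz : z ∈ Metric.closedBall (0 : Space d) R
        · rw [indicator_of_mem hz, h1 z (by simpa using hz)]; simp
        · simp [indicator_of_notMem hz]
    _ = ∫⁻ y, (∫⁻ z, γ (z + y) * ENNReal.ofReal (φ z)) ∂ν := by
        rw [lintegral_lintegral_swap]
        exact (hm.mul (hφ.continuous.measurable.comp measurable_fst).ennreal_ofReal).aemeasurable
    _ ≤ ∫⁻ y, C ∂ν := lintegral_mono fun y => hCb y
    _ < ∞ := by simpa using hC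

/-- The convolution of `γ` with a law with exponent `vΨ` agrees almost everywhere with
`potential`: both have the same integrals against smooth test functions. -/
theorem IsSpatialCovariance.ae_lintegral_add_eq (h : IsSpatialCovariance γ γhat) {v : ℝ}
    (hint : Integrable (fun ξ => Real.exp (-(v * Ψ ξ))) (spectralMeasure γhat))
    {ν : Measure (Space d)} [IsProbabilityMeasure ν]
    (hν : ∀ ξ, charFun ν ξ = Complex.exp (-(v * Ψ ξ : ℝ))) :
    ∀ᵐ z, ∫⁻ y, γ (z + y) ∂ν = ENNReal.ofReal (potential γhat Ψ v z) ∧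
      0 ≤ potential γhat Ψ v z := by
  set H : Space d → ℝ≥0∞ := fun z => ∫⁻ y, γ (z + y) ∂ν with hH
  have hHm : Measurable H := h.measurable_lintegral_add ν
  have hm : Measurable fun p : Space d × Space d => γ (p.1 + p.2) :=
    h.measurable.comp (by fun_prop)
  have hHfin : ∀ᵐ z, H z < ∞ := by
    have h1 : ∀ n : ℕ, ∀ᵐ z, z ∈ Metric.closedBall (0 : Space d) n → H z < ∞ := fun n => by
      rw [← ae_restrict_iff' Metric.isClosed_closedBall.measurableSet]
      exact MeasureTheory.ae_lt_top hHm (h.setLIntegral_ball_lt_top ν n).ne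
    filter_upwards [ae_all_iff.2 h1] with z hz
    obtain ⟨n, hn⟩ := exists_nat_ge ‖z‖
    exact hz n (by simpa using hn)
  have hHloc : LocallyIntegrable (fun z => (H z).toReal) := by
    refine (locallyIntegrable_iff).2 fun K hK => ?_
    obtain ⟨R, hR⟩ := hK.isBounded.subset_closedBall 0
    exact IntegrableOn.mono_set (integrable_toReal_of_lintegral_ne_top hHm.aemeasurable
      (h.setLIntegral_ball_lt_top ν R).ne) hR
  have hHtoReal : ∀ᵐ z, (H z).toReal = ∫ y, (γ (z + y)).toReal ∂ν := by
    filter_upwards [hHfin] with z hz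
    rw [integral_toReal (h.measurable_const_add z).aemeasurable
      (MeasureTheory.ae_lt_top (h.measurable_const_add z) hz.ne)]
  have key : ∀ᵐ z, (H z).toReal = potential γhat Ψ v z := by
    refine ae_eq_of_integral_contDiff_smul_eq hHloc
      (continuous_potential hint).locallyIntegrable fun φ hφ hc => ?_
    have hc' : HasCompactSupport fun x => ((φ x : ℝ) : ℂ) :=
      hc.comp_left (g := fun r : ℝ => (r : ℂ)) rfl
    have hs' : ContDiff ℝ ((⊤ : ℕ∞) : WithTop ℕ∞) fun x => ((φ x : ℝ) : ℂ) :=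
      Complex.ofRealCLM.contDiff.comp hφ
    have hF : Integrable (fourierTransform fun x => ((φ x : ℝ) : ℂ)) (spectralMeasure γhat) :=
      integrable_fourierTransform h.tempered_hat (hc'.toSchwartzMap hs')
    set F := fourierTransform fun x => ((φ x : ℝ) : ℂ) with hFdef
    set c : ℂ := (((2 * Real.pi) ^ d : ℝ) : ℂ)⁻¹ with hcdef
    -- Fubini for the convolution side.
    have hprod : Integrable (Function.uncurry fun z y => (γ (z + y)).toReal * φ z)
        ((volume : Measure (Space d)).prod ν) := by
      obtain ⟨R, hR⟩ := hc.isBounded.subset_closedBall 0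
      obtain ⟨M, hM⟩ := hφ.continuous.bounded_above_of_compact_support hc
      refine ⟨(hm.ennreal_toReal.mul (hφ.continuous.measurable.comp
        measurable_fst)).aestronglyMeasurable, ?_⟩
      rw [HasFiniteIntegral, lintegral_prod _ (by
        exact (hm.ennreal_toReal.mul (hφ.continuous.measurable.comp
        measurable_fst)).enorm.aemeasurable)]
      calc ∫⁻ z, ∫⁻ y, ‖(γ (z + y)).toReal * φ z‖ₑ ∂ν
          ≤ ∫⁻ z, (Metric.closedBall (0 : Space d) R).indicator H z * ENNReal.ofReal M := by
            refine lintegral_mono fun z => ?_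
            by_cases hz : z ∈ tsupport φ
            · rw [indicator_of_mem (hR hz),
                hH, ← lintegral_mul_const _ (h.measurable_const_add z)]
              refine lintegral_mono fun y => ?_
              rw [enorm_mul, Real.enorm_of_nonneg ENNReal.toReal_nonneg, ← ofReal_norm (φ z)]
              gcongr
              · exact ENNReal.ofReal_toReal_le
              · exact hM z
            · simp [image_eq_zero_of_notMem_tsupport hz]
        _ < ∞ := by
            rw [lintegral_mul_const _ (hHm.indicator Metric.isClosed_closedBall.measurableSet),
              lintegral_indicator Metric.isClosed_closedBall.measurableSet]
            exact ENNReal.mul_lt_top (h.setLIntegral_ball_lt_top ν R) ENNReal.ofReal_lt_top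
    -- Fourier side of the convolution.
    have hleft : ((∫ z, φ z • (H z).toReal : ℝ) : ℂ) =
        c * ∫ ξ, Complex.exp (-(v * Ψ ξ : ℝ)) * F ξ ∂(spectralMeasure γhat) := by
      have e1 : ∫ z, φ z • (H z).toReal = ∫ y, (∫ z, (γ (z + y)).toReal * φ z) ∂ν := by
        rw [← integral_integral_swap hprod]
        refine integral_congr_ae ?_
        filter_upwards [hHtoReal] with z hz
        rw [hz, smul_eq_mul, integral_mul_const, mul_comm]
      rw [e1, ← integral_complex_ofReal]
      simp only [h.integral_translate hφ hc]
      rw [integral_const_mul, integral_integral_swap]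
      · congr 1
        refine integral_congr_ae (ae_of_all _ fun ξ => ?_)
        simp only
        rw [integral_mul_const]
        congr 1
        have := congrArg (starRingEnd ℂ) (hν ξ)
        rw [charFun_apply, ← integral_conj] at this
        rw [← Complex.ofReal_neg, ← Complex.ofReal_exp, Complex.conj_ofReal, Complex.ofReal_exp,
          Complex.ofReal_neg] at this
        rw [← this]
        refine integral_congr_ae (ae_of_all _ fun y => ?_)
        simp only
        rw [← Complex.exp_conj, map_mul, Complex.conj_I, Complex.conj_ofReal, real_inner_comm]
        ring_nf
      · refine (hF.comp_snd ν).mono (AEStronglyMeasurable.mul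
          (by fun_prop : Continuous fun p : Space d × Space d =>
            Complex.exp (-(Complex.I * ((inner ℝ p.2 p.1 : ℝ) : ℂ)))).aestronglyMeasurable
          (hF.comp_snd ν).aestronglyMeasurable) (ae_of_all _ fun p => ?_)
        simp [Function.uncurry, Complex.norm_exp]
        exact le_rfl
    -- Fourier side of the potential.
    have hright : ((∫ z, φ z • potential γhat Ψ v z : ℝ) : ℂ) =
        (((∫ ξ, Complex.exp (-(v * Ψ ξ : ℝ)) * F ξ ∂(spectralMeasure γhat)) * c).re : ℝ) := by
      have hexp : Integrable (fun ξ => Complex.exp (-(v * Ψ ξ : ℝ))) (spectralMeasure γhat) := by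
        simpa using hint.ofReal (𝕜 := ℂ)
      have hprod' : Integrable (Function.uncurry fun (z ξ : Space d) =>
          (φ z : ℂ) * (Complex.exp (-(Complex.I * ((inner ℝ z ξ : ℝ) : ℂ))) *
            Complex.exp (-(v * Ψ ξ : ℝ)))) (volume.prod (spectralMeasure γhat)) := by
        have hφi : Integrable (fun z => (φ z : ℂ)) :=
          (hφ.continuous.integrable_of_hasCompactSupport hc).ofReal
        refine (hφi.mul_prod hexp).mono ?_ (ae_of_all _ fun p => ?_)
        · refine hφi.aestronglyMeasurable.comp_fst.mul (AEStronglyMeasurable.mul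
            (by fun_prop : Continuous fun p : Space d × Space d =>
              Complex.exp (-(Complex.I * ((inner ℝ p.1 p.2 : ℝ) : ℂ)))).aestronglyMeasurable
            hexp.aestronglyMeasurable.comp_snd)
        · simp [Function.uncurry, Complex.norm_exp]
      have e1 : ∀ z, potential γhat Ψ v z = (c * ∫ ξ, Complex.exp
          (-(Complex.I * ((inner ℝ z ξ : ℝ) : ℂ))) * Complex.exp (-(v * Ψ ξ : ℝ))
            ∂(spectralMeasure γhat)).re := fun z => by
        have hi : Integrable (fun ξ => Complex.exp
          (-(Complex.I * ((inner ℝ z ξ : ℝ) : ℂ))) * Complex.exp (-(v * Ψ ξ : ℝ)))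
            (spectralMeasure γhat) := by
          refine hexp.mono (AEStronglyMeasurable.mul (Continuous.aestronglyMeasurable
            (by fun_prop)) hexp.aestronglyMeasurable) (ae_of_all _ fun ξ => ?_)
          simp [Complex.norm_exp]
        rw [hcdef, ← Complex.ofReal_inv, Complex.re_ofReal_mul, potential, ← Complex.reCLM_apply,
          ← Complex.reCLM.integral_comp_comm hi]
        congr 1
        refine integral_congr_ae (ae_of_all _ fun ξ => ?_)
        simp only [Complex.reCLM_apply]
        rw [← Complex.ofReal_neg, ← Complex.ofReal_exp, Complex.re_mul_ofReal,
          real_inner_comm, ← Real.cos_neg, ← Complex.exp_ofReal_mul_I_re]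
        push_cast
        ring_nf
      have hi2 : Integrable (fun z => (φ z : ℂ) * ∫ ξ, Complex.exp
          (-(Complex.I * ((inner ℝ z ξ : ℝ) : ℂ))) * Complex.exp (-(v * Ψ ξ : ℝ))
            ∂(spectralMeasure γhat)) := by
        simpa only [Function.uncurry, integral_const_mul] using hprod'.integral_prod_left
      have e2 : ∀ z, φ z • potential γhat Ψ v z = Complex.reCLM (((φ z : ℂ) * ∫ ξ, Complex.exp
          (-(Complex.I * ((inner ℝ z ξ : ℝ) : ℂ))) * Complex.exp (-(v * Ψ ξ : ℝ))
            ∂(spectralMeasure γhat)) * c) := fun z => by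
        rw [e1, Complex.reCLM_apply, mul_assoc, Complex.re_ofReal_mul, smul_eq_mul, mul_comm c]
      simp only [e2]
      rw [Complex.reCLM.integral_comp_comm (hi2.mul_const c), integral_mul_const]
      simp only [← integral_const_mul]
      rw [integral_integral_swap hprod', Complex.reCLM_apply]
      congr 3
      refine integral_congr_ae (ae_of_all _ fun ξ => ?_)
      simp only [hFdef, fourierTransform]
      rw [← integral_const_mul]
      refine integral_congr_ae (ae_of_all _ fun z => ?_)
      simp only
      rw [real_inner_comm]
      ring
    have := congrArg Complex.re (hleft.trans (mul_comm _ _))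
    rw [Complex.ofReal_re] at this
    exact this.trans (Complex.ofReal_injective hright).symm
  filter_upwards [key, hHfin] with z hz hz'
  rw [← hz, ENNReal.ofReal_toReal hz'.ne]
  exact ⟨rfl, ENNReal.toReal_nonneg⟩

/-- The mean of `γ(z + X_{v+w})` equals `potential` at **every** point `z`. The almost everywhere
identity at time `v` is integrated against the absolutely continuous law at time `w`. -/
theorem IsSpatialCovariance.lintegral_add_conv_eq (h : IsSpatialCovariance γ γhat) {v w : ℝ}
    (hint : Integrable (fun ξ => Real.exp (-(v * Ψ ξ))) (spectralMeasure γhat))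
    {ν ν' ν'' : Measure (Space d)} [IsProbabilityMeasure ν] [IsProbabilityMeasure ν']
    [IsProbabilityMeasure ν'']
    (hν : ∀ ξ, charFun ν ξ = Complex.exp (-(v * Ψ ξ : ℝ)))
    (hν' : ∀ ξ, charFun ν' ξ = Complex.exp (-(w * Ψ ξ : ℝ))) (hac : ν' ≪ volume)
    (hν'' : ∀ ξ, charFun ν'' ξ = Complex.exp (-((v + w) * Ψ ξ : ℝ))) (z : Space d) :
    ∫⁻ y, γ (z + y) ∂ν'' = ENNReal.ofReal (potential γhat Ψ (v + w) z) := by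
  have hconv : ν'' = ν' ∗ ν := by
    refine Measure.ext_of_charFun (funext fun ξ => ?_)
    rw [charFun_conv, hν, hν', hν'', ← Complex.exp_add]
    push_cast; ring_nf
  have hae := h.ae_lintegral_add_eq hint hν
  have hae' : ∀ᵐ a ∂ν', ∫⁻ y, γ ((z + a) + y) ∂ν =
      ENNReal.ofReal (potential γhat Ψ v (z + a)) ∧ 0 ≤ potential γhat Ψ v (z + a) :=
    hac.ae_le ((measurePreserving_add_left volume z).quasiMeasurePreserving.ae hae)
  rw [hconv, Measure.lintegral_conv (h.measurable_const_add z), ← integral_potential_add hint hν' z,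
    ofReal_integral_eq_lintegral_ofReal]
  · refine lintegral_congr_ae ?_
    filter_upwards [hae'] with a ha
    simp only [← ha.1, add_assoc]
  · refine (integrable_const (potential γhat Ψ v 0)).mono'
      ((continuous_potential hint).comp (continuous_const.add continuous_id)).aestronglyMeasurable
      (ae_of_all _ fun a => abs_potential_le hint _)
  · exact hae'.mono fun a ha => ha.2

end Smoothing

/-! ### Consequences of the spectral condition -/

theorem lintegral_Ioc_rpow_neg {β : ℝ} (hβ : β < 1) {R : ℝ} (hR : 0 ≤ R) :
    ∫⁻ u in Ioc 0 R, ENNReal.ofReal (u ^ (-β)) = ENNReal.ofReal (R ^ (1 - β) / (1 - β)) := by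
  have hi : IntervalIntegrable (fun u : ℝ => u ^ (-β)) volume 0 R :=
    intervalIntegral.intervalIntegrable_rpow' (by linarith)
  rw [← ofReal_integral_eq_lintegral_ofReal ((intervalIntegrable_iff_integrableOn_Ioc_of_le hR).1 hi)
    ((ae_restrict_iff' measurableSet_Ioc).2 (ae_of_all _ fun u hu => Real.rpow_nonneg hu.1.le _)),
    ← intervalIntegral.integral_of_le hR, integral_rpow (Or.inl (by linarith)),
    Real.zero_rpow (by linarith), sub_zero, neg_add_eq_sub]

/-- The Laplace transform of `u^{-β}` on `(0,T]` decays like `y^{β-1}`. It is the sum of two bounds: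
the integral is at most `T^{1-β}/(1-β)`, and `y^{1-β}` times the integral is at most `Γ(1-β)`. -/
theorem lintegral_rpow_mul_exp_le {β : ℝ} (hβ₁ : β < 1) {T : ℝ} (hT : 0 ≤ T) {y : ℝ}
    (hy : 0 ≤ y) :
    ∫⁻ u in Ioc 0 T, ENNReal.ofReal (u ^ (-β)) * ENNReal.ofReal (Real.exp (-(u * y))) ≤
      ENNReal.ofReal (T ^ (1 - β) / (1 - β) + Real.Gamma (1 - β)) *
        ENNReal.ofReal (1 / (1 + y ^ (1 - β))) := by
  set L := ∫⁻ u in Ioc 0 T, ENNReal.ofReal (u ^ (-β)) * ENNReal.ofReal (Real.exp (-(u * y)))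
  have hG : 0 < Real.Gamma (1 - β) := Real.Gamma_pos_of_pos (by linarith)
  have h1 : L ≤ ENNReal.ofReal (T ^ (1 - β) / (1 - β)) := by
    rw [← lintegral_Ioc_rpow_neg hβ₁ hT]
    refine setLIntegral_mono' measurableSet_Ioc fun u hu => ?_
    refine mul_le_of_le_one_right zero_le (ENNReal.ofReal_le_one.2 (Real.exp_le_one_iff.2 ?_))
    nlinarith [hu.1]
  have h2 : ENNReal.ofReal (y ^ (1 - β)) * L ≤ ENNReal.ofReal (Real.Gamma (1 - β)) := by
    rcases hy.eq_or_lt with rfl | hy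
    · simp [Real.zero_rpow (by linarith : 1 - β ≠ 0)]
    · have h3 : L ≤ ENNReal.ofReal ((1 / y) ^ (1 - β) * Real.Gamma (1 - β)) := by
        have h4 := Real.integral_rpow_mul_exp_neg_mul_Ioi (a := 1 - β) (r := y) (by linarith) hy
        have h5 : IntegrableOn (fun u : ℝ => u ^ (1 - β - 1) * Real.exp (-(y * u))) (Ioi 0) := by
          by_contra hc
          rw [integral_undef hc] at h4
          have : 0 < (1 / y) ^ (1 - β) * Real.Gamma (1 - β) := by positivity
          linarith
        rw [← h4, ofReal_integral_eq_lintegral_ofReal h5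
          ((ae_restrict_iff' measurableSet_Ioi).2 (ae_of_all _ fun u hu =>
            mul_nonneg (Real.rpow_nonneg (le_of_lt hu) _) (Real.exp_pos _).le))]
        refine (lintegral_mono_set Ioc_subset_Ioi_self).trans
          (setLIntegral_mono' measurableSet_Ioi fun u hu => ?_)
        rw [← ENNReal.ofReal_mul (Real.rpow_nonneg (le_of_lt hu) _)]
        refine ENNReal.ofReal_le_ofReal (le_of_eq ?_)
        ring_nf
      calc ENNReal.ofReal (y ^ (1 - β)) * L
          ≤ ENNReal.ofReal (y ^ (1 - β)) *
            ENNReal.ofReal ((1 / y) ^ (1 - β) * Real.Gamma (1 - β)) := by gcongr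
        _ = ENNReal.ofReal (Real.Gamma (1 - β)) := by
          rw [← ENNReal.ofReal_mul (by positivity), ← mul_assoc,
            ← Real.mul_rpow hy.le (by positivity), mul_one_div_cancel hy.ne', Real.one_rpow,
            one_mul]
  have hp : 0 < 1 + y ^ (1 - β) := by positivity
  rw [one_div, ENNReal.ofReal_inv_of_pos hp, ← div_eq_mul_inv, ENNReal.le_div_iff_mul_le
    (Or.inl (by simpa using hp)) (Or.inl ENNReal.ofReal_ne_top),
    ENNReal.ofReal_add zero_le_one (by positivity), ENNReal.ofReal_add
      (div_nonneg (by positivity) (by linarith)) hG.le, mul_add, ENNReal.ofReal_one, mul_one,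
      mul_comm L]
  exact add_le_add h1 h2

section SpectralCondition

variable {d : ℕ} {β₀ : ℝ} {γhat Ψ : Space d → ℝ}

theorem SpectralCondition.integrable_exp (hβ₀ : 0 < β₀) (hβ₁ : β₀ < 1) (hm : Measurable Ψ)
    (h0 : ∀ ξ, 0 ≤ Ψ ξ) (hI : SpectralCondition β₀ Ψ (spectralMeasure γhat)) {v : ℝ}
    (hv : 0 < v) : Integrable (fun ξ => Real.exp (-(v * Ψ ξ))) (spectralMeasure γhat) := by
  have hint : Integrable (fun ξ => 1 / (1 + Ψ ξ ^ (1 - β₀))) (spectralMeasure γhat) := by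
    refine ⟨Measurable.aestronglyMeasurable (by fun_prop), ?_⟩
    rw [hasFiniteIntegral_iff_ofReal (ae_of_all _ fun ξ => by have := h0 ξ; positivity)]
    exact hI
  refine (hint.const_mul (2 + 1 / v)).mono' (by fun_prop) (ae_of_all _ fun ξ => ?_)
  have hy := h0 ξ
  set y := Ψ ξ
  have hp : 0 < 1 + y ^ (1 - β₀) := by positivity
  rw [Real.norm_of_nonneg (Real.exp_pos _).le, mul_one_div, le_div_iff₀ hp]
  have h1 : y ^ (1 - β₀) ≤ 1 + y := by
    have := Real.rpow_le_rpow hy (by linarith : y ≤ 1 + y) (by linarith : 0 ≤ 1 - β₀)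
    refine this.trans ?_
    simpa using Real.rpow_le_rpow_of_exponent_le (by linarith : 1 ≤ 1 + y)
      (by linarith : 1 - β₀ ≤ 1)
  have h2 : Real.exp (-(v * y)) ≤ 1 := Real.exp_le_one_iff.2 (by nlinarith)
  have h3 : Real.exp (-(v * y)) * y ≤ 1 / v := by
    rw [Real.exp_neg, ← div_eq_inv_mul, div_le_div_iff₀ (Real.exp_pos _) hv]
    nlinarith [Real.add_one_le_exp (v * y)]
  nlinarith [Real.exp_pos (-(v * y))]

theorem ofReal_potential_zero {v : ℝ}
    (hint : Integrable (fun ξ => Real.exp (-(v * Ψ ξ))) (spectralMeasure γhat)) :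
    ENNReal.ofReal (potential γhat Ψ v 0) = ENNReal.ofReal ((2 * Real.pi) ^ d)⁻¹ *
      ∫⁻ ξ, ENNReal.ofReal (Real.exp (-(v * Ψ ξ))) ∂(spectralMeasure γhat) := by
  rw [potential, ENNReal.ofReal_mul (by positivity)]
  simp only [inner_zero_right, Real.cos_zero, one_mul]
  rw [ofReal_integral_eq_lintegral_ofReal hint (ae_of_all _ fun ξ => (Real.exp_pos _).le)]

/-- The spectral condition says exactly that `u^{-β₀} E γ(X_u)` is integrable at `u = 0`. -/
theorem SpectralCondition.lintegral_rpow_mul_potential_lt_top (hβ₀ : 0 < β₀) (hβ₁ : β₀ < 1)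
    (hm : Measurable Ψ) (h0 : ∀ ξ, 0 ≤ Ψ ξ)
    (hI : SpectralCondition β₀ Ψ (spectralMeasure γhat)) {T : ℝ} (hT : 0 ≤ T) :
    ∫⁻ u in Ioc 0 T, ENNReal.ofReal (u ^ (-β₀)) * ENNReal.ofReal (potential γhat Ψ u 0) < ∞ := by
  have h1 : ∀ u ∈ Ioc 0 T, ENNReal.ofReal (u ^ (-β₀)) * ENNReal.ofReal (potential γhat Ψ u 0) =
      ENNReal.ofReal ((2 * Real.pi) ^ d)⁻¹ * ∫⁻ ξ, ENNReal.ofReal (u ^ (-β₀)) *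
        ENNReal.ofReal (Real.exp (-(u * Ψ ξ))) ∂(spectralMeasure γhat) := fun u hu => by
    rw [ofReal_potential_zero (hI.integrable_exp hβ₀ hβ₁ hm h0 hu.1),
      lintegral_const_mul _ (by fun_prop), mul_left_comm]
  rw [setLIntegral_congr_fun measurableSet_Ioc h1, lintegral_const_mul'' _ (by
    exact AEMeasurable.lintegral_prod_right' (f := fun p : ℝ × Space d => ENNReal.ofReal
      (p.1 ^ (-β₀)) * ENNReal.ofReal (Real.exp (-(p.1 * Ψ p.2)))) (by fun_prop)),
    lintegral_lintegral_swap (by fun_prop)]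
  refine ENNReal.mul_lt_top ENNReal.ofReal_lt_top ?_
  refine (lintegral_mono fun ξ => lintegral_rpow_mul_exp_le hβ₁ hT (h0 ξ)).trans_lt ?_
  rw [lintegral_const_mul _ (by fun_prop)]
  exact ENNReal.mul_lt_top ENNReal.ofReal_lt_top hI

end SpectralCondition

/-! ### Averages against mollifiers -/

/-- Averages against probability measures that concentrate at a point of continuity converge to the
value there. No bound on `h` is needed, as each measure is eventually carried by a neighbourhood on
which `h` is close to `h x₀`; the value `∞` is allowed. -/
theorem tendsto_lintegral_of_shrinking {ι E : Type*} {l : Filter ι} [TopologicalSpace E]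
    [MeasurableSpace E] {m : ι → Measure E} (hm : ∀ᶠ i in l, IsProbabilityMeasure (m i)) {x₀ : E}
    (hs : ∀ U ∈ 𝓝 x₀, ∀ᶠ i in l, ∀ᵐ x ∂(m i), x ∈ U) {h : E → ℝ≥0∞} (hc : ContinuousAt h x₀) :
    Tendsto (fun i => ∫⁻ x, h x ∂(m i)) l (𝓝 (h x₀)) := by
  refine tendsto_order.2 ⟨fun c hlt => ?_, fun c hlt => ?_⟩
  · obtain ⟨c', hc1, hc2⟩ := exists_between hlt
    filter_upwards [hm, hs _ (hc (lt_mem_nhds hc2))] with i hi hU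
    refine hc1.trans_le ?_
    calc c' = ∫⁻ _, c' ∂(m i) := by simp
      _ ≤ _ := lintegral_mono_ae (hU.mono fun x hx => le_of_lt hx)
  · obtain ⟨c', hc1, hc2⟩ := exists_between hlt
    filter_upwards [hm, hs _ (hc (gt_mem_nhds hc1))] with i hi hU
    refine lt_of_le_of_lt ?_ hc2
    calc ∫⁻ x, h x ∂(m i) ≤ ∫⁻ _, c' ∂(m i) := lintegral_mono_ae (hU.mono fun x hx => le_of_lt hx)
      _ = c' := by simp

theorem measurable_timeMollifier (δ : ℝ) : Measurable (timeMollifier δ) :=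
  measurable_const.indicator measurableSet_Icc

theorem timeMollifier_nonneg {δ : ℝ} (hδ : 0 < δ) (r : ℝ) : 0 ≤ timeMollifier δ r :=
  indicator_nonneg (fun _ _ => by positivity) _

/-- The probability measure with density `g_δ`. -/
noncomputable def timeAvg (δ : ℝ) : Measure ℝ :=
  volume.withDensity fun a => ENNReal.ofReal (timeMollifier δ a)

theorem lintegral_timeAvg (δ : ℝ) (f : ℝ → ℝ≥0∞) :
    ∫⁻ a, f a ∂(timeAvg δ) = ENNReal.ofReal δ⁻¹ * ∫⁻ a in Icc 0 δ, f a := by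
  have : (fun a => ENNReal.ofReal (timeMollifier δ a)) =
      (Icc 0 δ).indicator fun _ => ENNReal.ofReal δ⁻¹ := by
    funext a
    by_cases ha : a ∈ Icc 0 δ <;> simp [timeMollifier, ha]
  rw [timeAvg, this, withDensity_indicator measurableSet_Icc, withDensity_const,
    lintegral_smul_measure, smul_eq_mul]

theorem isProbabilityMeasure_timeAvg {δ : ℝ} (hδ : 0 < δ) : IsProbabilityMeasure (timeAvg δ) := by
  refine ⟨?_⟩
  rw [← lintegral_one, lintegral_timeAvg]
  simp [← ENNReal.ofReal_mul (inv_pos.2 hδ).le, hδ.ne']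

instance (δ : ℝ) : SFinite (timeAvg δ) := by unfold timeAvg; infer_instance

theorem timeAvg_ae_mem {δ : ℝ} : ∀ᵐ a ∂(timeAvg δ), a ∈ Icc 0 δ := by
  rw [timeAvg, ae_withDensity_iff (measurable_timeMollifier δ).ennreal_ofReal]
  refine ae_of_all _ fun a ha => ?_
  by_contra hc
  simp [timeMollifier, hc] at ha

theorem lintegral_Icc_abs_rpow_neg_le {β : ℝ} (hβ : β < 1) {R : ℝ} (hR : 0 ≤ R) :
    ∫⁻ c in Icc (-R) R, ENNReal.ofReal (|c| ^ (-β)) ≤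
      ENNReal.ofReal (2 * (R ^ (1 - β) / (1 - β))) := by
  have h1 : ∫⁻ c in Ioc 0 R, ENNReal.ofReal (|c| ^ (-β)) =
      ENNReal.ofReal (R ^ (1 - β) / (1 - β)) := by
    rw [← lintegral_Ioc_rpow_neg hβ hR]
    refine setLIntegral_congr_fun measurableSet_Ioc fun c hc => ?_
    simp only [abs_of_pos hc.1]
  have h2 : ∫⁻ c in Ico (-R) 0, ENNReal.ofReal (|c| ^ (-β)) =
      ENNReal.ofReal (R ^ (1 - β) / (1 - β)) := by
    rw [← h1]
    have := (Measure.measurePreserving_neg (volume : Measure ℝ)).setLIntegral_comp_preimage_emb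
      (Homeomorph.neg ℝ).measurableEmbedding (fun c => ENNReal.ofReal (|c| ^ (-β))) (Ioc 0 R)
    simpa using this
  have hsub : Icc (-R) R ⊆ (Ico (-R) 0 ∪ Ioc 0 R) ∪ {0} := fun c hc => by
    rcases lt_trichotomy c 0 with h | h | h
    · exact Or.inl (Or.inl ⟨hc.1, h⟩)
    · exact Or.inr h
    · exact Or.inl (Or.inr ⟨h, hc.2⟩)
  calc ∫⁻ c in Icc (-R) R, ENNReal.ofReal (|c| ^ (-β))
      ≤ ∫⁻ c in (Ico (-R) 0 ∪ Ioc 0 R) ∪ {0}, ENNReal.ofReal (|c| ^ (-β)) :=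
        lintegral_mono_set hsub
    _ ≤ ((∫⁻ c in Ico (-R) 0, ENNReal.ofReal (|c| ^ (-β))) +
          ∫⁻ c in Ioc 0 R, ENNReal.ofReal (|c| ^ (-β))) +
          ∫⁻ c in {0}, ENNReal.ofReal (|c| ^ (-β)) :=
        (lintegral_union_le _ _ _).trans (add_le_add_left (lintegral_union_le _ _ _) _)
    _ = _ := by
        rw [h1, h2, ← ENNReal.ofReal_add (by have : 0 < 1 - β := by linarith
                                             positivity) (by have : 0 < 1 - β := by linarith
                                                             positivity)]
        simp [two_mul]

/-- Averaging `|·|^{-β}` over `[w - δ, w]` costs at most a constant factor, uniformly in `δ`. -/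
theorem exists_lintegral_timeAvg_le {β : ℝ} (hβ₀ : 0 < β) (hβ₁ : β < 1) : ∃ C : ℝ≥0∞, C < ∞ ∧
    ∀ δ : ℝ, 0 < δ → ∀ w : ℝ, w ≠ 0 →
      ∫⁻ a, ENNReal.ofReal (|w - a| ^ (-β)) ∂(timeAvg δ) ≤ C * ENNReal.ofReal (|w| ^ (-β)) := by
  refine ⟨ENNReal.ofReal (2 ^ β * (6 / (1 - β))), ENNReal.ofReal_lt_top, fun δ hδ w hw => ?_⟩
  have hβ : 0 < 1 - β := by linarith
  have hw' : 0 < |w| := abs_pos.2 hw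
  have hhalf : (|w| / 2) ^ (-β) = 2 ^ β * |w| ^ (-β) := by
    rw [Real.div_rpow hw'.le (by norm_num), Real.rpow_neg (by norm_num : (0 : ℝ) ≤ 2)]
    field_simp
  have h6 : 1 ≤ 6 / (1 - β) := by rw [le_div_iff₀ hβ]; linarith
  rw [← ENNReal.ofReal_mul (by positivity)]
  -- For `δ ≤ |w|/2` the interval `[w - δ, w]` stays at distance `|w|/2` from the singularity; otherwise
  -- it lies in `[-3δ, 3δ]`, where `|·|^{-β}` has mean of order `δ^{-β}`.
  rcases le_or_gt δ (|w| / 2) with hle | hlt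
  · have := isProbabilityMeasure_timeAvg hδ
    calc ∫⁻ a, ENNReal.ofReal (|w - a| ^ (-β)) ∂(timeAvg δ)
        ≤ ∫⁻ _, ENNReal.ofReal ((|w| / 2) ^ (-β)) ∂(timeAvg δ) := by
          refine lintegral_mono_ae (timeAvg_ae_mem.mono fun a ha => ?_)
          refine ENNReal.ofReal_le_ofReal
            (Real.rpow_le_rpow_of_nonpos (by positivity) ?_ (by linarith))
          have := abs_sub_abs_le_abs_sub w a
          rw [abs_of_nonneg ha.1] at this
          linarith [ha.2]
      _ = ENNReal.ofReal ((|w| / 2) ^ (-β)) := by simp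
      _ ≤ _ := by
          refine ENNReal.ofReal_le_ofReal ?_
          rw [hhalf, mul_right_comm]
          exact le_mul_of_one_le_right (by positivity) h6
  · rw [lintegral_timeAvg]
    have h1 : ∫⁻ a in Icc 0 δ, ENNReal.ofReal (|w - a| ^ (-β)) ≤
        ∫⁻ c in Icc (-(3 * δ)) (3 * δ), ENNReal.ofReal (|c| ^ (-β)) := by
      have := (Measure.measurePreserving_sub_left (volume : Measure ℝ)
        w).setLIntegral_comp_preimage_emb (Homeomorph.subLeft w).measurableEmbedding
        (fun c => ENNReal.ofReal (|c| ^ (-β))) (Icc (-(3 * δ)) (3 * δ))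
      rw [← this]
      refine lintegral_mono_set fun a ha => ?_
      have := abs_le.1 (by linarith : |w| ≤ 2 * δ)
      exact ⟨by linarith [ha.1, ha.2], by linarith [ha.1, ha.2]⟩
    calc ENNReal.ofReal δ⁻¹ * ∫⁻ a in Icc 0 δ, ENNReal.ofReal (|w - a| ^ (-β))
        ≤ ENNReal.ofReal δ⁻¹ * ENNReal.ofReal (2 * ((3 * δ) ^ (1 - β) / (1 - β))) := by
          gcongr
          exact h1.trans (lintegral_Icc_abs_rpow_neg_le hβ₁ (by positivity))
      _ ≤ _ := by
          rw [← ENNReal.ofReal_mul (by positivity)]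
          refine ENNReal.ofReal_le_ofReal ?_
          have e1 : (3 * δ) ^ (1 - β) = 3 * δ * (3 * δ) ^ (-β) := by
            rw [sub_eq_add_neg, Real.rpow_add (by positivity), Real.rpow_one]
          have e2 : (3 * δ) ^ (-β) ≤ (|w| / 2) ^ (-β) :=
            Real.rpow_le_rpow_of_nonpos (by positivity) (by linarith) (by linarith)
          rw [e1]
          calc δ⁻¹ * (2 * (3 * δ * (3 * δ) ^ (-β) / (1 - β)))
              = (3 * δ) ^ (-β) * (6 / (1 - β)) := by field_simp; ring
            _ ≤ (|w| / 2) ^ (-β) * (6 / (1 - β)) := by gcongr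
            _ = _ := by rw [hhalf]; ring

/-! ### Mollified time and space kernels -/

/-- The mollified time kernel: `|·|^{-β}` averaged over `t - s - [0,δ]` and `t - r - [0,δ']`, with
both points restricted to `[0,t]`. -/
noncomputable def timeKernel (β t δ δ' s r : ℝ) : ℝ≥0∞ :=
  ∫⁻ p, (Icc 0 t).indicator 1 (t - s - p.1) * (Icc 0 t).indicator 1 (t - r - p.2) *
    ENNReal.ofReal (|(t - s - p.1) - (t - r - p.2)| ^ (-β)) ∂((timeAvg δ).prod (timeAvg δ'))

theorem measurable_timeKernel (β t δ δ' : ℝ) :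
    Measurable fun p : ℝ × ℝ => timeKernel β t δ δ' p.1 p.2 := by
  unfold timeKernel
  have h1 : Measurable ((Icc 0 t).indicator (1 : ℝ → ℝ≥0∞)) :=
    measurable_one.indicator measurableSet_Icc
  refine Measurable.lintegral_prod_right' (f := fun q : (ℝ × ℝ) × (ℝ × ℝ) =>
    (Icc 0 t).indicator 1 (t - q.1.1 - q.2.1) * (Icc 0 t).indicator 1 (t - q.1.2 - q.2.2) *
    ENNReal.ofReal (|(t - q.1.1 - q.2.1) - (t - q.1.2 - q.2.2)| ^ (-β))) ?_
  refine ((h1.comp (by fun_prop)).mul (h1.comp (by fun_prop))).mul (by fun_prop)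

/-- The mollified time kernel is at most a constant multiple of `|s-r|^{-β}`,
uniformly in `δ`, `δ'`; the bound for one average is applied twice. -/
theorem exists_timeKernel_le {β : ℝ} (hβ₀ : 0 < β) (hβ₁ : β < 1) : ∃ C : ℝ≥0∞, C < ∞ ∧
    ∀ t δ δ' : ℝ, 0 < δ → 0 < δ' → ∀ s r : ℝ, s ≠ r →
      timeKernel β t δ δ' s r ≤ C * ENNReal.ofReal (|s - r| ^ (-β)) := by
  obtain ⟨C, hC, hCb⟩ := exists_lintegral_timeAvg_le hβ₀ hβ₁
  refine ⟨C * C, ENNReal.mul_lt_top hC hC, fun t δ δ' hδ hδ' s r hsr => ?_⟩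
  calc timeKernel β t δ δ' s r
      ≤ ∫⁻ p, ENNReal.ofReal (|(r - s + p.2) - p.1| ^ (-β)) ∂((timeAvg δ).prod (timeAvg δ')) := by
        refine lintegral_mono fun p => ?_
        rw [show (t - s - p.1) - (t - r - p.2) = (r - s + p.2) - p.1 by ring]
        refine mul_le_of_le_one_left zero_le (mul_le_one' ?_ ?_) <;>
        exact indicator_le_self' (fun _ _ => zero_le) _
    _ = ∫⁻ b, ∫⁻ a, ENNReal.ofReal (|(r - s + b) - a| ^ (-β)) ∂(timeAvg δ) ∂(timeAvg δ') := by
        rw [lintegral_prod_symm _ (by fun_prop)]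
    _ ≤ ∫⁻ b, C * ENNReal.ofReal (|(s - r) - b| ^ (-β)) ∂(timeAvg δ') := by
        have hne : ∀ᵐ b ∂(timeAvg δ'), b ≠ s - r :=
          (withDensity_absolutelyContinuous _ _).ae_le (Measure.ae_ne volume (s - r))
        refine lintegral_mono_ae (hne.mono fun b hb => ?_)
        rw [show |(s - r) - b| = |r - s + b| by rw [← abs_neg]; ring_nf]
        exact hCb δ hδ _ fun h => hb (by linarith)
    _ ≤ _ := by
        rw [lintegral_const_mul _ (by fun_prop), mul_assoc]
        gcongr
        exact hCb δ' hδ' _ (sub_ne_zero.2 hsr)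

/-- Off the diagonal and inside `(0,t)` the mollified time kernel converges to `|s-r|^{-β}`; the
restriction to `[0,t]` is immaterial for small `δ`, `δ'`. -/
theorem tendsto_timeKernel {β t s r : ℝ} (hs : s ∈ Ioo 0 t) (hr : r ∈ Ioo 0 t) (hsr : s ≠ r) :
    Tendsto (fun q : ℝ × ℝ => timeKernel β t q.1 q.2 s r) (𝓝[>] 0 ×ˢ 𝓝[>] 0)
      (𝓝 (ENNReal.ofReal (|s - r| ^ (-β)))) := by
  have hpos : ∀ᶠ q : ℝ × ℝ in 𝓝[>] 0 ×ˢ 𝓝[>] 0, 0 < q.1 ∧ 0 < q.2 :=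
    (eventually_mem_nhdsWithin (a := (0 : ℝ)) (s := Ioi 0)).prod_mk
      (eventually_mem_nhdsWithin (a := (0 : ℝ)) (s := Ioi 0))
  have hkey := tendsto_lintegral_of_shrinking (l := (𝓝[>] (0 : ℝ)) ×ˢ (𝓝[>] (0 : ℝ)))
    (m := fun q : ℝ × ℝ => (timeAvg q.1).prod (timeAvg q.2)) (x₀ := (0, 0))
    (h := fun p : ℝ × ℝ => (Icc 0 t).indicator 1 (t - s - p.1) *
      (Icc 0 t).indicator 1 (t - r - p.2) *
      ENNReal.ofReal (|(t - s - p.1) - (t - r - p.2)| ^ (-β))) ?_ ?_ ?_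
  · convert! hkey using 2
    rw [indicator_of_mem (by constructor <;> linarith [hs.1, hs.2]),
      indicator_of_mem (by constructor <;> linarith [hr.1, hr.2])]
    simp only [Pi.one_apply, one_mul, sub_zero]
    rw [← abs_neg]; ring_nf
  · filter_upwards [hpos] with q hq
    have := isProbabilityMeasure_timeAvg hq.1
    have := isProbabilityMeasure_timeAvg hq.2
    infer_instance
  · intro U hU
    obtain ⟨η, hη, hηU⟩ := Metric.mem_nhds_iff.1 hU
    have hlt : ∀ᶠ q : ℝ × ℝ in 𝓝[>] 0 ×ˢ 𝓝[>] 0, q.1 < η ∧ q.2 < η :=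
      ((eventually_lt_nhds hη).filter_mono nhdsWithin_le_nhds).prod_mk
        ((eventually_lt_nhds hη).filter_mono nhdsWithin_le_nhds)
    filter_upwards [hlt] with q hq
    have h1 : ∀ᵐ p ∂((timeAvg q.1).prod (timeAvg q.2)), p.1 ∈ Icc 0 q.1 :=
      Measure.quasiMeasurePreserving_fst.ae timeAvg_ae_mem
    have h2 : ∀ᵐ p ∂((timeAvg q.1).prod (timeAvg q.2)), p.2 ∈ Icc 0 q.2 :=
      Measure.quasiMeasurePreserving_snd.ae timeAvg_ae_mem
    filter_upwards [h1, h2] with p hp1 hp2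
    refine hηU ?_
    rw [Metric.mem_ball, Prod.dist_eq, max_lt_iff, Real.dist_eq, Real.dist_eq, sub_zero, sub_zero,
      abs_of_nonneg hp1.1, abs_of_nonneg hp2.1]
    exact ⟨hp1.2.trans_lt hq.1, hp2.2.trans_lt hq.2⟩
  · have hc : ContinuousAt (fun p : ℝ × ℝ =>
        ENNReal.ofReal (|(t - s - p.1) - (t - r - p.2)| ^ (-β))) (0, 0) := by
      refine ENNReal.continuous_ofReal.continuousAt.comp (ContinuousAt.rpow_const
        (by fun_prop) (Or.inl ?_))
      simp only [sub_zero]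
      exact abs_ne_zero.2 fun h => hsr (by linarith)
    refine hc.congr ?_
    have h1 : ∀ᶠ p : ℝ × ℝ in 𝓝 (0, 0), t - s - p.1 ∈ Icc 0 t := by
      have : ContinuousAt (fun p : ℝ × ℝ => t - s - p.1) (0, 0) := by fun_prop
      exact this.eventually_mem (Icc_mem_nhds (by simp; linarith [hs.2]) (by simp; linarith [hs.1]))
    have h2 : ∀ᶠ p : ℝ × ℝ in 𝓝 (0, 0), t - r - p.2 ∈ Icc 0 t := by
      have : ContinuousAt (fun p : ℝ × ℝ => t - r - p.2) (0, 0) := by fun_prop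
      exact this.eventually_mem (Icc_mem_nhds (by simp; linarith [hr.2]) (by simp; linarith [hr.1]))
    filter_upwards [h1, h2] with p hp1 hp2
    simp [indicator_of_mem hp1, indicator_of_mem hp2]

section SpaceAvg

variable {d : ℕ} {ρ : Space d → ℝ}

theorem IsMollifier.continuous (hρ : IsMollifier ρ) : Continuous ρ := hρ.smooth.continuous

theorem IsMollifier.continuous_spaceMollifier (hρ : IsMollifier ρ) (ε : ℝ) :
    Continuous (spaceMollifier ρ ε) :=
  continuous_const.mul (hρ.continuous.comp (continuous_const_smul _))

theorem IsMollifier.spaceMollifier_nonneg (hρ : IsMollifier ρ) {ε : ℝ} (hε : 0 < ε) (z : Space d) :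
    0 ≤ spaceMollifier ρ ε z := mul_nonneg (by positivity) (hρ.nonneg _)

theorem IsMollifier.exists_radius (hρ : IsMollifier ρ) :
    ∃ R : ℝ, 0 < R ∧ ∀ ε : ℝ, 0 < ε → ∀ z, ε * R < ‖z‖ → spaceMollifier ρ ε z = 0 := by
  obtain ⟨R, hR⟩ := hρ.compactSupport.isBounded.subset_closedBall 0
  refine ⟨|R| + 1, by positivity, fun ε hε z hz => ?_⟩
  have : ε⁻¹ • z ∉ tsupport ρ := fun h => by
    have := hR h
    rw [mem_closedBall_zero_iff, norm_smul, norm_inv, Real.norm_of_nonneg hε.le,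
      inv_mul_le_iff₀ hε] at this
    nlinarith [le_abs_self R]
  rw [spaceMollifier, image_eq_zero_of_notMem_tsupport this, mul_zero]

theorem IsMollifier.exists_bound (hρ : IsMollifier ρ) {ε : ℝ} (hε : 0 < ε) :
    ∃ M : ℝ, 0 < M ∧ ∀ z, spaceMollifier ρ ε z ≤ M := by
  obtain ⟨M, hM⟩ := hρ.continuous.bounded_above_of_compact_support hρ.compactSupport
  refine ⟨(ε ^ d)⁻¹ * (|M| + 1), by positivity, fun z => ?_⟩
  refine mul_le_mul_of_nonneg_left ?_ (by positivity)
  linarith [le_abs_self (ρ (ε⁻¹ • z)), hM (ε⁻¹ • z), Real.norm_eq_abs (ρ (ε⁻¹ • z)), le_abs_self M]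

/-- The measure with density `ρ_ε`. -/
noncomputable def spaceAvg (ρ : Space d → ℝ) (ε : ℝ) : Measure (Space d) :=
  volume.withDensity fun a => ENNReal.ofReal (spaceMollifier ρ ε a)

instance (ρ : Space d → ℝ) (ε : ℝ) : SFinite (spaceAvg ρ ε) := by unfold spaceAvg; infer_instance

theorem IsMollifier.isProbabilityMeasure_spaceAvg (hρ : IsMollifier ρ) {ε : ℝ} (hε : 0 < ε) :
    IsProbabilityMeasure (spaceAvg ρ ε) := by
  refine ⟨?_⟩
  have hi : Integrable ρ := hρ.continuous.integrable_of_hasCompactSupport hρ.compactSupport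
  have h1 : Integrable (spaceMollifier ρ ε) :=
    (hi.comp_smul (inv_ne_zero hε.ne')).const_mul _
  rw [spaceAvg, withDensity_apply _ MeasurableSet.univ, Measure.restrict_univ,
    ← ofReal_integral_eq_lintegral_ofReal h1 (ae_of_all _ (hρ.spaceMollifier_nonneg hε))]
  simp only [spaceMollifier]
  rw [integral_const_mul, Measure.integral_comp_inv_smul, hρ.integral_eq_one]
  simp [abs_of_pos (pow_pos hε d), (pow_pos hε d).ne']

theorem IsMollifier.spaceAvg_ae_norm_le {R ε : ℝ}
    (hR : ∀ z, ε * R < ‖z‖ → spaceMollifier ρ ε z = 0) (hρ : IsMollifier ρ) :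
    ∀ᵐ a ∂(spaceAvg ρ ε), ‖a‖ ≤ ε * R := by
  rw [spaceAvg, ae_withDensity_iff (hρ.continuous_spaceMollifier ε).measurable.ennreal_ofReal]
  refine ae_of_all _ fun a ha => ?_
  by_contra hc
  simp [hR a (not_le.1 hc)] at ha

/-- Averages against `ρ_ε ⊗ ρ_ε'` converge to the value at the origin. -/
theorem IsMollifier.tendsto_lintegral (hρ : IsMollifier ρ) {h : Space d × Space d → ℝ≥0∞}
    (hc : ContinuousAt h (0, 0)) :
    Tendsto (fun q : ℝ × ℝ => ∫⁻ p, h p ∂((spaceAvg ρ q.1).prod (spaceAvg ρ q.2)))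
      (𝓝[>] 0 ×ˢ 𝓝[>] 0) (𝓝 (h (0, 0))) := by
  have hpos : ∀ᶠ q : ℝ × ℝ in 𝓝[>] 0 ×ˢ 𝓝[>] 0, 0 < q.1 ∧ 0 < q.2 :=
    (eventually_mem_nhdsWithin (a := (0 : ℝ)) (s := Ioi 0)).prod_mk
      (eventually_mem_nhdsWithin (a := (0 : ℝ)) (s := Ioi 0))
  refine tendsto_lintegral_of_shrinking ?_ ?_ hc
  · filter_upwards [hpos] with q hq
    have := hρ.isProbabilityMeasure_spaceAvg hq.1
    have := hρ.isProbabilityMeasure_spaceAvg hq.2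
    infer_instance
  · intro U hU
    obtain ⟨η, hη, hηU⟩ := Metric.mem_nhds_iff.1 hU
    obtain ⟨R, hR0, hR⟩ := hρ.exists_radius
    have hlt : ∀ᶠ q : ℝ × ℝ in 𝓝[>] 0 ×ˢ 𝓝[>] 0, q.1 < η / R ∧ q.2 < η / R :=
      ((eventually_lt_nhds (div_pos hη hR0)).filter_mono nhdsWithin_le_nhds).prod_mk
        ((eventually_lt_nhds (div_pos hη hR0)).filter_mono nhdsWithin_le_nhds)
    filter_upwards [hlt, hpos] with q hq hq0
    have h1 : ∀ᵐ p ∂((spaceAvg ρ q.1).prod (spaceAvg ρ q.2)), ‖p.1‖ ≤ q.1 * R :=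
      Measure.quasiMeasurePreserving_fst.ae (hρ.spaceAvg_ae_norm_le (hR q.1 hq0.1))
    have h2 : ∀ᵐ p ∂((spaceAvg ρ q.1).prod (spaceAvg ρ q.2)), ‖p.2‖ ≤ q.2 * R :=
      Measure.quasiMeasurePreserving_snd.ae (hρ.spaceAvg_ae_norm_le (hR q.2 hq0.2))
    filter_upwards [h1, h2] with p hp1 hp2
    refine hηU ?_
    rw [lt_div_iff₀ hR0, lt_div_iff₀ hR0] at hq
    rw [Metric.mem_ball, Prod.dist_eq, max_lt_iff, dist_zero_right, dist_zero_right]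
    exact ⟨hp1.trans_lt hq.1, hp2.trans_lt hq.2⟩

/-- The spatial covariance mollified by `ρ_ε` in one variable and `ρ_ε'` in the other. -/
noncomputable def spaceKernel (γ : Space d → ℝ≥0∞) (ρ : Space d → ℝ) (ε ε' : ℝ) (w : Space d) :
    ℝ≥0∞ :=
  ∫⁻ q, γ (w - q.1 + q.2) ∂((spaceAvg ρ ε).prod (spaceAvg ρ ε'))

theorem measurable_spaceKernel {γ : Space d → ℝ≥0∞} (hγ : Measurable γ) (ε ε' : ℝ) :
    Measurable (spaceKernel γ ρ ε ε') :=
  Measurable.lintegral_prod_right' (f := fun q : Space d × (Space d × Space d) =>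
    γ (q.1 - q.2.1 + q.2.2)) (hγ.comp (by fun_prop))

theorem IsMollifier.tendsto_spaceKernel (hρ : IsMollifier ρ) {γ : Space d → ℝ≥0∞}
    (hγ : Continuous γ) (w : Space d) :
    Tendsto (fun q : ℝ × ℝ => spaceKernel γ ρ q.1 q.2 w) (𝓝[>] 0 ×ˢ 𝓝[>] 0) (𝓝 (γ w)) := by
  have := hρ.tendsto_lintegral (h := fun p : Space d × Space d => γ (w - p.1 + p.2))
    (by fun_prop)
  simpa [spaceKernel] using this

end SpaceAvg

/-! ### Inner products of the approximating integrands -/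

theorem lintegral_prod_prod_mul {α β : Type*} [MeasurableSpace α] [MeasurableSpace β]
    (μ : Measure α) (ν : Measure β) [SFinite μ] [SFinite ν] {A : α × α → ℝ≥0∞} {B : β × β → ℝ≥0∞}
    (hA : Measurable A) (hB : Measurable B) :
    ∫⁻ z, A (z.1.1, z.2.1) * B (z.1.2, z.2.2) ∂((μ.prod ν).prod (μ.prod ν)) =
      (∫⁻ p, A p ∂(μ.prod μ)) * ∫⁻ q, B q ∂(ν.prod ν) := by
  rw [lintegral_prod _ (by fun_prop), lintegral_prod _ hA.aemeasurable,
    lintegral_prod _ hB.aemeasurable, ← lintegral_prod_mul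
    (hA.lintegral_prod_right').aemeasurable (hB.lintegral_prod_right').aemeasurable]
  refine lintegral_congr fun z => ?_
  exact lintegral_prod_mul (f := fun a => A (z.1, a)) (g := fun b => B (z.2, b))
    (hA.comp measurable_prodMk_left).aemeasurable (hB.comp measurable_prodMk_left).aemeasurable

instance (d : ℕ) : SFinite (spaceTime d) := by unfold spaceTime; infer_instance

/-- The quadruple integral defining the inner product of the noise, with values in `[0,∞]`. -/
noncomputable def noiseLIntegral {d : ℕ} (β₀ : ℝ) (γ : Space d → ℝ≥0∞)
    (φ ψ : ℝ × Space d → ℝ) : ℝ≥0∞ :=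
  ∫⁻ z, ‖φ z.1‖ₑ * ‖ψ z.2‖ₑ * ENNReal.ofReal (|z.1.1 - z.2.1| ^ (-β₀)) * γ (z.1.2 - z.2.2)
    ∂((spaceTime d).prod (spaceTime d))

theorem mem_noiseDomain {d : ℕ} {β₀ : ℝ} {γ : Space d → ℝ≥0∞} {φ : ℝ × Space d → ℝ} :
    φ ∈ noiseDomain β₀ γ ↔ Measurable φ ∧ noiseLIntegral β₀ γ φ φ < ∞ := Iff.rfl

section Domination

variable {d : ℕ} {β₀ : ℝ} {γ : Space d → ℝ≥0∞}

theorem noiseLIntegral_mono {φ φ' ψ ψ' : ℝ × Space d → ℝ} (h : ∀ z, |φ z| ≤ φ' z)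
    (h' : ∀ z, |ψ z| ≤ ψ' z) : noiseLIntegral β₀ γ φ ψ ≤ noiseLIntegral β₀ γ φ' ψ' := by
  refine lintegral_mono fun z => ?_
  have e1 : ‖φ z.1‖ₑ ≤ ‖φ' z.1‖ₑ :=
    enorm_le_iff_norm_le.2 (by simpa using (h z.1).trans (le_abs_self _))
  have e2 : ‖ψ z.2‖ₑ ≤ ‖ψ' z.2‖ₑ :=
    enorm_le_iff_norm_le.2 (by simpa using (h' z.2).trans (le_abs_self _))
  gcongr

theorem noiseInner_eq_toReal (hγ : Measurable γ) {φ ψ : ℝ × Space d → ℝ} (hφ : Measurable φ)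
    (hψ : Measurable ψ) (h0 : ∀ z, 0 ≤ φ z) (h0' : ∀ z, 0 ≤ ψ z)
    (hfin : noiseLIntegral β₀ γ φ ψ < ∞) :
    noiseInner β₀ γ φ ψ = (noiseLIntegral β₀ γ φ ψ).toReal := by
  have hm : Measurable fun z : (ℝ × Space d) × ℝ × Space d => ‖φ z.1‖ₑ * ‖ψ z.2‖ₑ *
      ENNReal.ofReal (|z.1.1 - z.2.1| ^ (-β₀)) * γ (z.1.2 - z.2.2) := by fun_prop
  rw [noiseLIntegral, ← integral_toReal hm.aemeasurable (ae_lt_top hm hfin.ne), noiseInner]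
  refine integral_congr_ae (ae_of_all _ fun z => ?_)
  simp only [ENNReal.toReal_mul, toReal_enorm, Real.norm_of_nonneg (h0 _),
    Real.norm_of_nonneg (h0' _)]
  rw [ENNReal.toReal_ofReal (Real.rpow_nonneg (abs_nonneg _) _)]

/-- Dominated convergence for the inner product of the noise. -/
theorem tendsto_noiseInner (hγ : Measurable γ) {D : ℝ × Space d → ℝ} (hD : D ∈ noiseDomain β₀ γ)
    {φ ψ : ℕ → ℝ × Space d → ℝ} {φ' ψ' : ℝ × Space d → ℝ} (hφ : ∀ n, Measurable (φ n))
    (hψ : ∀ n, Measurable (ψ n)) (hφD : ∀ n z, |φ n z| ≤ D z) (hψD : ∀ n z, |ψ n z| ≤ D z)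
    (hφ' : ∀ z, Tendsto (fun n => φ n z) atTop (𝓝 (φ' z)))
    (hψ' : ∀ z, Tendsto (fun n => ψ n z) atTop (𝓝 (ψ' z))) :
    Tendsto (fun n => noiseInner β₀ γ (φ n) (ψ n)) atTop (𝓝 (noiseInner β₀ γ φ' ψ')) := by
  have hDm := hD.1
  have hD0 : ∀ z, 0 ≤ D z := fun z => (abs_nonneg _).trans (hφD 0 z)
  have hm : Measurable fun z : (ℝ × Space d) × ℝ × Space d => ‖D z.1‖ₑ * ‖D z.2‖ₑ *
      ENNReal.ofReal (|z.1.1 - z.2.1| ^ (-β₀)) * γ (z.1.2 - z.2.2) := by fun_prop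
  refine tendsto_integral_of_dominated_convergence
    (fun z => (‖D z.1‖ₑ * ‖D z.2‖ₑ * ENNReal.ofReal (|z.1.1 - z.2.1| ^ (-β₀)) *
      γ (z.1.2 - z.2.2)).toReal) (fun n => ?_)
    (integrable_toReal_of_lintegral_ne_top hm.aemeasurable (mem_noiseDomain.1 hD).2.ne)
    (fun n => ae_of_all _ fun z => ?_) (ae_of_all _ fun z => ?_)
  · have := hφ n
    have := hψ n
    exact Measurable.aestronglyMeasurable (by fun_prop)
  · simp only [ENNReal.toReal_mul, toReal_enorm, Real.norm_eq_abs, abs_mul, abs_of_nonneg (hD0 _)]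
    rw [ENNReal.toReal_ofReal (Real.rpow_nonneg (abs_nonneg _) _),
      abs_of_nonneg (Real.rpow_nonneg (abs_nonneg _) _), abs_of_nonneg ENNReal.toReal_nonneg]
    gcongr
    · exact hD0 _
    · exact hφD n _
    · exact hψD n _
  · exact (((hφ' _).mul (hψ' _)).mul_const _).mul_const _

/-- The quadruple integral of functions with separated variables. -/
theorem lintegral_separated (hγ : Measurable γ) {a a' : ℝ → ℝ≥0∞} {b b' : Space d → ℝ≥0∞}
    (ha : Measurable a) (ha' : Measurable a') (hb : Measurable b) (hb' : Measurable b') :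
    ∫⁻ z, a z.1.1 * b z.1.2 * (a' z.2.1 * b' z.2.2) * ENNReal.ofReal (|z.1.1 - z.2.1| ^ (-β₀)) *
      γ (z.1.2 - z.2.2) ∂((spaceTime d).prod (spaceTime d)) =
    (∫⁻ u in Ici 0, ∫⁻ v in Ici 0, a u * a' v * ENNReal.ofReal (|u - v| ^ (-β₀))) *
      ∫⁻ y, ∫⁻ y', b y * b' y' * γ (y - y') := by
  have hA : Measurable fun p : ℝ × ℝ => a p.1 * a' p.2 * ENNReal.ofReal (|p.1 - p.2| ^ (-β₀)) := by
    fun_prop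
  have hB : Measurable fun p : Space d × Space d => b p.1 * b' p.2 * γ (p.1 - p.2) := by fun_prop
  rw [← lintegral_prod _ hA.aemeasurable, ← lintegral_prod _ hB.aemeasurable, spaceTime,
    ← lintegral_prod_prod_mul _ _ hA hB]
  refine lintegral_congr fun z => ?_
  simp only
  ring

/-- The function equal to `c` on `[0,t] × {|y| ≤ R}` and to `0` elsewhere. -/
noncomputable def boxFun (d : ℕ) (c t R : ℝ) (z : ℝ × Space d) : ℝ :=
  c * ((Icc 0 t).indicator 1 z.1 * (Metric.closedBall 0 R).indicator 1 z.2)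

theorem lintegral_Icc_abs_sub_rpow_lt_top {β : ℝ} (hβ : β < 1) {t : ℝ} (ht : 0 ≤ t) :
    ∫⁻ u in Icc 0 t, ∫⁻ v in Icc 0 t, ENNReal.ofReal (|u - v| ^ (-β)) < ∞ := by
  have h : ∀ u ∈ Icc 0 t, ∫⁻ v in Icc 0 t, ENNReal.ofReal (|u - v| ^ (-β)) ≤
      ENNReal.ofReal (2 * (t ^ (1 - β) / (1 - β))) := fun u hu => by
    refine le_trans ?_ (lintegral_Icc_abs_rpow_neg_le hβ ht)
    rw [← (Measure.measurePreserving_sub_left (volume : Measure ℝ)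
        u).setLIntegral_comp_preimage_emb (Homeomorph.subLeft u).measurableEmbedding
        (fun c => ENNReal.ofReal (|c| ^ (-β))) (Icc (-t) t)]
    refine lintegral_mono_set fun a ha => ?_
    exact ⟨by linarith [ha.2, hu.1], by linarith [ha.1, hu.2]⟩
  refine (setLIntegral_mono' measurableSet_Icc h).trans_lt ?_
  simp only [lintegral_const, Measure.restrict_apply_univ, Real.volume_Icc]
  exact ENNReal.mul_lt_top ENNReal.ofReal_lt_top ENNReal.ofReal_lt_top

theorem IsSpatialCovariance.boxFun_mem_noiseDomain {γhat : Space d → ℝ}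
    (h : IsSpatialCovariance γ γhat) (hβ : β₀ < 1) {c t R : ℝ} (ht : 0 ≤ t) :
    boxFun d c t R ∈ noiseDomain β₀ γ := by
  have hγ := h.measurable
  have hI : Measurable ((Icc 0 t).indicator (1 : ℝ → ℝ)) := measurable_one.indicator measurableSet_Icc
  have hB : Measurable ((Metric.closedBall (0 : Space d) R).indicator (1 : Space d → ℝ)) :=
    measurable_one.indicator Metric.isClosed_closedBall.measurableSet
  refine mem_noiseDomain.2 ⟨measurable_const.mul ((hI.comp measurable_fst).mul
    (hB.comp measurable_snd)), ?_⟩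
  have hI1 : Measurable ((Icc 0 t).indicator (1 : ℝ → ℝ≥0∞)) :=
    measurable_one.indicator measurableSet_Icc
  have hB1 : Measurable ((Metric.closedBall (0 : Space d) R).indicator (1 : Space d → ℝ≥0∞)) :=
    measurable_one.indicator Metric.isClosed_closedBall.measurableSet
  have he : ∀ z, ‖boxFun d c t R z‖ₑ = (‖c‖ₑ * (Icc 0 t).indicator 1 z.1) *
      (Metric.closedBall (0 : Space d) R).indicator 1 z.2 := fun z => by
    rw [boxFun, enorm_mul, enorm_mul, enorm_indicator_eq_indicator_enorm,
      enorm_indicator_eq_indicator_enorm, mul_assoc]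
    simp [indicator]
  rw [noiseLIntegral]
  simp only [he]
  rw [lintegral_separated hγ (hI1.const_mul _) (hI1.const_mul _) hB1 hB1]
  refine ENNReal.mul_lt_top ?_ ?_
  · calc ∫⁻ u in Ici 0, ∫⁻ v in Ici 0, ‖c‖ₑ * (Icc 0 t).indicator 1 u *
          (‖c‖ₑ * (Icc 0 t).indicator 1 v) * ENNReal.ofReal (|u - v| ^ (-β₀))
        ≤ ∫⁻ u, (Icc 0 t).indicator (fun u => ∫⁻ v, (Icc 0 t).indicator (fun v =>
            ‖c‖ₑ ^ 2 * ENNReal.ofReal (|u - v| ^ (-β₀))) v) u := by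
          refine (setLIntegral_le_lintegral _ _).trans (lintegral_mono fun u => ?_)
          by_cases hu : u ∈ Icc 0 t
          · simp only [indicator_of_mem hu]
            refine (setLIntegral_le_lintegral _ _).trans (lintegral_mono fun v => ?_)
            by_cases hv : v ∈ Icc 0 t
            · simp only [indicator_of_mem hv, Pi.one_apply, mul_one, sq]
              exact le_rfl
            · simp [indicator_of_notMem hv]
          · simp [indicator_of_notMem hu]
      _ = ‖c‖ₑ ^ 2 * ∫⁻ u in Icc 0 t, ∫⁻ v in Icc 0 t, ENNReal.ofReal (|u - v| ^ (-β₀)) := by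
          rw [lintegral_indicator measurableSet_Icc, ← lintegral_const_mul' _ _ (by simp)]
          refine lintegral_congr fun u => ?_
          rw [lintegral_indicator measurableSet_Icc, lintegral_const_mul' _ _ (by simp)]
      _ < ∞ := ENNReal.mul_lt_top (by simp) (lintegral_Icc_abs_sub_rpow_lt_top hβ ht)
  · calc ∫⁻ y, ∫⁻ y', (Metric.closedBall (0 : Space d) R).indicator 1 y *
        (Metric.closedBall (0 : Space d) R).indicator 1 y' * γ (y - y')
        ≤ ∫⁻ y, (Metric.closedBall (0 : Space d) R).indicator
          (fun _ => ∫⁻ w in Metric.closedBall (0 : Space d) (2 * R), γ w) y := by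
          refine lintegral_mono fun y => ?_
          by_cases hy : y ∈ Metric.closedBall (0 : Space d) R
          · simp only [indicator_of_mem hy, Pi.one_apply, one_mul]
            rw [← (Measure.measurePreserving_sub_left (volume : Measure (Space d))
              y).setLIntegral_comp_preimage_emb (Homeomorph.subLeft y).measurableEmbedding
              γ (Metric.closedBall 0 (2 * R)), ← lintegral_indicator (show MeasurableSet
                ((fun t => y - t) ⁻¹' Metric.closedBall (0 : Space d) (2 * R)) from
                (Homeomorph.subLeft y).measurable Metric.isClosed_closedBall.measurableSet)]
            refine lintegral_mono fun y' => ?_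
            by_cases hy' : y' ∈ Metric.closedBall (0 : Space d) R
            · rw [indicator_of_mem hy', indicator_of_mem]
              · simp
              · simp only [mem_preimage, mem_closedBall_zero_iff] at *
                linarith [norm_sub_le y y']
            · simp [indicator_of_notMem hy']
          · simp [indicator_of_notMem hy]
      _ < ∞ := by
          rw [lintegral_indicator Metric.isClosed_closedBall.measurableSet, lintegral_const,
            Measure.restrict_apply_univ]
          exact ENNReal.mul_lt_top (h.locallyIntegrable _ (isCompact_closedBall _ _))
            (isCompact_closedBall _ _).measure_lt_top

end Domination

section ApproxDelta

variable {d : ℕ} {ρ : Space d → ℝ} {ε δ : ℝ} {t : ℝ≥0} {x : Space d} {f : ℝ≥0 → Space d}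

theorem IsMollifier.approxDelta_integrand_nonneg (hρ : IsMollifier ρ) (hε : 0 < ε) (hδ : 0 < δ)
    (r : ℝ) (w : Space d) : 0 ≤ timeMollifier δ r * spaceMollifier ρ ε w :=
  mul_nonneg (timeMollifier_nonneg hδ _) (hρ.spaceMollifier_nonneg hε _)

theorem IsMollifier.approxDelta_nonneg (hρ : IsMollifier ρ) (hε : 0 < ε) (hδ : 0 < δ)
    (z : ℝ × Space d) : 0 ≤ approxDelta ρ ε δ t x f z :=
  indicator_nonneg (fun _ _ => intervalIntegral.integral_nonneg t.2 fun _ _ =>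
    hρ.approxDelta_integrand_nonneg hε hδ _ _) _

theorem IsMollifier.measurable_approxDelta_integrand (hρ : IsMollifier ρ)
    (hf : Measurable fun s : ℝ => f s.toNNReal) : Measurable fun q : (ℝ × Space d) × ℝ =>
      timeMollifier δ (t - q.2 - q.1.1) * spaceMollifier ρ ε (f q.2.toNNReal + x - q.1.2) := by
  have h1 := measurable_timeMollifier δ
  have h2 := (hρ.continuous_spaceMollifier ε).measurable
  have h3 : Measurable fun q : (ℝ × Space d) × ℝ => f q.2.toNNReal := hf.comp measurable_snd
  exact (h1.comp (by fun_prop)).mul (h2.comp ((h3.add_const x).sub measurable_fst.snd))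

theorem IsMollifier.measurable_approxDelta (hρ : IsMollifier ρ)
    (hf : Measurable fun s : ℝ => f s.toNNReal) : Measurable (approxDelta ρ ε δ t x f) := by
  have h1 : Measurable fun z : ℝ × Space d => ∫ s in (0 : ℝ)..t,
      timeMollifier δ (t - s - z.1) * spaceMollifier ρ ε (f s.toNNReal + x - z.2) := by
    simp only [intervalIntegral.integral_of_le t.coe_nonneg]
    exact (hρ.measurable_approxDelta_integrand
      hf).stronglyMeasurable.integral_prod_right'.measurable
  have h2 : approxDelta ρ ε δ t x f = (Prod.fst ⁻¹' Icc (0 : ℝ) t).indicator fun z =>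
      ∫ s in (0 : ℝ)..t,
        timeMollifier δ (t - s - z.1) * spaceMollifier ρ ε (f s.toNNReal + x - z.2) := by
    funext z
    by_cases hz : z.1 ∈ Icc (0 : ℝ) t
    · rw [approxDelta, indicator_of_mem hz,
          indicator_of_mem (show z ∈ Prod.fst ⁻¹' Icc (0 : ℝ) t from hz)]
    · rw [approxDelta, indicator_of_notMem hz,
        indicator_of_notMem (show z ∉ Prod.fst ⁻¹' Icc (0 : ℝ) t from hz)]
  rw [h2]
  exact h1.indicator (measurable_fst measurableSet_Icc)

theorem timeMollifier_le (hδ : 0 < δ) (r : ℝ) : timeMollifier δ r ≤ δ⁻¹ :=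
  indicator_le_self' (fun _ _ => by positivity) _

/-- On paths bounded by `B` the integrand is dominated by a box function depending only on `B`. -/
theorem IsMollifier.exists_approxDelta_le_boxFun (hρ : IsMollifier ρ) (hε : 0 < ε) (hδ : 0 < δ)
    (t : ℝ≥0) (x : Space d) (B : ℝ) : ∃ c R : ℝ, ∀ f : ℝ≥0 → Space d,
      (∀ s : ℝ≥0, s ≤ t → ‖f s‖ ≤ B) → ∀ z, |approxDelta ρ ε δ t x f z| ≤ boxFun d c t R z := by
  obtain ⟨M, hM0, hM⟩ := hρ.exists_bound hε
  obtain ⟨R, hR0, hR⟩ := hρ.exists_radius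
  refine ⟨δ⁻¹ * M * t, B + ‖x‖ + ε * R, fun f hf z => ?_⟩
  have hc0 : 0 ≤ δ⁻¹ * M * t := by positivity
  by_cases hz : z.1 ∈ Icc (0 : ℝ) t
  · rw [approxDelta, indicator_of_mem hz, boxFun, indicator_of_mem hz]
    by_cases hz2 : z.2 ∈ Metric.closedBall (0 : Space d) (B + ‖x‖ + ε * R)
    · rw [indicator_of_mem hz2, ← Real.norm_eq_abs]
      refine (intervalIntegral.norm_integral_le_of_norm_le_const
        (C := δ⁻¹ * M) fun s _ => ?_).trans (by simp)
      rw [Real.norm_of_nonneg (hρ.approxDelta_integrand_nonneg hε hδ _ _)]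
      exact mul_le_mul (timeMollifier_le hδ _) (hM _) (hρ.spaceMollifier_nonneg hε _) (by positivity)
    · rw [indicator_of_notMem hz2, intervalIntegral.integral_zero_ae]
      · simp
      · refine ae_of_all _ fun s hs => ?_
        rw [uIoc_of_le t.coe_nonneg] at hs
        rw [hR ε hε _ _, mul_zero]
        have h1 : ‖f s.toNNReal‖ ≤ B := hf _ (Real.toNNReal_le_iff_le_coe.2 hs.2)
        have h2 : B + ‖x‖ + ε * R < ‖z.2‖ := by simpa using hz2
        have h3 : ‖z.2‖ ≤ ‖f s.toNNReal + x - z.2‖ + (‖f s.toNNReal‖ + ‖x‖) := by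
          have := norm_sub_le (f s.toNNReal + x) (f s.toNNReal + x - z.2)
          rw [sub_sub_cancel] at this
          linarith [norm_add_le (f s.toNNReal) x]
        linarith
  · rw [approxDelta, indicator_of_notMem hz, boxFun, indicator_of_notMem hz]
    simp

theorem IsMollifier.enorm_approxDelta (hρ : IsMollifier ρ) (hε : 0 < ε) (hδ : 0 < δ)
    (hf : Measurable fun s : ℝ => f s.toNNReal) (z : ℝ × Space d) :
    ‖approxDelta ρ ε δ t x f z‖ₑ = ∫⁻ s in Ioc (0 : ℝ) t,
      (Icc (0 : ℝ) t).indicator 1 z.1 * ENNReal.ofReal (timeMollifier δ (t - s - z.1)) *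
        ENNReal.ofReal (spaceMollifier ρ ε (f s.toNNReal + x - z.2)) := by
  by_cases hz : z.1 ∈ Icc (0 : ℝ) t
  · obtain ⟨M, hM0, hM⟩ := hρ.exists_bound hε
    have hi : IntegrableOn (fun s : ℝ => timeMollifier δ (t - s - z.1) *
        spaceMollifier ρ ε (f s.toNNReal + x - z.2)) (Ioc (0 : ℝ) t) := by
      refine Measure.integrableOn_of_bounded (M := δ⁻¹ * M) (by simp)
        ((hρ.measurable_approxDelta_integrand hf).comp
          measurable_prodMk_left).aestronglyMeasurable (ae_of_all _ fun s => ?_)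
      rw [Real.norm_of_nonneg (hρ.approxDelta_integrand_nonneg hε hδ _ _)]
      exact mul_le_mul (timeMollifier_le hδ _) (hM _) (hρ.spaceMollifier_nonneg hε _) (by positivity)
    rw [Real.enorm_of_nonneg (hρ.approxDelta_nonneg hε hδ z), approxDelta, indicator_of_mem hz,
      intervalIntegral.integral_of_le t.coe_nonneg, ofReal_integral_eq_lintegral_ofReal hi
        (ae_of_all _ fun s => hρ.approxDelta_integrand_nonneg hε hδ _ _)]
    simp only [indicator_of_mem hz, Pi.one_apply, one_mul,
      ENNReal.ofReal_mul (timeMollifier_nonneg hδ _)]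
  · simp [approxDelta, indicator_of_notMem hz]

theorem lintegral_Ici_indicator_timeMollifier (t s r : ℝ) (δ δ' : ℝ) (β₀ : ℝ) :
    ∫⁻ u in Ici 0, ∫⁻ v in Ici 0,
      ((Icc 0 t).indicator 1 u * ENNReal.ofReal (timeMollifier δ (t - s - u))) *
      ((Icc 0 t).indicator 1 v * ENNReal.ofReal (timeMollifier δ' (t - r - v))) *
        ENNReal.ofReal (|u - v| ^ (-β₀)) = timeKernel β₀ t δ δ' s r := by
  have hrest : ∀ h : ℝ → ℝ≥0∞, (∀ u, u ∉ Icc 0 t → h u = 0) → ∫⁻ u in Ici 0, h u = ∫⁻ u, h u := by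
    intro h hh
    rw [← lintegral_indicator measurableSet_Ici]
    refine lintegral_congr fun u => ?_
    by_cases hu : u ∈ Ici (0 : ℝ)
    · rw [indicator_of_mem hu]
    · rw [indicator_of_notMem hu, hh u fun h => hu h.1]
  have hI : Measurable ((Icc 0 t).indicator (1 : ℝ → ℝ≥0∞)) :=
    measurable_one.indicator measurableSet_Icc
  have hI' : ∀ c : ℝ, Measurable fun a => (Icc 0 t).indicator (1 : ℝ → ℝ≥0∞) (t - c - a) := fun c =>
    hI.comp (by fun_prop)
  have hm : Measurable fun p : ℝ × ℝ => (Icc 0 t).indicator (1 : ℝ → ℝ≥0∞) (t - s - p.1) *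
      (Icc 0 t).indicator (1 : ℝ → ℝ≥0∞) (t - r - p.2) *
      ENNReal.ofReal (|(t - s - p.1) - (t - r - p.2)| ^ (-β₀)) :=
    (((hI' s).comp measurable_fst).mul ((hI' r).comp measurable_snd)).mul (by fun_prop)
  have hg := fun δ => (measurable_timeMollifier δ).ennreal_ofReal
  rw [timeKernel, lintegral_prod _ hm.aemeasurable, timeAvg, timeAvg,
    lintegral_withDensity_eq_lintegral_mul _ (hg δ) (hm.lintegral_prod_right'),
    hrest _ (fun u hu => by simp [indicator_of_notMem hu]),
    ← lintegral_sub_left_eq_self _ (t - s)]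
  refine lintegral_congr fun a => ?_
  have hma : Measurable fun b : ℝ => (Icc 0 t).indicator (1 : ℝ → ℝ≥0∞) (t - s - a) *
      (Icc 0 t).indicator (1 : ℝ → ℝ≥0∞) (t - r - b) *
      ENNReal.ofReal (|(t - s - a) - (t - r - b)| ^ (-β₀)) := hm.comp measurable_prodMk_left
  rw [hrest _ (fun v hv => by simp [indicator_of_notMem hv]), Pi.mul_apply,
    lintegral_withDensity_eq_lintegral_mul _ (hg δ') hma,
    ← lintegral_const_mul _ ((hg δ').mul hma),
    ← lintegral_sub_left_eq_self _ (t - r)]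
  refine lintegral_congr fun b => ?_
  simp only [Pi.mul_apply, sub_sub_cancel]
  ring

theorem lintegral_spaceMollifier (hρ : IsMollifier ρ) {γ : Space d → ℝ≥0∞} (hγ : Measurable γ)
    (ε ε' : ℝ) (x a b : Space d) :
    ∫⁻ y, ∫⁻ y', ENNReal.ofReal (spaceMollifier ρ ε (a + x - y)) *
      ENNReal.ofReal (spaceMollifier ρ ε' (b + x - y')) * γ (y - y') =
      spaceKernel γ ρ ε ε' (a - b) := by
  have hg := fun ε => (hρ.continuous_spaceMollifier ε).measurable.ennreal_ofReal
  have hm : Measurable fun q : Space d × Space d => γ (a - b - q.1 + q.2) := by fun_prop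
  rw [spaceKernel, lintegral_prod _ hm.aemeasurable, spaceAvg, spaceAvg,
    lintegral_withDensity_eq_lintegral_mul _ (hg ε) (hm.lintegral_prod_right'),
    ← lintegral_sub_left_eq_self _ (a + x)]
  refine lintegral_congr fun y => ?_
  have hmy : Measurable fun q => γ (a - b - y + q) := by fun_prop
  rw [Pi.mul_apply,
    lintegral_withDensity_eq_lintegral_mul _ (hg ε') hmy,
    ← lintegral_const_mul _ ((hg ε').mul hmy),
    ← lintegral_sub_left_eq_self _ (b + x)]
  refine lintegral_congr fun y' => ?_
  simp only [Pi.mul_apply, sub_sub_cancel]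
  rw [mul_assoc]
  congr 3
  abel

/-- The inner product of two integrands is the double time integral of the mollified kernels. -/
theorem IsMollifier.noiseLIntegral_approxDelta (hρ : IsMollifier ρ) {β₀ : ℝ}
    {γ : Space d → ℝ≥0∞} (hγ : Measurable γ) {ε' δ' : ℝ} {g : ℝ≥0 → Space d} (hε : 0 < ε)
    (hδ : 0 < δ) (hε' : 0 < ε') (hδ' : 0 < δ') (hf : Measurable fun s : ℝ => f s.toNNReal)
    (hg : Measurable fun s : ℝ => g s.toNNReal) :
    noiseLIntegral β₀ γ (approxDelta ρ ε δ t x f) (approxDelta ρ ε' δ' t x g) =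
      ∫⁻ s in Ioc (0 : ℝ) t, ∫⁻ r in Ioc (0 : ℝ) t, timeKernel β₀ t δ δ' s r *
        spaceKernel γ ρ ε ε' (f s.toNNReal - g r.toNNReal) := by
  have hI : Measurable ((Icc (0 : ℝ) t).indicator (1 : ℝ → ℝ≥0∞)) :=
    measurable_one.indicator measurableSet_Icc
  have hT := fun δ => (measurable_timeMollifier δ).ennreal_ofReal
  have hS := fun ε => (hρ.continuous_spaceMollifier ε).measurable.ennreal_ofReal
  set E : ℝ → ℝ → (ℝ≥0 → Space d) → ℝ × Space d → ℝ → ℝ≥0∞ := fun ε δ f z s =>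
    (Icc (0 : ℝ) t).indicator 1 z.1 * ENNReal.ofReal (timeMollifier δ (t - s - z.1)) *
        ENNReal.ofReal (spaceMollifier ρ ε (f s.toNNReal + x - z.2)) with hE
  have hEm : ∀ ε δ f, (Measurable fun s : ℝ => f s.toNNReal) →
      Measurable (Function.uncurry (E ε δ f)) := fun ε δ f hf => by
    have h3 : Measurable fun q : (ℝ × Space d) × ℝ => f q.2.toNNReal := hf.comp measurable_snd
    exact ((hI.comp measurable_fst.fst).mul ((hT δ).comp (by fun_prop))).mul
      ((hS ε).comp ((h3.add_const x).sub measurable_fst.snd))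
  have hF := hEm ε δ f hf
  have hG := hEm ε' δ' g hg
  have hFz : ∀ z, Measurable (E ε δ f z) := fun z => hF.comp measurable_prodMk_left
  have hGz : ∀ z, Measurable (E ε' δ' g z) := fun z => hG.comp measurable_prodMk_left
  have hK : Measurable fun z : (ℝ × Space d) × ℝ × Space d =>
      ENNReal.ofReal (|z.1.1 - z.2.1| ^ (-β₀)) * γ (z.1.2 - z.2.2) := by fun_prop
  have hM : Measurable fun q : ((ℝ × Space d) × ℝ × Space d) × ℝ × ℝ =>
      E ε δ f q.1.1 q.2.1 * E ε' δ' g q.1.2 q.2.2 *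
        (ENNReal.ofReal (|q.1.1.1 - q.1.2.1| ^ (-β₀)) * γ (q.1.1.2 - q.1.2.2)) :=
    ((hF.comp (measurable_fst.fst.prodMk measurable_snd.fst)).mul
      (hG.comp (measurable_fst.snd.prodMk measurable_snd.snd))).mul (hK.comp measurable_fst)
  calc noiseLIntegral β₀ γ (approxDelta ρ ε δ t x f) (approxDelta ρ ε' δ' t x g)
      = ∫⁻ z, ∫⁻ p, E ε δ f z.1 p.1 * E ε' δ' g z.2 p.2 *
          (ENNReal.ofReal (|z.1.1 - z.2.1| ^ (-β₀)) * γ (z.1.2 - z.2.2))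
          ∂((volume.restrict (Ioc (0 : ℝ) t)).prod (volume.restrict (Ioc (0 : ℝ) t)))
          ∂((spaceTime d).prod (spaceTime d)) := by
        refine lintegral_congr fun z => ?_
        have hFG : Measurable fun p : ℝ × ℝ => E ε δ f z.1 p.1 * E ε' δ' g z.2 p.2 :=
          ((hFz z.1).comp measurable_fst).mul ((hGz z.2).comp measurable_snd)
        rw [hρ.enorm_approxDelta hε hδ hf, hρ.enorm_approxDelta hε' hδ' hg, mul_assoc,
          lintegral_mul_const _ hFG,
          ← lintegral_prod_mul (hFz z.1).aemeasurable (hGz z.2).aemeasurable]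
    _ = ∫⁻ p, ∫⁻ z, E ε δ f z.1 p.1 * E ε' δ' g z.2 p.2 *
          (ENNReal.ofReal (|z.1.1 - z.2.1| ^ (-β₀)) * γ (z.1.2 - z.2.2))
          ∂((spaceTime d).prod (spaceTime d))
          ∂((volume.restrict (Ioc (0 : ℝ) t)).prod (volume.restrict (Ioc (0 : ℝ) t))) :=
        lintegral_lintegral_swap hM.aemeasurable
    _ = ∫⁻ p, timeKernel β₀ t δ δ' p.1 p.2 *
          spaceKernel γ ρ ε ε' (f p.1.toNNReal - g p.2.toNNReal)
          ∂((volume.restrict (Ioc (0 : ℝ) t)).prod (volume.restrict (Ioc (0 : ℝ) t))) := by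
        refine lintegral_congr fun p => ?_
        have hT' : ∀ δ c, Measurable fun u => (Icc (0 : ℝ) t).indicator (1 : ℝ → ℝ≥0∞) u *
            ENNReal.ofReal (timeMollifier δ (t - c - u)) := fun δ c =>
          hI.mul ((hT δ).comp (by fun_prop))
        have hS' : ∀ ε a, Measurable fun y => ENNReal.ofReal (spaceMollifier ρ ε (a + x - y)) :=
          fun ε a => (hS ε).comp (by fun_prop)
        rw [← lintegral_Ici_indicator_timeMollifier,
          ← lintegral_spaceMollifier hρ hγ ε ε' x (f p.1.toNNReal) (g p.2.toNNReal),
          ← lintegral_separated hγ (hT' δ p.1) (hT' δ' p.2) (hS' ε _) (hS' ε' _)]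
        refine lintegral_congr fun z => ?_
        simp only [hE]
        ring
    _ = _ := by
        rw [lintegral_prod]
        refine Measurable.aemeasurable (Measurable.mul (measurable_timeKernel _ _ _ _)
          ((measurable_spaceKernel hγ _ _).comp ?_))
        exact (hf.comp measurable_fst).sub (hg.comp measurable_snd)

end ApproxDelta

/-! ### Square-integrable functions on a product -/

theorem eLpNorm_two_sq {α E : Type*} [MeasurableSpace α] [NormedAddCommGroup E] (μ : Measure α)
    (f : α → E) : eLpNorm f 2 μ ^ 2 = ∫⁻ x, ‖f x‖ₑ ^ 2 ∂μ := by
  have := eLpNorm_nnreal_pow_eq_lintegral (μ := μ) (f := f) (p := 2) two_ne_zero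
  simpa using this

theorem tendsto_zero_of_sq {ι : Type*} {l : Filter ι} {a : ι → ℝ≥0∞}
    (h : Tendsto (fun i => a i ^ 2) l (𝓝 0)) : Tendsto a l (𝓝 0) := by
  have := h.ennrpow_const (((2 : ℕ) : ℝ)⁻¹)
  rw [ENNReal.zero_rpow_of_pos (by norm_num)] at this
  exact this.congr fun i => ENNReal.pow_rpow_inv_natCast two_ne_zero (a i)

theorem tendsto_sq_zero {ι : Type*} {l : Filter ι} {a : ι → ℝ≥0∞}
    (h : Tendsto a l (𝓝 0)) : Tendsto (fun i => a i ^ 2) l (𝓝 0) := by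
  have := h.ennrpow_const (2 : ℝ)
  simpa using this

theorem MeasureTheory.MemLp.eLpNorm_two_sq_eq {α : Type*} [MeasurableSpace α] {μ : Measure α}
    {f : α → ℝ} (hf : MemLp f 2 μ) : eLpNorm f 2 μ ^ 2 = ENNReal.ofReal (∫ x, f x ^ 2 ∂μ) := by
  rw [eLpNorm_two_sq, ofReal_integral_eq_lintegral_ofReal hf.integrable_sq
    (ae_of_all _ fun x => sq_nonneg _)]
  refine lintegral_congr fun x => ?_
  rw [Real.enorm_eq_ofReal_abs, ← ENNReal.ofReal_pow (abs_nonneg _), sq_abs]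

/-- A sequence converging to `0` in mean has a subsequence converging to `0` almost everywhere. -/
theorem exists_subseq_ae_tendsto_zero {α : Type*} [MeasurableSpace α] {μ : Measure α}
    {h : ℕ → α → ℝ≥0∞} (hm : ∀ n, AEMeasurable (h n) μ)
    (hh : Tendsto (fun n => ∫⁻ x, h n x ∂μ) atTop (𝓝 0)) :
    ∃ ns : ℕ → ℕ, StrictMono ns ∧ ∀ᵐ x ∂μ, Tendsto (fun k => h (ns k) x) atTop (𝓝 0) := by
  have hev : ∀ k : ℕ, ∀ᶠ n in atTop, ∫⁻ x, h n x ∂μ ≤ (1 / 2 : ℝ≥0∞) ^ k := fun k =>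
    (hh.eventually_lt_const (ENNReal.pow_pos (by simp) k)).mono fun _ hn => hn.le
  obtain ⟨ns, hns, hle⟩ := extraction_forall_of_eventually hev
  refine ⟨ns, hns, ?_⟩
  have hsum : ∫⁻ x, ∑' k, h (ns k) x ∂μ ≠ ∞ := by
    rw [lintegral_tsum fun k => hm _]
    refine ((ENNReal.tsum_le_tsum hle).trans_lt ?_).ne
    rw [ENNReal.tsum_geometric]
    simp
  filter_upwards [ae_lt_top' (AEMeasurable.tsum fun k => hm _) hsum] with x hx
  exact ENNReal.tendsto_atTop_zero_of_tsum_ne_top hx.ne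

section Product

variable {Ω Ω' : Type*} [MeasurableSpace Ω] [MeasurableSpace Ω'] {P : Measure Ω} {P' : Measure Ω'}
  [SFinite P] [SFinite P']

theorem eLpNorm_prod_two_sq {F : Ω × Ω' → ℝ} (hF : AEStronglyMeasurable F (P.prod P')) :
    eLpNorm F 2 (P.prod P') ^ 2 = ∫⁻ ω', eLpNorm (fun ω => F (ω, ω')) 2 P ^ 2 ∂P' := by
  rw [eLpNorm_two_sq, lintegral_prod_symm _ (hF.enorm.pow_const 2)]
  simp only [eLpNorm_two_sq]

theorem aemeasurable_eLpNorm_slice {F : Ω × Ω' → ℝ} (hF : AEStronglyMeasurable F (P.prod P')) :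
    AEMeasurable (fun ω' => eLpNorm (fun ω => F (ω, ω')) 2 P ^ 2) P' := by
  simp only [eLpNorm_two_sq]
  exact (hF.enorm.pow_const 2).prod_swap.lintegral_prod_right'

/-- Along a subsequence, convergence in `L²` of the product gives convergence in `L²(P)` of almost
all slices. -/
theorem exists_subseq_slice_tendsto {F : ℕ → Ω × Ω' → ℝ} {V : Ω × Ω' → ℝ}
    (hF : ∀ n, AEStronglyMeasurable (F n) (P.prod P')) (hV : AEStronglyMeasurable V (P.prod P'))
    (h : Tendsto (fun n => eLpNorm (F n - V) 2 (P.prod P')) atTop (𝓝 0)) :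
    ∃ ns : ℕ → ℕ, StrictMono ns ∧ ∀ᵐ ω' ∂P', Tendsto (fun k =>
      eLpNorm (fun ω => F (ns k) (ω, ω') - V (ω, ω')) 2 P) atTop (𝓝 0) := by
  have h2 := tendsto_sq_zero h
  simp only [eLpNorm_prod_two_sq ((hF _).sub hV)] at h2
  obtain ⟨ns, hns, hae⟩ := exists_subseq_ae_tendsto_zero
    (fun n => aemeasurable_eLpNorm_slice ((hF n).sub hV)) h2
  exact ⟨ns, hns, hae.mono fun ω' hω' => tendsto_zero_of_sq hω'⟩

theorem eLpNorm_joint_eq {F : Ω × Ω' → ℝ} (hF : AEStronglyMeasurable F (P.prod P'))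
    {g : Ω' → Lp ℝ 2 P} (hFg : ∀ᵐ ω' ∂P', (fun ω => F (ω, ω')) =ᵐ[P] g ω') :
    eLpNorm F 2 (P.prod P') = eLpNorm g 2 P' := by
  have h2 : eLpNorm F 2 (P.prod P') ^ 2 = eLpNorm g 2 P' ^ 2 := by
    rw [eLpNorm_prod_two_sq hF, eLpNorm_two_sq P' g]
    refine lintegral_congr_ae (hFg.mono fun ω' h => ?_)
    simp only
    rw [eLpNorm_congr_ae h, Lp.enorm_def]
  exact (ENNReal.pow_right_strictMono two_ne_zero).injective h2

/-- A square-integrable `L²(P)`-valued random variable on `Ω'` has a jointly measurable version on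
`Ω × Ω'`. -/
theorem exists_joint_version {g : Ω' → Lp ℝ 2 P} (hg : MemLp g 2 P') :
    ∃ F : Ω × Ω' → ℝ, MemLp F 2 (P.prod P') ∧ ∀ᵐ ω' ∂P', (fun ω => F (ω, ω')) =ᵐ[P] g ω' := by
  refine MemLp.induction (p := 2) ENNReal.ofNat_ne_top (fun g : Ω' → Lp ℝ 2 P =>
    ∃ F : Ω × Ω' → ℝ, MemLp F 2 (P.prod P') ∧ ∀ᵐ ω' ∂P', (fun ω => F (ω, ω')) =ᵐ[P] g ω')
    ?_ ?_ ?_ ?_ hg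
  · intro c s hs hlt
    have hm : AEStronglyMeasurable (fun z : Ω × Ω' => s.indicator (fun _ => (1 : ℝ)) z.2 * c z.1)
        (P.prod P') :=
      ((measurable_const.indicator hs).comp measurable_snd).aestronglyMeasurable.mul
        (Lp.aestronglyMeasurable c).comp_fst
    have hsl : ∀ ω', (fun ω => s.indicator (fun _ => (1 : ℝ)) ω' * c ω) =ᵐ[P]
        (s.indicator (fun _ => c) ω' : Lp ℝ 2 P) := fun ω' => by
      by_cases h : ω' ∈ s
      · simp [h]
      · simp only [indicator_of_notMem h, zero_mul]
        exact (Lp.coeFn_zero _ _ _).symm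
    refine ⟨_, ⟨hm, ?_⟩, ae_of_all _ hsl⟩
    rw [eLpNorm_joint_eq hm (ae_of_all _ hsl)]
    exact (memLp_indicator_const 2 hs c (Or.inr hlt.ne)).2
  · rintro f g - - - ⟨F, hF, hFf⟩ ⟨G, hG, hGg⟩
    refine ⟨F + G, hF.add hG, ?_⟩
    filter_upwards [hFf, hGg] with ω' h1 h2
    filter_upwards [h1, h2, Lp.coeFn_add (f ω') (g ω')] with ω e1 e2 e3
    simp only [Pi.add_apply] at *
    rw [e1, e2, e3]
  -- Joint versions of an `L²` convergent sequence form a Cauchy sequence with the same distances;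
  -- the slices of its limit are identified along a subsequence.
  · refine IsSeqClosed.isClosed fun fn f hfn hlim => ?_
    choose F hF hFf using hfn
    have hdiff : ∀ n m, eLpNorm (F n - F m) 2 (P.prod P') = eLpNorm (⇑(fn n) - ⇑(fn m)) 2 P' := by
      intro n m
      refine eLpNorm_joint_eq ((hF n).sub (hF m)).1 ?_
      filter_upwards [hFf n, hFf m] with ω' h1 h2
      filter_upwards [h1, h2, Lp.coeFn_sub (fn n ω') (fn m ω')] with ω e1 e2 e3
      simp only [Pi.sub_apply] at *
      rw [e1, e2, e3]
    have hcauchy : CauchySeq fun n => (hF n).toLp (F n) := by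
      have hiso : ∀ n m, edist ((hF n).toLp (F n)) ((hF m).toLp (F m)) = edist (fn n) (fn m) := by
        intro n m
        rw [Lp.edist_toLp_toLp, hdiff, Lp.edist_def]
      have := hlim.cauchySeq
      rw [EMetric.cauchySeq_iff] at this ⊢
      simpa only [hiso] using this
    obtain ⟨G, hG⟩ := cauchySeq_tendsto_of_complete hcauchy
    have h1 : Tendsto (fun n => eLpNorm (F n - ⇑G) 2 (P.prod P')) atTop (𝓝 0) := by
      have := tendsto_iff_edist_tendsto_0.1 hG
      refine this.congr fun n => ?_
      rw [Lp.edist_def]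
      exact eLpNorm_congr_ae ((hF n).coeFn_toLp.sub .rfl)
    have h2 : Tendsto (fun n => ∫⁻ ω', ‖fn n ω' - f ω'‖ₑ ^ 2 ∂P') atTop (𝓝 0) := by
      have := tendsto_sq_zero (tendsto_iff_edist_tendsto_0.1 hlim)
      refine this.congr fun n => ?_
      rw [Lp.edist_def, eLpNorm_two_sq]
      rfl
    obtain ⟨ns, hns, hae⟩ := exists_subseq_slice_tendsto (fun n => (hF n).1)
      (Lp.aestronglyMeasurable G) h1
    obtain ⟨ms, hms, hae'⟩ := exists_subseq_ae_tendsto_zero (h := fun n ω' =>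
      ‖fn (ns n) ω' - f ω'‖ₑ ^ 2) (fun n => ((Lp.aestronglyMeasurable _).sub
        (Lp.aestronglyMeasurable _)).enorm.pow_const 2) (h2.comp hns.tendsto_atTop)
    refine ⟨G, Lp.memLp G, ?_⟩
    filter_upwards [hae, hae', ae_all_iff.2 hFf,
      (Lp.aestronglyMeasurable G).prodMk_right] with ω' hω hω' hFω hGm
    have h3 : Tendsto (fun k => eLpNorm (fun ω => F (ns (ms k)) (ω, ω') - G (ω, ω')) 2 P +
        ‖fn (ns (ms k)) ω' - f ω'‖ₑ) atTop (𝓝 0) := by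
      have := (hω.comp hms.tendsto_atTop).add (tendsto_zero_of_sq hω')
      rwa [add_zero] at this
    have h4 : eLpNorm ((fun ω => G (ω, ω')) - ⇑(f ω')) 2 P = 0 := by
      refine le_antisymm (ge_of_tendsto' h3 fun k => ?_) zero_le
      set n := ns (ms k)
      have hFn : AEStronglyMeasurable (fun ω => F n (ω, ω')) P :=
        (Lp.aestronglyMeasurable (fn n ω')).congr (hFω n).symm
      have e1 : eLpNorm ((fun ω => F n (ω, ω')) - ⇑(f ω')) 2 P = ‖fn n ω' - f ω'‖ₑ := by
        rw [Lp.enorm_def]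
        refine eLpNorm_congr_ae ?_
        filter_upwards [hFω n, Lp.coeFn_sub (fn n ω') (f ω')] with ω a1 a2
        rw [a2, Pi.sub_apply, Pi.sub_apply, a1]
      have e2 : (fun ω => G (ω, ω')) - ⇑(f ω') =
          -(fun ω => F n (ω, ω') - G (ω, ω')) + ((fun ω => F n (ω, ω')) - ⇑(f ω')) := by
        funext ω; simp
      rw [e2, ← e1, ← eLpNorm_neg (f := fun ω => F n (ω, ω') - G (ω, ω'))]
      exact eLpNorm_add_le (hFn.sub hGm).neg (hFn.sub (Lp.aestronglyMeasurable _)) one_le_two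
    have h5 := (eLpNorm_eq_zero_iff (hGm.sub (Lp.aestronglyMeasurable _)) two_ne_zero).1 h4
    filter_upwards [h5] with ω hω5
    simpa [sub_eq_zero] using hω5
  · rintro f g hfg - ⟨F, hF, hFf⟩
    refine ⟨F, hF, ?_⟩
    filter_upwards [hFf, hfg] with ω' h1 h2
    rw [← h2]; exact h1

end Product

/-! ### Right-continuous paths with left limits -/

/-- The first point of the grid `(n+1)⁻¹ ℕ` strictly after `s`. -/
noncomputable def gridTime (n : ℕ) (s : ℝ≥0) : ℝ≥0 := (⌊(n + 1) * s⌋₊ + 1) / (n + 1)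

theorem le_gridTime (n : ℕ) (s : ℝ≥0) : s ≤ gridTime n s := by
  rw [gridTime, le_div_iff₀ (by positivity), mul_comm]
  exact (Nat.lt_floor_add_one _).le

theorem gridTime_le (n : ℕ) (s : ℝ≥0) : gridTime n s ≤ s + 1 / (n + 1) := by
  have h : (s + 1 / (n + 1)) * ((n : ℝ≥0) + 1) = (n + 1) * s + 1 := by
    field_simp
  rw [gridTime, div_le_iff₀ (by positivity), h]
  gcongr
  exact Nat.floor_le (by positivity)

theorem gridTime_le_add_one (n : ℕ) (s : ℝ≥0) : gridTime n s ≤ s + 1 :=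
  (gridTime_le n s).trans (by
    gcongr
    rw [div_le_one (by positivity)]
    exact le_add_of_nonneg_left zero_le)

theorem tendsto_gridTime (s : ℝ≥0) :
    Tendsto (fun n => gridTime n s) atTop (𝓝[Ici s] s) := by
  refine tendsto_nhdsWithin_iff.2 ⟨?_, Eventually.of_forall fun n => le_gridTime n s⟩
  refine tendsto_of_tendsto_of_tendsto_of_le_of_le tendsto_const_nhds (h := fun n : ℕ =>
    s + 1 / ((n : ℝ≥0) + 1)) ?_ (fun n => le_gridTime n s) (fun n => gridTime_le n s)
  have : Tendsto (fun n : ℕ => s + 1 / ((n : ℝ≥0) + 1)) atTop (𝓝 (s + 0)) :=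
    tendsto_const_nhds.add (tendsto_one_div_add_atTop_nhds_zero_nat (𝕜 := ℝ≥0))
  simpa using this

section Cadlag

variable {d : ℕ}

theorem IsCadlagPath.tendsto_gridTime {f : ℝ≥0 → Space d} (hf : IsCadlagPath f) (s : ℝ≥0) :
    Tendsto (fun n => f (gridTime n s)) atTop (𝓝 (f s)) :=
  (hf s).1.tendsto.comp (_root_.tendsto_gridTime s)

theorem IsCadlagPath.exists_bound {f : ℝ≥0 → Space d} (hf : IsCadlagPath f) (T : ℝ≥0) :
    ∃ B : ℝ, ∀ s ≤ T, ‖f s‖ ≤ B := by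
  have hloc : ∀ s : ℝ≥0, ∃ u ∈ 𝓝 s, ∃ B : ℝ, ∀ r ∈ u, ‖f r‖ ≤ B := fun s => by
    obtain ⟨hr, l, hl⟩ := hf s
    have h1 : ∀ᶠ r in 𝓝[≥] s, ‖f r‖ < ‖f s‖ + 1 := hr.norm.eventually_lt_const (by linarith)
    have h2 : ∀ᶠ r in 𝓝[<] s, ‖f r‖ < ‖l‖ + 1 := hl.norm.eventually_lt_const (by linarith)
    have h3 : ∀ᶠ r in 𝓝 s, ‖f r‖ ≤ max (‖f s‖ + 1) (‖l‖ + 1) := by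
      rw [← nhdsLT_sup_nhdsGE, eventually_sup]
      exact ⟨h2.mono fun r hr => hr.le.trans (le_max_right _ _),
        h1.mono fun r hr => hr.le.trans (le_max_left _ _)⟩
    exact ⟨_, h3, _, fun r hr => hr⟩
  have : ∃ B : ℝ, ∀ s ∈ Icc 0 T, ‖f s‖ ≤ B := by
    refine isCompact_Icc.induction_on (p := fun S => ∃ B : ℝ, ∀ s ∈ S, ‖f s‖ ≤ B)
      ⟨0, by simp⟩ (fun _ _ hst ⟨B, hB⟩ => ⟨B, fun s hs => hB s (hst hs)⟩) ?_ ?_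
    · rintro S S' ⟨B, hB⟩ ⟨B', hB'⟩
      refine ⟨max B B', fun s hs => hs.elim (fun h => (hB s h).trans (le_max_left _ _))
        fun h => (hB' s h).trans (le_max_right _ _)⟩
    · intro s _
      obtain ⟨u, hu, hB⟩ := hloc s
      exact ⟨u, mem_nhdsWithin_of_mem_nhds hu, hB⟩
  obtain ⟨B, hB⟩ := this
  exact ⟨B, fun s hs => hB s ⟨zero_le, hs⟩⟩

theorem measurable_comp_gridTime {Ω : Type*} [MeasurableSpace Ω] {X : ℝ≥0 → Ω → Space d}
    (hX : ∀ s, Measurable (X s)) (n : ℕ) :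
    Measurable fun p : ℝ≥0 × Ω => X (gridTime n p.1) p.2 := by
  have h0 : ∀ k : ℕ, Measurable fun ω => X (((k : ℝ≥0) + 1) / ((n : ℝ≥0) + 1)) ω := fun k => hX _
  have h1 : Measurable fun q : ℕ × Ω => X (((q.1 : ℝ≥0) + 1) / ((n : ℝ≥0) + 1)) q.2 :=
    measurable_from_prod_countable_right h0
  have h2 : Measurable fun p : ℝ≥0 × Ω => ⌊((n : ℝ≥0) + 1) * p.1⌋₊ :=
    Nat.measurable_floor.comp (measurable_fst.const_mul _)
  have h3 : Measurable fun p : ℝ≥0 × Ω => (⌊((n : ℝ≥0) + 1) * p.1⌋₊, p.2) :=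
    h2.prodMk measurable_snd
  have h4 := h1.comp h3
  simp only [Function.comp_def] at h4
  simp only [gridTime]
  exact h4

/-- A process with right-continuous paths is jointly measurable. -/
theorem measurable_uncurry_of_rightCont {Ω : Type*} [MeasurableSpace Ω] {X : ℝ≥0 → Ω → Space d}
    (hX : ∀ s, Measurable (X s)) (hc : ∀ ω s, ContinuousWithinAt (fun s => X s ω) (Ici s) s) :
    Measurable fun p : ℝ × Ω => X p.1.toNNReal p.2 := by
  have hlim : ∀ p : ℝ≥0 × Ω, Tendsto (fun n => X (gridTime n p.1) p.2) atTop (𝓝 (X p.1 p.2)) :=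
    fun p => (hc p.2 p.1).tendsto.comp (tendsto_gridTime p.1)
  have hN : Measurable fun p : ℝ≥0 × Ω => X p.1 p.2 :=
    measurable_of_tendsto_metrizable (measurable_comp_gridTime hX) (tendsto_pi_nhds.2 hlim)
  exact hN.comp ((measurable_real_toNNReal.comp measurable_fst).prodMk measurable_snd)

theorem measurable_uncurry_real_of_cadlag {Ω : Type*} [MeasurableSpace Ω] {X : ℝ≥0 → Ω → Space d}
    (hX : ∀ s, Measurable (X s)) (hc : ∀ ω, IsCadlagPath fun s => X s ω) :
    Measurable fun p : ℝ × Ω => X p.1.toNNReal p.2 :=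
  measurable_uncurry_of_rightCont hX fun ω s => (hc ω s).1

theorem IsCadlagPath.measurable {f : ℝ≥0 → Space d} (hf : IsCadlagPath f) :
    Measurable fun s : ℝ => f s.toNNReal := by
  have h1 : Measurable fun p : ℝ × Unit => f p.1.toNNReal :=
    measurable_uncurry_real_of_cadlag (X := fun s (_ : Unit) => f s) (fun _ => measurable_const)
      fun _ => hf
  have h2 : Measurable fun s : ℝ => (s, ()) := measurable_id.prodMk measurable_const
  exact h1.comp h2

/-- Measurable rounding to a countable dense set. -/
theorem exists_rounding (d n : ℕ) : ∃ c : Space d → ℕ, Measurable c ∧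
    ∀ y, dist (TopologicalSpace.denseSeq (Space d) (c y)) y ≤ 1 / ((n : ℝ) + 1) := by
  classical
  have hp : ∀ y : Space d, ∃ k, dist (TopologicalSpace.denseSeq (Space d) k) y < 1 / ((n : ℝ) + 1) :=
    fun y => by
      obtain ⟨k, hk⟩ := (TopologicalSpace.denseRange_denseSeq (Space d)).exists_dist_lt y
        (by positivity : (0 : ℝ) < 1 / ((n : ℝ) + 1))
      exact ⟨k, by rwa [dist_comm]⟩
  exact ⟨fun y => Nat.find (hp y), measurable_find hp fun k =>
    measurableSet_lt (by fun_prop) measurable_const, fun y => (Nat.find_spec (hp y)).le⟩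

end Cadlag

/-! ### The noise evaluated at the approximating integrands -/

section Noise

variable {d : ℕ} {Ω : Type*} [MeasurableSpace Ω] {P : Measure Ω}
  {β₀ : ℝ} {γ : Space d → ℝ≥0∞} {W : (ℝ × Space d → ℝ) → Ω → ℝ}

theorem IsNoise.memLp (hW : IsNoise β₀ γ W P) {φ : ℝ × Space d → ℝ} (hφ : φ ∈ noiseDomain β₀ γ) :
    MemLp (W φ) 2 P :=
  (hW.gaussian.hasGaussianLaw_eval ⟨φ, hφ⟩).memLp_two

theorem IsNoise.eLpNorm_sub_sq (hW : IsNoise β₀ γ W P) {φ ψ : ℝ × Space d → ℝ}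
    (hφ : φ ∈ noiseDomain β₀ γ) (hψ : ψ ∈ noiseDomain β₀ γ) :
    eLpNorm (W φ - W ψ) 2 P ^ 2 = ENNReal.ofReal
      (noiseInner β₀ γ φ φ - 2 * noiseInner β₀ γ φ ψ + noiseInner β₀ γ ψ ψ) := by
  have h1 := hW.memLp hφ
  have h2 := hW.memLp hψ
  have i1 : Integrable (fun ω => W φ ω * W φ ω) P := h1.integrable_mul h1
  have i2 : Integrable (fun ω => 2 * (W φ ω * W ψ ω)) P := (h1.integrable_mul h2).const_mul 2
  have i3 : Integrable (fun ω => W ψ ω * W ψ ω) P := h2.integrable_mul h2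
  have i4 : Integrable (fun ω => W φ ω * W φ ω - 2 * (W φ ω * W ψ ω)) P := i1.sub i2
  rw [(h1.sub h2).eLpNorm_two_sq_eq, ← hW.covariance φ hφ φ hφ, ← hW.covariance φ hφ ψ hψ,
    ← hW.covariance ψ hψ ψ hψ, ← integral_const_mul, ← integral_sub i1 i2, ← integral_add i4 i3]
  congr 1
  refine integral_congr_ae (ae_of_all _ fun ω => ?_)
  simp only [Pi.sub_apply]
  ring

theorem noiseDomain_of_le {D φ : ℝ × Space d → ℝ} (hD : D ∈ noiseDomain β₀ γ) (hφ : Measurable φ)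
    (h : ∀ z, |φ z| ≤ D z) : φ ∈ noiseDomain β₀ γ :=
  mem_noiseDomain.2 ⟨hφ, (noiseLIntegral_mono h h).trans_lt (mem_noiseDomain.1 hD).2⟩

/-- Dominated convergence for the noise. -/
theorem IsNoise.tendsto_eLpNorm (hW : IsNoise β₀ γ W P) (hγ : Measurable γ)
    {D : ℝ × Space d → ℝ} (hD : D ∈ noiseDomain β₀ γ) {φ : ℕ → ℝ × Space d → ℝ}
    {φ' : ℝ × Space d → ℝ} (hφ : ∀ n, Measurable (φ n)) (hφm : Measurable φ')
    (hφD : ∀ n z, |φ n z| ≤ D z) (hφ' : ∀ z, Tendsto (fun n => φ n z) atTop (𝓝 (φ' z))) :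
    Tendsto (fun n => eLpNorm (W (φ n) - W φ') 2 P) atTop (𝓝 0) := by
  have hφD' : ∀ z, |φ' z| ≤ D z := fun z => le_of_tendsto' (hφ' z).abs fun n => hφD n z
  refine tendsto_zero_of_sq ?_
  have h1 := tendsto_noiseInner hγ hD hφ hφ hφD hφD hφ' hφ'
  have h2 := tendsto_noiseInner hγ hD hφ (fun _ => hφm) hφD (fun _ => hφD') hφ'
    (fun _ => tendsto_const_nhds)
  have h3 := ENNReal.tendsto_ofReal ((h1.sub (h2.const_mul 2)).add_const (noiseInner β₀ γ φ' φ'))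
  rw [show noiseInner β₀ γ φ' φ' - 2 * noiseInner β₀ γ φ' φ' + noiseInner β₀ γ φ' φ' = 0 by ring,
    ENNReal.ofReal_zero] at h3
  exact h3.congr fun n => (hW.eLpNorm_sub_sq (noiseDomain_of_le hD (hφ n) (hφD n))
    (noiseDomain_of_le hD hφm hφD')).symm

open Classical in
/-- `W φ` as an element of `L²(P)` (and `0` outside the domain of the noise). -/
noncomputable def IsNoise.toLp (hW : IsNoise β₀ γ W P) (φ : ℝ × Space d → ℝ) : Lp ℝ 2 P :=
  if h : φ ∈ noiseDomain β₀ γ then (hW.memLp h).toLp (W φ) else 0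

theorem IsNoise.coeFn_toLp (hW : IsNoise β₀ γ W P) {φ : ℝ × Space d → ℝ}
    (hφ : φ ∈ noiseDomain β₀ γ) : hW.toLp φ =ᵐ[P] W φ := by
  rw [IsNoise.toLp, dif_pos hφ]
  exact MemLp.coeFn_toLp _

theorem IsNoise.tendsto_toLp (hW : IsNoise β₀ γ W P) {φ : ℕ → ℝ × Space d → ℝ}
    {φ' : ℝ × Space d → ℝ} (hφ : ∀ n, φ n ∈ noiseDomain β₀ γ) (hφ' : φ' ∈ noiseDomain β₀ γ)
    (h : Tendsto (fun n => eLpNorm (W (φ n) - W φ') 2 P) atTop (𝓝 0)) :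
    Tendsto (fun n => hW.toLp (φ n)) atTop (𝓝 (hW.toLp φ')) := by
  refine tendsto_iff_edist_tendsto_0.2 (h.congr fun n => ?_)
  rw [Lp.edist_def]
  exact (eLpNorm_congr_ae ((hW.coeFn_toLp (hφ n)).sub (hW.coeFn_toLp hφ'))).symm

theorem IsNoise.enorm_toLp_sq (hW : IsNoise β₀ γ W P) (hγ : Measurable γ) {φ : ℝ × Space d → ℝ}
    (hφ : φ ∈ noiseDomain β₀ γ) (h0 : ∀ z, 0 ≤ φ z) :
    ‖hW.toLp φ‖ₑ ^ 2 = noiseLIntegral β₀ γ φ φ := by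
  rw [Lp.enorm_def, eLpNorm_congr_ae (hW.coeFn_toLp hφ), (hW.memLp hφ).eLpNorm_two_sq_eq]
  simp only [sq]
  rw [hW.covariance φ hφ φ hφ, noiseInner_eq_toReal hγ hφ.1 hφ.1 h0 h0 (mem_noiseDomain.1 hφ).2,
    ENNReal.ofReal_toReal (mem_noiseDomain.1 hφ).2.ne]

variable {γhat : Space d → ℝ} {ρ : Space d → ℝ} {ε δ : ℝ} {t : ℝ≥0} {x : Space d}

theorem IsMollifier.tendsto_approxDelta (hρ : IsMollifier ρ) (hε : 0 < ε) (hδ : 0 < δ)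
    {f : ℕ → ℝ≥0 → Space d} {f' : ℝ≥0 → Space d}
    (hf : ∀ n, Measurable fun s : ℝ => f n s.toNNReal)
    (h : ∀ s ≤ t, Tendsto (fun n => f n s) atTop (𝓝 (f' s))) (z : ℝ × Space d) :
    Tendsto (fun n => approxDelta ρ ε δ t x (f n) z) atTop (𝓝 (approxDelta ρ ε δ t x f' z)) := by
  by_cases hz : z.1 ∈ Icc (0 : ℝ) t
  · simp only [approxDelta, indicator_of_mem hz]
    obtain ⟨M, hM0, hM⟩ := hρ.exists_bound hε
    refine intervalIntegral.tendsto_integral_filter_of_dominated_convergence (fun _ => δ⁻¹ * M)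
      (Eventually.of_forall fun n => ((hρ.measurable_approxDelta_integrand (hf n)).comp
          measurable_prodMk_left).aestronglyMeasurable)
      (Eventually.of_forall fun n => ae_of_all _ fun s _ => ?_) (by simp)
      (ae_of_all _ fun s hs => ?_)
    · rw [Real.norm_of_nonneg (hρ.approxDelta_integrand_nonneg hε hδ _ _)]
      exact mul_le_mul (timeMollifier_le hδ _) (hM _) (hρ.spaceMollifier_nonneg hε _) (by positivity)
    · rw [uIoc_of_le t.coe_nonneg] at hs
      refine Tendsto.const_mul _ (((hρ.continuous_spaceMollifier ε).tendsto _).comp ?_)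
      exact ((h _ (Real.toNNReal_le_iff_le_coe.2 hs.2)).add_const x).sub_const z.2
  · simp only [approxDelta, indicator_of_notMem hz]
    exact tendsto_const_nhds

theorem IsMollifier.approxDelta_mem_noiseDomain (hρ : IsMollifier ρ)
    (hγ : IsSpatialCovariance γ γhat) (hβ : β₀ < 1) (hε : 0 < ε) (hδ : 0 < δ) {f : ℝ≥0 → Space d}
    (hf : IsCadlagPath f) : approxDelta ρ ε δ t x f ∈ noiseDomain β₀ γ := by
  obtain ⟨B, hB⟩ := hf.exists_bound t
  obtain ⟨c, R, hcR⟩ := hρ.exists_approxDelta_le_boxFun hε hδ t x B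
  exact noiseDomain_of_le (hγ.boxFun_mem_noiseDomain hβ t.coe_nonneg)
    (hρ.measurable_approxDelta hf.measurable) (hcR f hB)

/-- The `L²(P)`-valued map `ω' ↦ W(Φ_{ω'})` is strongly measurable. It is the limit of the maps
obtained from discretized and rounded paths, which depend on countably many values only. -/
theorem IsNoise.stronglyMeasurable_toLp [IsProbabilityMeasure P] (hW : IsNoise β₀ γ W P)
    (hγ : IsSpatialCovariance γ γhat)
    (hβ : β₀ < 1) (hρ : IsMollifier ρ) (hε : 0 < ε) (hδ : 0 < δ) {Ω' : Type*} [MeasurableSpace Ω']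
    {X : ℝ≥0 → Ω' → Space d} (hX : ∀ s, Measurable (X s))
    (hc : ∀ ω, IsCadlagPath fun s => X s ω) :
    StronglyMeasurable fun ω' => hW.toLp (approxDelta ρ ε δ t x fun s => X s ω') := by
  choose c hcm hcd using exists_rounding d
  let K : ℕ → ℕ := fun n => ⌊((n : ℝ≥0) + 1) * t⌋₊
  -- The path through finitely many rounded values: on `[0,t]` it is the rounded value of `X` at the
  -- next grid point.
  let path : (n : ℕ) → (Fin (K n + 1) → ℕ) → ℝ≥0 → Space d := fun n v s =>
    TopologicalSpace.denseSeq (Space d) (v ⟨min ⌊((n : ℝ≥0) + 1) * s⌋₊ (K n), by omega⟩)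
  let vec : (n : ℕ) → Ω' → Fin (K n + 1) → ℕ := fun n ω' k =>
    c n (X (((k : ℕ) + 1) / (n + 1)) ω')
  have hvec : ∀ n, Measurable (vec n) := fun n =>
    measurable_pi_lambda _ fun k => (hcm n).comp (hX _)
  have hpath : ∀ n v, Measurable fun s : ℝ => path n v s.toNNReal := fun n v => by
    have h1 : Measurable fun k : ℕ => TopologicalSpace.denseSeq (Space d)
      (v ⟨min k (K n), by omega⟩) := measurable_from_nat
    exact h1.comp (Nat.measurable_floor.comp (measurable_const.mul measurable_real_toNNReal))
  have hval : ∀ n ω' s, s ≤ t → path n (vec n ω') s =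
      TopologicalSpace.denseSeq (Space d) (c n (X (gridTime n s) ω')) := fun n ω' s hs => by
    have : ⌊((n : ℝ≥0) + 1) * s⌋₊ ≤ K n := Nat.floor_mono (by gcongr)
    simp only [path, vec, gridTime, min_eq_left this]
  refine stronglyMeasurable_of_tendsto atTop (f := fun n ω' =>
    hW.toLp (approxDelta ρ ε δ t x (path n (vec n ω')))) (fun n => ?_)
    (tendsto_pi_nhds.2 fun ω' => ?_)
  -- The `n`-th map factors through a countable set.
  · exact (StronglyMeasurable.of_discrete (f := fun v =>
      hW.toLp (approxDelta ρ ε δ t x (path n v)))).comp_measurable (hvec n)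
  · obtain ⟨B, hB⟩ := (hc ω').exists_bound (t + 1)
    have hle : ∀ n : ℕ, 1 / ((n : ℝ) + 1) ≤ 1 := fun n => by
      rw [div_le_one (by positivity)]; linarith [n.cast_nonneg (α := ℝ)]
    have hbd : ∀ n, ∀ s ≤ t, ‖path n (vec n ω') s‖ ≤ B + 1 := fun n s hs => by
      rw [hval n ω' s hs]
      have h1 := hB (gridTime n s) ((gridTime_le_add_one n s).trans (by gcongr))
      have h2 := hcd n (X (gridTime n s) ω')
      rw [dist_eq_norm] at h2
      have h3 := norm_sub_norm_le (TopologicalSpace.denseSeq (Space d) (c n (X (gridTime n s) ω')))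
        (X (gridTime n s) ω')
      linarith [hle n]
    have hlim : ∀ s ≤ t, Tendsto (fun n => path n (vec n ω') s) atTop (𝓝 (X s ω')) := fun s hs => by
      have h1 := (hc ω').tendsto_gridTime s
      refine (tendsto_iff_of_dist ?_).1 h1
      refine squeeze_zero (fun _ => dist_nonneg) (fun n => ?_)
        (tendsto_one_div_add_atTop_nhds_zero_nat (𝕜 := ℝ))
      rw [hval n ω' s hs, dist_comm]
      exact hcd n _
    obtain ⟨a, R, haR⟩ := hρ.exists_approxDelta_le_boxFun hε hδ t x (B + 1)
    have hD := hγ.boxFun_mem_noiseDomain (β₀ := β₀) hβ (c := a) (R := R) t.coe_nonneg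
    have hmeas := fun n => hρ.measurable_approxDelta (ε := ε) (δ := δ) (t := t) (x := x)
      (hpath n (vec n ω'))
    refine hW.tendsto_toLp (fun n => noiseDomain_of_le hD (hmeas n) (haR _ (hbd n)))
      (hρ.approxDelta_mem_noiseDomain hγ hβ hε hδ (hc ω')) ?_
    exact hW.tendsto_eLpNorm hγ.measurable hD hmeas (hρ.measurable_approxDelta (hc ω').measurable)
      (fun n => haR _ (hbd n)) fun z => hρ.tendsto_approxDelta hε hδ (fun n => hpath n _) hlim z

/-- A jointly measurable version of `W(Φ)` exists on `Ω × Ω'` and is square-integrable, provided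
that the mean energy of `Φ` is finite. -/
theorem IsNoise.exists_isNoiseIntegral [IsProbabilityMeasure P] (hW : IsNoise β₀ γ W P)
    (hγ : IsSpatialCovariance γ γhat)
    (hβ : β₀ < 1) (hρ : IsMollifier ρ) (hε : 0 < ε) (hδ : 0 < δ) {Ω' : Type*} [MeasurableSpace Ω']
    {P' : Measure Ω'} [IsProbabilityMeasure P'] {X : ℝ≥0 → Ω' → Space d}
    (hX : ∀ s, Measurable (X s)) (hc : ∀ ω, IsCadlagPath fun s => X s ω)
    (hfin : ∫⁻ ω', noiseLIntegral β₀ γ (approxDelta ρ ε δ t x fun s => X s ω')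
      (approxDelta ρ ε δ t x fun s => X s ω') ∂P' < ∞) :
    ∃ F : Ω × Ω' → ℝ, IsNoiseIntegral β₀ γ W P P'
      (fun ω' => approxDelta ρ ε δ t x fun s => X s ω') F ∧ MemLp F 2 (P.prod P') := by
  have hdom : ∀ ω', approxDelta ρ ε δ t x (fun s => X s ω') ∈ noiseDomain β₀ γ := fun ω' =>
    hρ.approxDelta_mem_noiseDomain hγ hβ hε hδ (hc ω')
  have hmem : MemLp (fun ω' => hW.toLp (approxDelta ρ ε δ t x fun s => X s ω')) 2 P' := by
    refine ⟨(hW.stronglyMeasurable_toLp hγ hβ hρ hε hδ hX hc).aestronglyMeasurable, ?_⟩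
    have h2 : eLpNorm (fun ω' => hW.toLp (approxDelta ρ ε δ t x fun s => X s ω')) 2 P' ^ 2 < ∞ := by
      rw [eLpNorm_two_sq]
      simpa only [hW.enorm_toLp_sq hγ.measurable (hdom _) (hρ.approxDelta_nonneg hε hδ)] using hfin
    by_contra h
    rw [not_lt, top_le_iff] at h
    simp [h] at h2
  obtain ⟨F, hF, hFe⟩ := exists_joint_version hmem
  exact ⟨F, ⟨hF.1, ae_of_all _ hdom, hFe.mono fun ω' h => h.trans (hW.coeFn_toLp (hdom ω'))⟩, hF⟩

end Noise

/-! ### One-dimensional laws of the Lévy process -/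

section LevyLaw

variable {d : ℕ} {Ω' : Type*} [MeasurableSpace Ω'] {P' : Measure Ω'} [IsProbabilityMeasure P']
  {X : ℝ≥0 → Ω' → Space d} {Ψ : Space d → ℝ}

omit [IsProbabilityMeasure P'] in
theorem IsSymmetricLevyProcess.norm_charFun_one (hX : IsSymmetricLevyProcess X Ψ P')
    (ξ : Space d) : ‖charFun (P'.map (X 1)) ξ‖ = Real.exp (-Ψ ξ) := by
  rw [hX.exponent, Complex.norm_exp]
  simp

theorem IsSymmetricLevyProcess.exponent_nonneg (hX : IsSymmetricLevyProcess X Ψ P')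
    (ξ : Space d) : 0 ≤ Ψ ξ := by
  have := Measure.isProbabilityMeasure_map (hX.measurable 1).aemeasurable (μ := P')
  have h := norm_charFun_le_one (μ := P'.map (X 1)) ξ
  rw [hX.norm_charFun_one, Real.exp_le_one_iff] at h
  linarith

theorem IsSymmetricLevyProcess.measurable_exponent (hX : IsSymmetricLevyProcess X Ψ P') :
    Measurable Ψ := by
  have h : Ψ = fun ξ => -Real.log ‖charFun (P'.map (X 1)) ξ‖ := by
    ext ξ
    rw [hX.norm_charFun_one, Real.log_exp, neg_neg]
  rw [h]
  exact (Real.measurable_log.comp measurable_charFun.norm).neg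

theorem IsSymmetricLevyProcess.integrable_exp (hX : IsSymmetricLevyProcess X Ψ P') {β₀ : ℝ}
    (hβ₀ : 0 < β₀) (hβ₁ : β₀ < 1) {γhat : Space d → ℝ}
    (hI : SpectralCondition β₀ Ψ (spectralMeasure γhat)) {v : ℝ} (hv : 0 < v) :
    Integrable (fun ξ => Real.exp (-(v * Ψ ξ))) (spectralMeasure γhat) :=
  hI.integrable_exp hβ₀ hβ₁ hX.measurable_exponent hX.exponent_nonneg hv

variable {γ : Space d → ℝ≥0∞} {γhat : Space d → ℝ}

/-- The mean of `γ(z + Y)` for a random vector `Y` with characteristic function `exp(-v Ψ)`. The law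
of `Y` is the convolution of the law of `X_{v/2}`, which has a density, with itself. -/
theorem IsSymmetricLevyProcess.lintegral_add_of_charFun (hX : IsSymmetricLevyProcess X Ψ P')
    (hγ : IsSpatialCovariance γ γhat) {v : ℝ} (hv : 0 < v)
    (hint : ∀ v : ℝ, 0 < v → Integrable (fun ξ => Real.exp (-(v * Ψ ξ))) (spectralMeasure γhat))
    {Θ : Type*} [MeasurableSpace Θ] {m : Measure Θ} [IsProbabilityMeasure m] {Y : Θ → Space d}
    (hY : Measurable Y) (hYc : ∀ ξ, charFun (m.map Y) ξ = Complex.exp (-(v * Ψ ξ : ℝ)))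
    (z : Space d) : ∫⁻ θ, γ (z + Y θ) ∂m = ENNReal.ofReal (potential γhat Ψ v z) := by
  let w : ℝ≥0 := (v / 2).toNNReal
  have hw : (w : ℝ) = v / 2 := Real.coe_toNNReal _ (by positivity)
  have hw0 : 0 < w := by rw [← NNReal.coe_pos, hw]; positivity
  have := Measure.isProbabilityMeasure_map (hX.measurable w).aemeasurable (μ := P')
  have := Measure.isProbabilityMeasure_map hY.aemeasurable (μ := m)
  have h := hγ.lintegral_add_conv_eq (hint w (by rw [hw]; positivity)) (hX.exponent w)
    (hX.exponent w) (hX.density w hw0) (ν'' := m.map Y)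
    (fun ξ => by rw [hYc, hw, add_halves]) z
  rw [hw, add_halves, lintegral_map (hγ.measurable_const_add z) hY] at h
  exact h

omit [IsProbabilityMeasure P'] in
theorem IsLevyProcess.map_sub (hX : IsLevyProcess X P') {r s : ℝ≥0} (h : r ≤ s) :
    P'.map (fun ω => X s ω - X r ω) = P'.map (X (s - r)) := by
  have := (hX.stationary r (s - r)).map_eq
  rwa [add_tsub_cancel_of_le h] at this

theorem IsSymmetricLevyProcess.lintegral_increment (hX : IsSymmetricLevyProcess X Ψ P')
    (hγ : IsSpatialCovariance γ γhat)
    (hint : ∀ v : ℝ, 0 < v → Integrable (fun ξ => Real.exp (-(v * Ψ ξ))) (spectralMeasure γhat))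
    {r s : ℝ≥0} (h : r < s) (z : Space d) :
    ∫⁻ ω, γ (z + (X s ω - X r ω)) ∂P' = ENNReal.ofReal (potential γhat Ψ (s - r) z) := by
  refine hX.lintegral_add_of_charFun hγ (sub_pos.2 (NNReal.coe_lt_coe.2 h)) hint
    (Y := fun ω => X s ω - X r ω) ((hX.measurable s).sub (hX.measurable r)) (fun ξ => ?_) z
  rw [hX.map_sub h.le, hX.exponent, NNReal.coe_sub h.le]

/-- The difference `X_s - X_r` is an increment over time `|s-r|`. -/
theorem IsSymmetricLevyProcess.lintegral_sub_same (hX : IsSymmetricLevyProcess X Ψ P')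
    (hγ : IsSpatialCovariance γ γhat)
    (hint : ∀ v : ℝ, 0 < v → Integrable (fun ξ => Real.exp (-(v * Ψ ξ))) (spectralMeasure γhat))
    {r s : ℝ≥0} (h : s ≠ r) (z : Space d) :
    ∫⁻ ω, γ (X s ω - X r ω + z) ∂P' = ENNReal.ofReal (potential γhat Ψ |(s : ℝ) - r| z) := by
  rcases lt_or_gt_of_ne h with h | h
  · have hlt : (s : ℝ) < r := NNReal.coe_lt_coe.2 h
    rw [abs_of_neg (sub_neg.2 hlt), neg_sub, ← potential_neg, ← hX.lintegral_increment hγ hint h]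
    refine lintegral_congr fun ω => ?_
    rw [← hγ.symmetric]
    congr 1
    abel
  · have hlt : (r : ℝ) < s := NNReal.coe_lt_coe.2 h
    rw [abs_of_pos (sub_pos.2 hlt), ← hX.lintegral_increment hγ hint h]
    simp only [add_comm]

/-- The difference of `X_s` and an independent copy of `X_r` has, by symmetry, the law of
`X_{s+r}`. -/
theorem IsSymmetricLevyProcess.lintegral_sub_indep (hX : IsSymmetricLevyProcess X Ψ P')
    (hγ : IsSpatialCovariance γ γhat)
    (hint : ∀ v : ℝ, 0 < v → Integrable (fun ξ => Real.exp (-(v * Ψ ξ))) (spectralMeasure γhat))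
    {r s : ℝ≥0} (hs : 0 < s) (z : Space d) :
    ∫⁻ θ, γ (X s θ.1 - X r θ.2 + z) ∂(P'.prod P') =
      ENNReal.ofReal (potential γhat Ψ ((s : ℝ) + r) z) := by
  have hv : (0 : ℝ) < s + r := add_pos_of_pos_of_nonneg hs r.coe_nonneg
  have hm : Measurable fun θ : Ω' × Ω' => X s θ.1 - X r θ.2 :=
    ((hX.measurable s).comp measurable_fst).sub ((hX.measurable r).comp measurable_snd)
  rw [← hX.lintegral_add_of_charFun hγ hv hint (m := P'.prod P') hm ?_ z]
  · simp only [add_comm]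
  · intro ξ
    have e1 : charFun (P'.map (X s)) ξ = ∫ ω, Complex.exp (inner ℝ (X s ω) ξ * Complex.I) ∂P' := by
      rw [charFun_apply, integral_map (hX.measurable s).aemeasurable (by fun_prop)]
    have e2 : charFun (P'.map (X r)) (-ξ) =
        ∫ ω, Complex.exp (inner ℝ (X r ω) (-ξ) * Complex.I) ∂P' := by
      rw [charFun_apply, integral_map (hX.measurable r).aemeasurable (by fun_prop)]
    have e3 : charFun (P'.map (X r)) (-ξ) = Complex.exp (-((r : ℝ) * Ψ ξ : ℝ)) := by
      rw [charFun_neg, hX.exponent, ← Complex.exp_conj, map_neg, Complex.conj_ofReal]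
    calc charFun ((P'.prod P').map fun θ => X s θ.1 - X r θ.2) ξ
        = ∫ θ, Complex.exp (inner ℝ (X s θ.1) ξ * Complex.I) *
            Complex.exp (inner ℝ (X r θ.2) (-ξ) * Complex.I) ∂(P'.prod P') := by
          rw [charFun_apply, integral_map hm.aemeasurable (by fun_prop)]
          refine integral_congr_ae (ae_of_all _ fun θ => ?_)
          simp only [inner_sub_left, inner_neg_right]
          rw [← Complex.exp_add]
          congr 1
          push_cast
          ring
      _ = _ := by
          rw [integral_prod_mul (fun ω => Complex.exp (inner ℝ (X s ω) ξ * Complex.I))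
            (fun ω => Complex.exp (inner ℝ (X r ω) (-ξ) * Complex.I)), ← e1, ← e2, e3, hX.exponent,
            ← Complex.exp_add]
          congr 1
          push_cast
          ring

end LevyLaw

/-! ### The majorant of the mean energy density -/

section EnergyKernel

variable {d : ℕ} {β₀ : ℝ} {γhat Ψ : Space d → ℝ}

/-- `|u|^{-β₀} (2π)^{-d} ∫ exp(-|u| Ψ) dμ`, the mean of `|r-s|^{-β₀} γ(X_r - X_s)` for
`|r-s| = |u|`. -/
noncomputable def energyKernel (β₀ : ℝ) (γhat Ψ : Space d → ℝ) (u : ℝ) : ℝ≥0∞ :=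
  ENNReal.ofReal (|u| ^ (-β₀)) * (ENNReal.ofReal ((2 * Real.pi) ^ d)⁻¹ *
    ∫⁻ ξ, ENNReal.ofReal (Real.exp (-(|u| * Ψ ξ))) ∂(spectralMeasure γhat))

theorem measurable_energyKernel (hm : Measurable Ψ) : Measurable (energyKernel β₀ γhat Ψ) := by
  unfold energyKernel
  have h : Measurable fun u : ℝ => ∫⁻ ξ, ENNReal.ofReal (Real.exp (-(|u| * Ψ ξ)))
      ∂(spectralMeasure γhat) := by
    refine Measurable.lintegral_prod_right' (f := fun q : ℝ × Space d =>
      ENNReal.ofReal (Real.exp (-(|q.1| * Ψ q.2)))) ?_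
    have h1 : Measurable fun q : ℝ × Space d => |q.1| * Ψ q.2 := by fun_prop
    fun_prop
  exact Measurable.mul (by fun_prop) (h.const_mul _)

theorem energyKernel_eq (hint : ∀ v : ℝ, 0 < v → Integrable (fun ξ => Real.exp (-(v * Ψ ξ)))
    (spectralMeasure γhat)) {u : ℝ} (hu : u ≠ 0) : energyKernel β₀ γhat Ψ u =
      ENNReal.ofReal (|u| ^ (-β₀)) * ENNReal.ofReal (potential γhat Ψ |u| 0) := by
  rw [ofReal_potential_zero (hint _ (abs_pos.2 hu)), energyKernel]

theorem energyKernel_neg (u : ℝ) : energyKernel β₀ γhat Ψ (-u) = energyKernel β₀ γhat Ψ u := by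
  simp only [energyKernel, abs_neg]

theorem setLIntegral_energyKernel_lt_top (hβ₀ : 0 < β₀) (hβ₁ : β₀ < 1) (hm : Measurable Ψ)
    (h0 : ∀ ξ, 0 ≤ Ψ ξ) (hI : SpectralCondition β₀ Ψ (spectralMeasure γhat)) {T : ℝ}
    (hT : 0 ≤ T) : ∫⁻ u in Ioc 0 T, energyKernel β₀ γhat Ψ u < ∞ := by
  refine lt_of_eq_of_lt ?_ (hI.lintegral_rpow_mul_potential_lt_top hβ₀ hβ₁ hm h0 hT)
  refine setLIntegral_congr_fun measurableSet_Ioc fun u hu => ?_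
  simp only [energyKernel_eq (fun v hv => hI.integrable_exp hβ₀ hβ₁ hm h0 hv) hu.1.ne',
    abs_of_pos hu.1]

/-- The potential at the origin decreases in time. -/
theorem potential_zero_anti (h0 : ∀ ξ, 0 ≤ Ψ ξ) {v w : ℝ}
    (hv : Integrable (fun ξ => Real.exp (-(v * Ψ ξ))) (spectralMeasure γhat))
    (hw : Integrable (fun ξ => Real.exp (-(w * Ψ ξ))) (spectralMeasure γhat)) (h : v ≤ w) :
    ENNReal.ofReal (potential γhat Ψ w 0) ≤ ENNReal.ofReal (potential γhat Ψ v 0) := by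
  rw [ofReal_potential_zero hv, ofReal_potential_zero hw]
  gcongr with ξ
  exact h0 ξ

theorem setLIntegral_Ioc_sub_le {k : ℝ → ℝ≥0∞} (hneg : ∀ u, k (-u) = k u)
    {a b s : ℝ} (hs : s ∈ Icc a b) :
    ∫⁻ r in Ioc a b, k (s - r) ≤ 2 * ∫⁻ u in Ioc 0 (b - a), k u := by
  have h1 : ∫⁻ r in Ioc s b, k (s - r) ≤ ∫⁻ u in Ioc 0 (b - a), k u := by
    have e : ∫⁻ r in Ioc s b, k (s - r) = ∫⁻ u in Ioc 0 (b - s), k u := by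
      have := (measurePreserving_add_right (volume : Measure ℝ) s).setLIntegral_comp_preimage_emb
        (MeasurableEquiv.addRight s).measurableEmbedding (fun r => k (s - r)) (Ioc s b)
      rw [← this]
      simp only [preimage_add_const_Ioc, sub_self]
      refine lintegral_congr fun u => ?_
      rw [← hneg]
      congr 1
      ring
    rw [e]
    exact lintegral_mono_set (Ioc_subset_Ioc_right (by linarith [hs.1]))
  have h2 : ∫⁻ r in Ioc a s, k (s - r) ≤ ∫⁻ u in Ioc 0 (b - a), k u := by
    have e : ∫⁻ r in Ioc a s, k (s - r) = ∫⁻ u in Ico 0 (s - a), k u := by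
      have := (Measure.measurePreserving_sub_left (volume : Measure ℝ) s).setLIntegral_comp_preimage_emb
        (MeasurableEquiv.subLeft s).measurableEmbedding (fun r => k (s - r)) (Ioc a s)
      rw [← this]
      simp only [preimage_const_sub_Ioc, sub_self, sub_sub_cancel]
    rw [e, setLIntegral_congr Ico_ae_eq_Ioc]
    exact lintegral_mono_set (Ioc_subset_Ioc_right (by linarith [hs.2]))
  rw [← Ioc_union_Ioc_eq_Ioc hs.1 hs.2, two_mul]
  exact (lintegral_union_le _ _ _).trans (add_le_add h2 h1)

theorem lintegral_lintegral_sub_lt_top {k : ℝ → ℝ≥0∞}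
    (hneg : ∀ u, k (-u) = k u) {t : ℝ} (hfin : ∫⁻ u in Ioc 0 t, k u < ∞) :
    ∫⁻ s in Ioc 0 t, ∫⁻ r in Ioc 0 t, k (s - r) < ∞ := by
  have h : ∫⁻ s in Ioc 0 t, ∫⁻ r in Ioc 0 t, k (s - r) ≤
      ∫⁻ s in Ioc 0 t, 2 * ∫⁻ u in Ioc 0 t, k u := by
    refine setLIntegral_mono measurable_const fun s hs => ?_
    have := setLIntegral_Ioc_sub_le hneg (Ioc_subset_Icc_self hs)
    rwa [sub_zero] at this
  refine h.trans_lt ?_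
  rw [setLIntegral_const]
  exact ENNReal.mul_lt_top (ENNReal.mul_lt_top (by simp) hfin) (by simp)

end EnergyKernel

/-! ### Mean energies and their approximations -/

/-- Lebesgue measure on the square `(0,t)²`. -/
noncomputable def timeSquare (t : ℝ) : Measure (ℝ × ℝ) :=
  (volume.restrict (Ioo 0 t)).prod (volume.restrict (Ioo 0 t))

instance (t : ℝ) : SFinite (timeSquare t) := by unfold timeSquare; infer_instance

theorem ae_timeSquare (t : ℝ) :
    ∀ᵐ p ∂(timeSquare t), p.1 ∈ Ioo 0 t ∧ p.2 ∈ Ioo 0 t ∧ p.1 ≠ p.2 := by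
  have h1 : ∀ᵐ p ∂(timeSquare t), p ∈ Ioo 0 t ×ˢ Ioo 0 t := by
    rw [timeSquare, Measure.prod_restrict]
    exact ae_restrict_mem (measurableSet_Ioo.prod measurableSet_Ioo)
  have h2 : ∀ᵐ p ∂(timeSquare t), p.1 ≠ p.2 := by
    refine (Measure.ae_prod_iff_ae_ae ?_).2 (ae_of_all _ fun s => ?_)
    · exact (measurableSet_eq_fun measurable_fst measurable_snd).compl
    · exact ae_restrict_of_ae ((Measure.ae_ne volume s).mono fun r h => h.symm)
  filter_upwards [h1, h2] with p hp hne using ⟨hp.1, hp.2, hne⟩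

theorem lintegral_timeSquare_sub_lt_top {k : ℝ → ℝ≥0∞} (hk : Measurable k)
    (hneg : ∀ u, k (-u) = k u) {t : ℝ} (hfin : ∫⁻ u in Ioc 0 t, k u < ∞) :
    ∫⁻ p, k (p.1 - p.2) ∂(timeSquare t) < ∞ := by
  have hk' : Measurable fun p : ℝ × ℝ => k (p.1 - p.2) := hk.comp (by fun_prop)
  rw [timeSquare, lintegral_prod _ hk'.aemeasurable, Measure.restrict_congr_set Ioo_ae_eq_Ioc]
  exact lintegral_lintegral_sub_lt_top hneg hfin

section MutualEnergy

variable {d : ℕ} {β₀ : ℝ} {γ : Space d → ℝ≥0∞} {t : ℝ≥0}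

theorem measurable_kernel_mul_covariance {Θ : Type*} [MeasurableSpace Θ] (hγ : Measurable γ)
    {A B : ℝ≥0 → Θ → Space d} (hA : Measurable fun p : ℝ × Θ => A p.1.toNNReal p.2)
    (hB : Measurable fun p : ℝ × Θ => B p.1.toNNReal p.2) {k : ℝ × ℝ → ℝ≥0∞} (hk : Measurable k) :
    Measurable fun q : Θ × (ℝ × ℝ) =>
      k q.2 * γ (A q.2.1.toNNReal q.1 - B q.2.2.toNNReal q.1) := by
  have h1 : Measurable fun q : Θ × (ℝ × ℝ) => A q.2.1.toNNReal q.1 :=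
    hA.comp (measurable_snd.fst.prodMk measurable_fst)
  have h2 : Measurable fun q : Θ × (ℝ × ℝ) => B q.2.2.toNNReal q.1 :=
    hB.comp (measurable_snd.snd.prodMk measurable_fst)
  exact (hk.comp measurable_snd).mul (hγ.comp (h1.sub h2))

theorem mutualEnergy_eq (hγ : Measurable γ) {f g : ℝ≥0 → Space d}
    (hf : Measurable fun s : ℝ => f s.toNNReal) (hg : Measurable fun s : ℝ => g s.toNNReal) :
    mutualEnergy β₀ γ t f g = ∫⁻ p, ENNReal.ofReal (|p.1 - p.2| ^ (-β₀)) *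
      γ (f p.1.toNNReal - g p.2.toNNReal) ∂(timeSquare t) := by
  have hm : Measurable fun p : ℝ × ℝ => ENNReal.ofReal (|p.1 - p.2| ^ (-β₀)) *
      γ (f p.1.toNNReal - g p.2.toNNReal) :=
    Measurable.mul (by fun_prop)
      (hγ.comp ((hf.comp measurable_fst).sub (hg.comp measurable_snd)))
  rw [timeSquare, lintegral_prod _ hm.aemeasurable, Measure.restrict_congr_set Ioo_ae_eq_Icc]
  rfl

theorem measurable_mutualEnergy {Θ : Type*} [MeasurableSpace Θ] (hγ : Measurable γ)
    {A B : ℝ≥0 → Θ → Space d} (hA : Measurable fun p : ℝ × Θ => A p.1.toNNReal p.2)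
    (hB : Measurable fun p : ℝ × Θ => B p.1.toNNReal p.2) :
    Measurable fun θ => mutualEnergy β₀ γ t (fun s => A s θ) fun s => B s θ := by
  have h : ∀ θ, mutualEnergy β₀ γ t (fun s => A s θ) (fun s => B s θ) =
      ∫⁻ p, ENNReal.ofReal (|p.1 - p.2| ^ (-β₀)) *
        γ (A p.1.toNNReal θ - B p.2.toNNReal θ) ∂(timeSquare t) := fun θ =>
    mutualEnergy_eq hγ (hA.comp measurable_prodMk_right) (hB.comp measurable_prodMk_right)
  simp only [h]
  exact (measurable_kernel_mul_covariance hγ hA hB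
    (k := fun p : ℝ × ℝ => ENNReal.ofReal (|p.1 - p.2| ^ (-β₀)))
    (by fun_prop)).lintegral_prod_right'

theorem IsMollifier.noiseLIntegral_eq_timeSquare {ρ : Space d → ℝ} (hρ : IsMollifier ρ)
    (hγ : Measurable γ) {ε δ ε' δ' : ℝ} (hε : 0 < ε) (hδ : 0 < δ) (hε' : 0 < ε') (hδ' : 0 < δ')
    {x : Space d} {f g : ℝ≥0 → Space d} (hf : Measurable fun s : ℝ => f s.toNNReal)
    (hg : Measurable fun s : ℝ => g s.toNNReal) :
    noiseLIntegral β₀ γ (approxDelta ρ ε δ t x f) (approxDelta ρ ε' δ' t x g) =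
      ∫⁻ p, timeKernel β₀ t δ δ' p.1 p.2 *
        spaceKernel γ ρ ε ε' (f p.1.toNNReal - g p.2.toNNReal) ∂(timeSquare t) := by
  have hm : Measurable fun p : ℝ × ℝ => timeKernel β₀ t δ δ' p.1 p.2 *
      spaceKernel γ ρ ε ε' (f p.1.toNNReal - g p.2.toNNReal) :=
    (measurable_timeKernel β₀ t δ δ').mul ((measurable_spaceKernel hγ ε ε').comp
      ((hf.comp measurable_fst).sub (hg.comp measurable_snd)))
  rw [hρ.noiseLIntegral_approxDelta hγ hε hδ hε' hδ' hf hg, timeSquare,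
    lintegral_prod _ hm.aemeasurable, Measure.restrict_congr_set Ioo_ae_eq_Ioc]

end MutualEnergy

/-- Two jointly measurable processes `A`, `B` whose difference `A_s - B_r` has the characteristic
function `exp(-τ(s,r) Ψ)`, as far as the means of `γ` are concerned. It holds for `A = B = X` with
`τ(s,r) = |s-r|`, and for two independent copies of `X` with `τ(s,r) = s+r`. -/
structure IsPotentialPair {d : ℕ} {Θ : Type*} [MeasurableSpace Θ] (γ : Space d → ℝ≥0∞)
    (γhat Ψ : Space d → ℝ) (m : Measure Θ) (A B : ℝ≥0 → Θ → Space d) (τ : ℝ → ℝ → ℝ) :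
    Prop where
  measurable_left : Measurable fun p : ℝ × Θ => A p.1.toNNReal p.2
  measurable_right : Measurable fun p : ℝ × Θ => B p.1.toNNReal p.2
  abs_sub_le : ∀ s r, 0 < s → 0 < r → |s - r| ≤ τ s r
  lintegral_eq : ∀ s r, 0 < s → 0 < r → s ≠ r → ∀ z,
    ∫⁻ θ, γ (A s.toNNReal θ - B r.toNNReal θ + z) ∂m = ENNReal.ofReal (potential γhat Ψ (τ s r) z)

section LevyPairs

variable {d : ℕ} {Ω' : Type*} [MeasurableSpace Ω'] {P' : Measure Ω'} [IsProbabilityMeasure P']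
  {X : ℝ≥0 → Ω' → Space d} {Ψ : Space d → ℝ} {γ : Space d → ℝ≥0∞} {γhat : Space d → ℝ}

theorem IsSymmetricLevyProcess.isPotentialPair_same (hX : IsSymmetricLevyProcess X Ψ P')
    (hc : ∀ ω, IsCadlagPath fun s => X s ω) (hγ : IsSpatialCovariance γ γhat)
    (hint : ∀ v : ℝ, 0 < v → Integrable (fun ξ => Real.exp (-(v * Ψ ξ))) (spectralMeasure γhat)) :
    IsPotentialPair γ γhat Ψ P' X X fun s r => |s - r| where
  measurable_left := measurable_uncurry_real_of_cadlag hX.measurable hc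
  measurable_right := measurable_uncurry_real_of_cadlag hX.measurable hc
  abs_sub_le s r _ _ := le_rfl
  lintegral_eq s r hs hr hsr z := by
    have h : s.toNNReal ≠ r.toNNReal := fun h => hsr ((Real.toNNReal_eq_toNNReal_iff hs.le hr.le).1 h)
    rw [hX.lintegral_sub_same hγ hint h, Real.coe_toNNReal _ hs.le, Real.coe_toNNReal _ hr.le]

theorem IsSymmetricLevyProcess.isPotentialPair_indep (hX : IsSymmetricLevyProcess X Ψ P')
    (hc : ∀ ω, IsCadlagPath fun s => X s ω) (hγ : IsSpatialCovariance γ γhat)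
    (hint : ∀ v : ℝ, 0 < v → Integrable (fun ξ => Real.exp (-(v * Ψ ξ))) (spectralMeasure γhat)) :
    IsPotentialPair γ γhat Ψ (P'.prod P') (fun s θ => X s θ.1) (fun s θ => X s θ.2)
      fun s r => s + r where
  measurable_left := (measurable_uncurry_real_of_cadlag hX.measurable hc).comp
    (measurable_fst.prodMk measurable_snd.fst)
  measurable_right := (measurable_uncurry_real_of_cadlag hX.measurable hc).comp
    (measurable_fst.prodMk measurable_snd.snd)
  abs_sub_le s r hs hr := by rw [abs_le]; constructor <;> linarith
  lintegral_eq s r hs hr hsr z := by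
    rw [hX.lintegral_sub_indep hγ hint (Real.toNNReal_pos.2 hs), Real.coe_toNNReal _ hs.le,
      Real.coe_toNNReal _ hr.le]

end LevyPairs

section PotentialPair

variable {d : ℕ} {Θ : Type*} [MeasurableSpace Θ] {γ : Space d → ℝ≥0∞} {γhat Ψ : Space d → ℝ}
  {m : Measure Θ} {A B : ℝ≥0 → Θ → Space d} {τ : ℝ → ℝ → ℝ}
  {ρ : Space d → ℝ} {β₀ : ℝ} {t : ℝ≥0} {x : Space d}

theorem IsPotentialPair.measurable_sub (h : IsPotentialPair γ γhat Ψ m A B τ) (s r : ℝ) :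
    Measurable fun θ => A s.toNNReal θ - B r.toNNReal θ :=
  (h.measurable_left.comp measurable_prodMk_left).sub (h.measurable_right.comp measurable_prodMk_left)

theorem IsPotentialPair.lintegral_spaceKernel [SFinite m] (h : IsPotentialPair γ γhat Ψ m A B τ)
    (hγ : Measurable γ) {s r : ℝ} (hs : 0 < s) (hr : 0 < r) (hsr : s ≠ r) (ε ε' : ℝ) :
    ∫⁻ θ, spaceKernel γ ρ ε ε' (A s.toNNReal θ - B r.toNNReal θ) ∂m =
      ∫⁻ q, ENNReal.ofReal (potential γhat Ψ (τ s r) (-q.1 + q.2))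
        ∂((spaceAvg ρ ε).prod (spaceAvg ρ ε')) := by
  unfold spaceKernel
  rw [lintegral_lintegral_swap]
  · refine lintegral_congr fun q => ?_
    rw [← h.lintegral_eq s r hs hr hsr]
    refine lintegral_congr fun θ => ?_
    congr 1
    abel
  · refine (hγ.comp ?_).aemeasurable
    exact (((h.measurable_sub s r).comp measurable_fst).sub measurable_snd.fst).add
      measurable_snd.snd

variable (hint : ∀ v : ℝ, 0 < v → Integrable (fun ξ => Real.exp (-(v * Ψ ξ)))
    (spectralMeasure γhat))

include hint

theorem IsPotentialPair.potential_le (h : IsPotentialPair γ γhat Ψ m A B τ)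
    (h0 : ∀ ξ, 0 ≤ Ψ ξ) {s r : ℝ} (hs : 0 < s) (hr : 0 < r) (hsr : s ≠ r) (z : Space d) :
    ENNReal.ofReal (potential γhat Ψ (τ s r) z) ≤
      ENNReal.ofReal (potential γhat Ψ |s - r| 0) := by
  have h1 : 0 < |s - r| := abs_pos.2 (sub_ne_zero.2 hsr)
  have h2 := h.abs_sub_le s r hs hr
  exact (ENNReal.ofReal_le_ofReal (potential_le_zero (hint _ (h1.trans_le h2)) z)).trans
    (potential_zero_anti h0 (hint _ h1) (hint _ (h1.trans_le h2)) h2)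

theorem IsPotentialPair.lintegral_spaceKernel_le [SFinite m] (h : IsPotentialPair γ γhat Ψ m A B τ)
    (hγ : Measurable γ) (h0 : ∀ ξ, 0 ≤ Ψ ξ) (hρ : IsMollifier ρ) {s r : ℝ} (hs : 0 < s)
    (hr : 0 < r) (hsr : s ≠ r) {ε ε' : ℝ} (hε : 0 < ε) (hε' : 0 < ε') :
    ∫⁻ θ, spaceKernel γ ρ ε ε' (A s.toNNReal θ - B r.toNNReal θ) ∂m ≤
      ENNReal.ofReal (potential γhat Ψ |s - r| 0) := by
  have := hρ.isProbabilityMeasure_spaceAvg hε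
  have := hρ.isProbabilityMeasure_spaceAvg hε'
  rw [h.lintegral_spaceKernel hγ hs hr hsr]
  refine (lintegral_mono fun q => h.potential_le hint h0 hs hr hsr _).trans ?_
  simp

theorem IsPotentialPair.tendsto_lintegral_spaceKernel [SFinite m]
    (h : IsPotentialPair γ γhat Ψ m A B τ)
    (hγ : Measurable γ) (hρ : IsMollifier ρ) {s r : ℝ} (hs : 0 < s) (hr : 0 < r) (hsr : s ≠ r) :
    Tendsto (fun q : ℝ × ℝ =>
        ∫⁻ θ, spaceKernel γ ρ q.1 q.2 (A s.toNNReal θ - B r.toNNReal θ) ∂m)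
      (𝓝[>] 0 ×ˢ 𝓝[>] 0) (𝓝 (∫⁻ θ, γ (A s.toNNReal θ - B r.toNNReal θ) ∂m)) := by
  have hc : Continuous (potential γhat Ψ (τ s r)) := continuous_potential
    (hint _ ((abs_pos.2 (sub_ne_zero.2 hsr)).trans_le (h.abs_sub_le s r hs hr)))
  have h1 := hρ.tendsto_lintegral (h := fun q : Space d × Space d =>
    ENNReal.ofReal (potential γhat Ψ (τ s r) (-q.1 + q.2)))
    (ENNReal.continuous_ofReal.comp (hc.comp (by fun_prop))).continuousAt
  simp only [← h.lintegral_spaceKernel hγ hs hr hsr, neg_zero, add_zero] at h1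
  rw [← h.lintegral_eq s r hs hr hsr 0] at h1
  simpa only [add_zero] using h1

omit hint in
theorem IsPotentialPair.lintegral_noise [SFinite m] (h : IsPotentialPair γ γhat Ψ m A B τ)
    (hγ : Measurable γ) (hρ : IsMollifier ρ) {ε δ ε' δ' : ℝ} (hε : 0 < ε) (hδ : 0 < δ)
    (hε' : 0 < ε') (hδ' : 0 < δ') :
    ∫⁻ θ, noiseLIntegral β₀ γ (approxDelta ρ ε δ t x fun s => A s θ)
      (approxDelta ρ ε' δ' t x fun s => B s θ) ∂m =
    ∫⁻ p, timeKernel β₀ t δ δ' p.1 p.2 *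
      (∫⁻ θ, spaceKernel γ ρ ε ε' (A p.1.toNNReal θ - B p.2.toNNReal θ) ∂m) ∂(timeSquare t) := by
  have hm := measurable_kernel_mul_covariance (measurable_spaceKernel hγ ε ε' (ρ := ρ))
    h.measurable_left
    h.measurable_right (measurable_timeKernel β₀ t δ δ')
  have e : ∀ θ, noiseLIntegral β₀ γ (approxDelta ρ ε δ t x fun s => A s θ)
      (approxDelta ρ ε' δ' t x fun s => B s θ) = ∫⁻ p, timeKernel β₀ t δ δ' p.1 p.2 *
        spaceKernel γ ρ ε ε' (A p.1.toNNReal θ - B p.2.toNNReal θ) ∂(timeSquare t) := fun θ =>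
    hρ.noiseLIntegral_eq_timeSquare hγ hε hδ hε' hδ' (h.measurable_left.comp measurable_prodMk_right)
      (h.measurable_right.comp measurable_prodMk_right)
  simp only [e]
  rw [lintegral_lintegral_swap hm.aemeasurable]
  refine lintegral_congr fun p => ?_
  rw [lintegral_const_mul]
  exact (measurable_spaceKernel hγ ε ε').comp (h.measurable_sub p.1 p.2)

omit hint in
theorem IsPotentialPair.lintegral_mutualEnergy [SFinite m] (h : IsPotentialPair γ γhat Ψ m A B τ)
    (hγ : Measurable γ) : ∫⁻ θ, mutualEnergy β₀ γ t (fun s => A s θ) (fun s => B s θ) ∂m =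
      ∫⁻ p, ENNReal.ofReal (|p.1 - p.2| ^ (-β₀)) *
        (∫⁻ θ, γ (A p.1.toNNReal θ - B p.2.toNNReal θ) ∂m) ∂(timeSquare t) := by
  have hm := measurable_kernel_mul_covariance hγ h.measurable_left h.measurable_right
    (k := fun p : ℝ × ℝ => ENNReal.ofReal (|p.1 - p.2| ^ (-β₀))) (by fun_prop)
  have e : ∀ θ, mutualEnergy β₀ γ t (fun s => A s θ) (fun s => B s θ) =
      ∫⁻ p, ENNReal.ofReal (|p.1 - p.2| ^ (-β₀)) *
        γ (A p.1.toNNReal θ - B p.2.toNNReal θ) ∂(timeSquare t) := fun θ =>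
    mutualEnergy_eq hγ (h.measurable_left.comp measurable_prodMk_right)
      (h.measurable_right.comp measurable_prodMk_right)
  simp only [e]
  rw [lintegral_lintegral_swap hm.aemeasurable]
  refine lintegral_congr fun p => ?_
  rw [lintegral_const_mul]
  exact hγ.comp (h.measurable_sub p.1 p.2)

variable (hfin : ∫⁻ p, energyKernel β₀ γhat Ψ (p.1 - p.2) ∂(timeSquare t) < ∞)

include hfin

theorem IsPotentialPair.lintegral_mutualEnergy_lt_top [SFinite m]
    (h : IsPotentialPair γ γhat Ψ m A B τ)
    (hγ : Measurable γ) (h0 : ∀ ξ, 0 ≤ Ψ ξ) :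
    ∫⁻ θ, mutualEnergy β₀ γ t (fun s => A s θ) (fun s => B s θ) ∂m < ∞ := by
  rw [h.lintegral_mutualEnergy hγ]
  refine (lintegral_mono_ae ?_).trans_lt hfin
  filter_upwards [ae_timeSquare t] with p hp
  rw [energyKernel_eq hint (sub_ne_zero.2 hp.2.2)]
  gcongr
  have := h.lintegral_eq p.1 p.2 hp.1.1 hp.2.1.1 hp.2.2 0
  simp only [add_zero] at this
  rw [this]
  exact h.potential_le hint h0 hp.1.1 hp.2.1.1 hp.2.2 _

omit hint hfin in
theorem IsPotentialPair.measurable_lintegral_spaceKernel [SFinite m]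
    (h : IsPotentialPair γ γhat Ψ m A B τ) (hγ : Measurable γ) (δ δ' ε ε' : ℝ) :
    Measurable fun p : ℝ × ℝ => timeKernel β₀ t δ δ' p.1 p.2 *
      (∫⁻ θ, spaceKernel γ ρ ε ε' (A p.1.toNNReal θ - B p.2.toNNReal θ) ∂m) := by
  refine (measurable_timeKernel β₀ t δ δ').mul ?_
  have hm := measurable_kernel_mul_covariance (measurable_spaceKernel hγ ε ε' (ρ := ρ))
    h.measurable_left
    h.measurable_right (k := fun _ => 1) measurable_const
  simp only [one_mul] at hm
  exact hm.lintegral_prod_left'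

/-- The mean energies of the approximating integrands are finite and converge to the mean mutual
energy, whichever way the two pairs of parameters tend to `0`. -/
theorem IsPotentialPair.tendsto_lintegral_noise [SFinite m] (h : IsPotentialPair γ γhat Ψ m A B τ)
    (hγ : Measurable γ) (h0 : ∀ ξ, 0 ≤ Ψ ξ) (hρ : IsMollifier ρ) (hβ₀ : 0 < β₀) (hβ₁ : β₀ < 1)
    {ι : Type*} {l : Filter ι} [l.IsCountablyGenerated] {ε δ ε' δ' : ι → ℝ}
    (hε : Tendsto ε l (𝓝[>] 0)) (hδ : Tendsto δ l (𝓝[>] 0)) (hε' : Tendsto ε' l (𝓝[>] 0))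
    (hδ' : Tendsto δ' l (𝓝[>] 0)) :
    Tendsto (fun i => ∫⁻ θ, noiseLIntegral β₀ γ (approxDelta ρ (ε i) (δ i) t x fun s => A s θ)
      (approxDelta ρ (ε' i) (δ' i) t x fun s => B s θ) ∂m) l
      (𝓝 (∫⁻ θ, mutualEnergy β₀ γ t (fun s => A s θ) (fun s => B s θ) ∂m)) := by
  obtain ⟨C, hC, hCb⟩ := exists_timeKernel_le hβ₀ hβ₁
  have pos : ∀ {e : ι → ℝ}, Tendsto e l (𝓝[>] 0) → ∀ᶠ i in l, 0 < e i := fun he =>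
    (tendsto_nhdsWithin_iff.1 he).2
  rw [h.lintegral_mutualEnergy hγ]
  have key : Tendsto (fun i => ∫⁻ p, timeKernel β₀ t (δ i) (δ' i) p.1 p.2 *
      (∫⁻ θ, spaceKernel γ ρ (ε i) (ε' i) (A p.1.toNNReal θ - B p.2.toNNReal θ) ∂m)
        ∂(timeSquare t)) l (𝓝 (∫⁻ p, ENNReal.ofReal (|p.1 - p.2| ^ (-β₀)) *
        (∫⁻ θ, γ (A p.1.toNNReal θ - B p.2.toNNReal θ) ∂m) ∂(timeSquare t))) := by
    -- Dominated by a multiple of the energy kernel; off the diagonal both mollified kernels converge.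
    refine tendsto_lintegral_filter_of_dominated_convergence
      (fun p => C * energyKernel β₀ γhat Ψ (p.1 - p.2))
      (Eventually.of_forall fun i => h.measurable_lintegral_spaceKernel hγ _ _ _ _) ?_ ?_ ?_
    · filter_upwards [pos hε, pos hδ, pos hε', pos hδ'] with i h1 h2 h3 h4
      filter_upwards [ae_timeSquare t] with p hp
      rw [energyKernel_eq hint (sub_ne_zero.2 hp.2.2), ← mul_assoc]
      exact mul_le_mul' (hCb t _ _ h2 h4 _ _ hp.2.2)
        (h.lintegral_spaceKernel_le hint hγ h0 hρ hp.1.1 hp.2.1.1 hp.2.2 h1 h3)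
    · rw [lintegral_const_mul' _ _ hC.ne]
      exact (ENNReal.mul_lt_top hC hfin).ne
    · filter_upwards [ae_timeSquare t] with p hp
      have hlt : ∫⁻ θ, γ (A p.1.toNNReal θ - B p.2.toNNReal θ) ∂m < ∞ := by
        have := h.lintegral_eq p.1 p.2 hp.1.1 hp.2.1.1 hp.2.2 0
        simp only [add_zero] at this
        rw [this]
        exact ENNReal.ofReal_lt_top
      have t1 := (tendsto_timeKernel (β := β₀) hp.1 hp.2.1 hp.2.2).comp (hδ.prodMk hδ')
      have t2 := (h.tendsto_lintegral_spaceKernel hint hγ hρ hp.1.1 hp.2.1.1 hp.2.2).comp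
        (hε.prodMk hε')
      simp only [Function.comp_def] at t1 t2
      exact ENNReal.Tendsto.mul t1 (Or.inr hlt.ne) t2 (Or.inr ENNReal.ofReal_ne_top)
  refine key.congr' ?_
  filter_upwards [pos hε, pos hδ, pos hε', pos hδ'] with i h1 h2 h3 h4
  exact (h.lintegral_noise hγ hρ h1 h2 h3 h4).symm

theorem IsPotentialPair.lintegral_noise_lt_top [SFinite m] (h : IsPotentialPair γ γhat Ψ m A B τ)
    (hγ : Measurable γ) (h0 : ∀ ξ, 0 ≤ Ψ ξ) (hρ : IsMollifier ρ) (hβ₀ : 0 < β₀) (hβ₁ : β₀ < 1)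
    {ε δ ε' δ' : ℝ} (hε : 0 < ε) (hδ : 0 < δ) (hε' : 0 < ε') (hδ' : 0 < δ') :
    ∫⁻ θ, noiseLIntegral β₀ γ (approxDelta ρ ε δ t x fun s => A s θ)
      (approxDelta ρ ε' δ' t x fun s => B s θ) ∂m < ∞ := by
  obtain ⟨C, hC, hCb⟩ := exists_timeKernel_le hβ₀ hβ₁
  rw [h.lintegral_noise hγ hρ hε hδ hε' hδ']
  have : ∫⁻ p, C * energyKernel β₀ γhat Ψ (p.1 - p.2) ∂(timeSquare t) < ∞ := by
    rw [lintegral_const_mul' _ _ hC.ne]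
    exact ENNReal.mul_lt_top hC hfin
  refine (lintegral_mono_ae ?_).trans_lt this
  filter_upwards [ae_timeSquare t] with p hp
  rw [energyKernel_eq hint (sub_ne_zero.2 hp.2.2), ← mul_assoc]
  exact mul_le_mul' (hCb t _ _ hδ hδ' _ _ hp.2.2)
    (h.lintegral_spaceKernel_le hint hγ h0 hρ hp.1.1 hp.2.1.1 hp.2.2 hε hε')

end PotentialPair

/-! ### Limits in `L²` -/

theorem MeasureTheory.MemLp.eLpNorm_sub_two_sq {α : Type*} [MeasurableSpace α] {μ : Measure α}
    {f g : α → ℝ} (hf : MemLp f 2 μ) (hg : MemLp g 2 μ) : eLpNorm (f - g) 2 μ ^ 2 =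
      ENNReal.ofReal ((∫ x, f x * f x ∂μ) - 2 * (∫ x, f x * g x ∂μ) + ∫ x, g x * g x ∂μ) := by
  have i1 : Integrable (fun x => f x * f x) μ := hf.integrable_mul hf
  have i2 : Integrable (fun x => 2 * (f x * g x)) μ := (hf.integrable_mul hg).const_mul 2
  have i3 : Integrable (fun x => g x * g x) μ := hg.integrable_mul hg
  have i4 : Integrable (fun x => f x * f x - 2 * (f x * g x)) μ := i1.sub i2
  rw [(hf.sub hg).eLpNorm_two_sq_eq, ← integral_const_mul, ← integral_sub i1 i2,
    ← integral_add i4 i3]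
  congr 1
  refine integral_congr_ae (ae_of_all _ fun x => ?_)
  simp only [Pi.sub_apply]
  ring

theorem tendsto_integral_mul_of_eLpNorm {α ι : Type*} [MeasurableSpace α] {μ : Measure α}
    {l : Filter ι} {f g : ι → α → ℝ} {f' g' : α → ℝ} (hf : ∀ n, MemLp (f n) 2 μ)
    (hg : ∀ n, MemLp (g n) 2 μ) (hf' : MemLp f' 2 μ) (hg' : MemLp g' 2 μ)
    (h : Tendsto (fun n => eLpNorm (f n - f') 2 μ) l (𝓝 0))
    (h' : Tendsto (fun n => eLpNorm (g n - g') 2 μ) l (𝓝 0)) :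
    Tendsto (fun n => ∫ x, f n x * g n x ∂μ) l (𝓝 (∫ x, f' x * g' x ∂μ)) := by
  have key : ∀ {u v : α → ℝ} (hu : MemLp u 2 μ) (hv : MemLp v 2 μ),
      ∫ x, u x * v x ∂μ = inner ℝ (hv.toLp v) (hu.toLp u) := fun hu hv => by
    rw [L2.inner_def]
    refine integral_congr_ae ?_
    filter_upwards [hu.coeFn_toLp, hv.coeFn_toLp] with x h1 h2
    simp [h1, h2]
  simp only [key (hf _) (hg _), key hf' hg']
  exact ((Lp.tendsto_Lp_iff_tendsto_eLpNorm'' g hg g' hg').2 h').inner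
    ((Lp.tendsto_Lp_iff_tendsto_eLpNorm'' f hf f' hf').2 h)

/-- An `L²` limit of centred Gaussian variables is centred Gaussian. -/
theorem map_eq_gaussianReal_of_tendsto {Ω : Type*} [MeasurableSpace Ω] {P : Measure Ω}
    [IsProbabilityMeasure P] {f : ℕ → Ω → ℝ} {f' : Ω → ℝ} {v : ℕ → ℝ≥0} {v' : ℝ≥0}
    (hf : ∀ n, MemLp (f n) 2 P) (hf' : MemLp f' 2 P) (hg : ∀ n, P.map (f n) = gaussianReal 0 (v n))
    (h : Tendsto (fun n => eLpNorm (f n - f') 2 P) atTop (𝓝 0)) (hv : Tendsto v atTop (𝓝 v')) :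
    P.map f' = gaussianReal 0 v' := by
  have := Measure.isProbabilityMeasure_map hf'.1.aemeasurable (μ := P)
  refine Measure.ext_of_charFun (funext fun u => ?_)
  have cf : ∀ {g : Ω → ℝ}, AEMeasurable g P → charFun (P.map g) u =
      ∫ ω, Complex.exp (u * g ω * Complex.I) ∂P := fun hg => by
    rw [charFun_apply_real, integral_map hg (by fun_prop)]
  have hint : ∀ {g : Ω → ℝ}, MemLp g 2 P →
      Integrable (fun ω => Complex.exp (u * g ω * Complex.I)) P := fun {g} hg => by
    refine Integrable.of_bound (C := 1) ?_ (ae_of_all _ fun ω => ?_)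
    · have : Continuous fun y : ℝ => Complex.exp (u * y * Complex.I) := by fun_prop
      exact this.comp_aestronglyMeasurable hg.1
    · rw [← Complex.ofReal_mul, Complex.norm_exp_ofReal_mul_I]
  have hle : ∀ n, ‖charFun (P.map (f n)) u - charFun (P.map f') u‖ₑ ≤
      ‖u‖ₑ * eLpNorm (f n - f') 2 P := fun n => by
    rw [cf (hf n).1.aemeasurable, cf hf'.1.aemeasurable, ← integral_sub (hint (hf n)) (hint hf')]
    calc ‖∫ ω, (Complex.exp (u * f n ω * Complex.I) - Complex.exp (u * f' ω * Complex.I)) ∂P‖ₑ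
        ≤ ∫⁻ ω, ‖Complex.exp (u * f n ω * Complex.I) - Complex.exp (u * f' ω * Complex.I)‖ₑ ∂P :=
          enorm_integral_le_lintegral_enorm _
      _ ≤ ∫⁻ ω, ‖u‖ₑ * ‖f n ω - f' ω‖ₑ ∂P := by
          refine lintegral_mono fun ω => ?_
          rw [← enorm_mul, enorm_le_iff_norm_le]
          have e : Complex.exp (u * f n ω * Complex.I) - Complex.exp (u * f' ω * Complex.I) =
              Complex.exp (u * f' ω * Complex.I) *
                (Complex.exp (Complex.I * ((u * (f n ω - f' ω) : ℝ) : ℂ)) - 1) := by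
            rw [mul_sub, ← Complex.exp_add, mul_one]
            congr 2
            push_cast
            ring
          rw [e, norm_mul, ← Complex.ofReal_mul, Complex.norm_exp_ofReal_mul_I, one_mul]
          exact Real.norm_exp_I_mul_ofReal_sub_one_le
      _ = ‖u‖ₑ * eLpNorm (f n - f') 1 P := by
          rw [lintegral_const_mul' _ _ (by simp), eLpNorm_one_eq_lintegral_enorm]
          rfl
      _ ≤ _ := by
          gcongr
          exact eLpNorm_le_eLpNorm_of_exponent_le (by norm_num) ((hf n).1.sub hf'.1)
  have h1 : Tendsto (fun n => charFun (P.map (f n)) u) atTop (𝓝 (charFun (P.map f') u)) := by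
    refine tendsto_iff_edist_tendsto_0.2 ?_
    have h0 : Tendsto (fun n => ‖u‖ₑ * eLpNorm (f n - f') 2 P) atTop (𝓝 0) := by
      simpa using ENNReal.Tendsto.const_mul h (Or.inr (by simp : ‖u‖ₑ ≠ ∞))
    refine tendsto_of_tendsto_of_tendsto_of_le_of_le tendsto_const_nhds h0
      (fun _ => zero_le) fun n => ?_
    rw [edist_eq_enorm_sub]
    exact hle n
  have h2 : Tendsto (fun n => charFun (P.map (f n)) u) atTop
      (𝓝 (charFun (gaussianReal 0 v') u)) := by
    simp only [hg, charFun_gaussianReal]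
    have : Tendsto (fun n => ((v n : ℝ) : ℂ)) atTop (𝓝 ((v' : ℝ) : ℂ)) :=
      (Complex.continuous_ofReal.tendsto _).comp ((NNReal.continuous_coe.tendsto _).comp hv)
    exact (Complex.continuous_exp.tendsto _).comp
      (tendsto_const_nhds.sub ((this.mul_const _).div_const _))
  exact tendsto_nhds_unique h1 h2

/-! ### Existence of the stochastic integral -/

section Existence

variable {d : ℕ} {Ω Ω' : Type*} [MeasurableSpace Ω] [MeasurableSpace Ω'] {P : Measure Ω}
  [IsProbabilityMeasure P] {P' : Measure Ω'} [IsProbabilityMeasure P'] {β₀ : ℝ}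
  {γ : Space d → ℝ≥0∞} {γhat : Space d → ℝ} {W : (ℝ × Space d → ℝ) → Ω → ℝ}
  {X : ℝ≥0 → Ω' → Space d} {Ψ : Space d → ℝ} {ρ : Space d → ℝ} {t : ℝ≥0} {x : Space d}

theorem measurable_noiseLIntegral {Θ : Type*} [MeasurableSpace Θ] (hγ : Measurable γ)
    {A B : ℝ≥0 → Θ → Space d} (hA : Measurable fun p : ℝ × Θ => A p.1.toNNReal p.2)
    (hB : Measurable fun p : ℝ × Θ => B p.1.toNNReal p.2) (hρ : IsMollifier ρ) {ε δ ε' δ' : ℝ}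
    (hε : 0 < ε) (hδ : 0 < δ) (hε' : 0 < ε') (hδ' : 0 < δ') :
    Measurable fun θ => noiseLIntegral β₀ γ (approxDelta ρ ε δ t x fun s => A s θ)
      (approxDelta ρ ε' δ' t x fun s => B s θ) := by
  have e : ∀ θ, noiseLIntegral β₀ γ (approxDelta ρ ε δ t x fun s => A s θ)
      (approxDelta ρ ε' δ' t x fun s => B s θ) = ∫⁻ p, timeKernel β₀ t δ δ' p.1 p.2 *
        spaceKernel γ ρ ε ε' (A p.1.toNNReal θ - B p.2.toNNReal θ) ∂(timeSquare t) := fun θ =>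
    hρ.noiseLIntegral_eq_timeSquare hγ hε hδ hε' hδ' (hA.comp measurable_prodMk_right)
      (hB.comp measurable_prodMk_right)
  simp only [e]
  exact (measurable_kernel_mul_covariance (measurable_spaceKernel hγ ε ε' (ρ := ρ)) hA hB
    (measurable_timeKernel β₀ t δ δ')).lintegral_prod_right'

theorem boxFun_mono {c c' T R R' : ℝ} (hc : c ≤ c') (hc' : 0 ≤ c') (hR : R ≤ R')
    (z : ℝ × Space d) : boxFun d c T R z ≤ boxFun d c' T R' z := by
  have h1 : 0 ≤ (Icc 0 T).indicator (1 : ℝ → ℝ) z.1 := indicator_nonneg (by simp) _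
  have h2 : 0 ≤ (Metric.closedBall 0 R).indicator (1 : Space d → ℝ) z.2 :=
    indicator_nonneg (by simp) _
  refine mul_le_mul hc (mul_le_mul_of_nonneg_left ?_ h1) (mul_nonneg h1 h2) hc'
  exact indicator_le_indicator_of_subset (Metric.closedBall_subset_closedBall hR) (by simp) _

/-- The energies of a pair of approximating integrands are finite, path by path. -/
theorem IsMollifier.noiseLIntegral_approxDelta_lt_top (hρ : IsMollifier ρ)
    (hγ : IsSpatialCovariance γ γhat) (hβ : β₀ < 1) {ε δ ε' δ' : ℝ} (hε : 0 < ε) (hδ : 0 < δ)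
    (hε' : 0 < ε') (hδ' : 0 < δ') {f g : ℝ≥0 → Space d} (hf : IsCadlagPath f)
    (hg : IsCadlagPath g) :
    noiseLIntegral β₀ γ (approxDelta ρ ε δ t x f) (approxDelta ρ ε' δ' t x g) < ∞ := by
  obtain ⟨B, hB⟩ := hf.exists_bound t
  obtain ⟨c, R, hcR⟩ := hρ.exists_approxDelta_le_boxFun hε hδ t x B
  obtain ⟨B', hB'⟩ := hg.exists_bound t
  obtain ⟨c', R', hcR'⟩ := hρ.exists_approxDelta_le_boxFun hε' hδ' t x B'
  have h0 : 0 ≤ max |c| |c'| := (abs_nonneg c).trans (le_max_left _ _)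
  refine (noiseLIntegral_mono (φ' := boxFun d (max |c| |c'|) t (max R R'))
    (ψ' := boxFun d (max |c| |c'|) t (max R R')) (fun z => (hcR f hB z).trans ?_)
    (fun z => (hcR' g hB' z).trans ?_)).trans_lt
    (mem_noiseDomain.1 (hγ.boxFun_mem_noiseDomain hβ t.coe_nonneg)).2
  · exact boxFun_mono ((le_abs_self c).trans (le_max_left _ _)) h0 (le_max_left _ _) z
  · exact boxFun_mono ((le_abs_self c').trans (le_max_right _ _)) h0 (le_max_right _ _) z

theorem IsMollifier.noiseInner_approxDelta (hρ : IsMollifier ρ)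
    (hγ : IsSpatialCovariance γ γhat) (hβ : β₀ < 1) {ε δ ε' δ' : ℝ} (hε : 0 < ε) (hδ : 0 < δ)
    (hε' : 0 < ε') (hδ' : 0 < δ') {f g : ℝ≥0 → Space d} (hf : IsCadlagPath f)
    (hg : IsCadlagPath g) :
    noiseInner β₀ γ (approxDelta ρ ε δ t x f) (approxDelta ρ ε' δ' t x g) =
      (noiseLIntegral β₀ γ (approxDelta ρ ε δ t x f) (approxDelta ρ ε' δ' t x g)).toReal :=
  noiseInner_eq_toReal hγ.measurable (hρ.measurable_approxDelta hf.measurable)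
    (hρ.measurable_approxDelta hg.measurable) (hρ.approxDelta_nonneg hε hδ)
    (hρ.approxDelta_nonneg hε' hδ') (hρ.noiseLIntegral_approxDelta_lt_top hγ hβ hε hδ hε' hδ' hf hg)

theorem IsNoise.integral_mul_noiseIntegral (hW : IsNoise β₀ γ W P)
    (hγ : IsSpatialCovariance γ γhat) (hβ : β₀ < 1) (hρ : IsMollifier ρ)
    (hX : ∀ s, Measurable (X s)) (hc : ∀ ω, IsCadlagPath fun s => X s ω) {ε δ ε' δ' : ℝ}
    (hε : 0 < ε) (hδ : 0 < δ) (hε' : 0 < ε') (hδ' : 0 < δ') {F G : Ω × Ω' → ℝ}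
    (hF : IsNoiseIntegral β₀ γ W P P' (fun ω' => approxDelta ρ ε δ t x fun s => X s ω') F)
    (hG : IsNoiseIntegral β₀ γ W P P' (fun ω' => approxDelta ρ ε' δ' t x fun s => X s ω') G)
    (hF2 : MemLp F 2 (P.prod P')) (hG2 : MemLp G 2 (P.prod P')) :
    ∫ z, F z * G z ∂(P.prod P') = (∫⁻ ω', noiseLIntegral β₀ γ
      (approxDelta ρ ε δ t x fun s => X s ω') (approxDelta ρ ε' δ' t x fun s => X s ω') ∂P').toReal
      := by
  have hXm := measurable_uncurry_real_of_cadlag hX hc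
  have hi : Integrable (fun z => F z * G z) (P.prod P') := hF2.integrable_mul hG2
  rw [integral_prod_symm _ hi,
    ← integral_toReal (measurable_noiseLIntegral hγ.measurable hXm hXm hρ hε hδ hε' hδ').aemeasurable
    (ae_of_all _ fun ω' =>
      hρ.noiseLIntegral_approxDelta_lt_top hγ hβ hε hδ hε' hδ' (hc ω') (hc ω'))]
  refine integral_congr_ae ?_
  filter_upwards [hF.eq, hG.eq] with ω' h1 h2
  rw [← hρ.noiseInner_approxDelta hγ hβ hε hδ hε' hδ' (hc ω') (hc ω'),
    ← hW.covariance _ (hρ.approxDelta_mem_noiseDomain hγ hβ hε hδ (hc ω')) _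
      (hρ.approxDelta_mem_noiseDomain hγ hβ hε' hδ' (hc ω'))]
  refine integral_congr_ae ?_
  filter_upwards [h1, h2] with ω e1 e2
  rw [e1, e2]

/-- The limit defining the stochastic integral exists: the mean inner products of any two families
of approximating integrands converge to the same number, so the family is Cauchy in `L²(Ω × Ω')`. -/
theorem IsNoise.exists_isDeltaIntegral (hW : IsNoise β₀ γ W P)
    (hγ : IsSpatialCovariance γ γhat) (hβ₀ : 0 < β₀) (hβ₁ : β₀ < 1) (hρ : IsMollifier ρ)
    (hX : IsSymmetricLevyProcess X Ψ P') (hc : ∀ ω, IsCadlagPath fun s => X s ω)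
    (hI : SpectralCondition β₀ Ψ (spectralMeasure γhat)) :
    ∃ V : Ω × Ω' → ℝ, IsDeltaIntegral β₀ γ W P X P' ρ t x V := by
  have h0 := hX.exponent_nonneg
  have hint : ∀ v : ℝ, 0 < v → Integrable (fun ξ => Real.exp (-(v * Ψ ξ)))
    (spectralMeasure γhat) := fun v hv => hX.integrable_exp hβ₀ hβ₁ hI hv
  have hfin : ∫⁻ p, energyKernel β₀ γhat Ψ (p.1 - p.2) ∂(timeSquare t) < ∞ :=
    lintegral_timeSquare_sub_lt_top (measurable_energyKernel hX.measurable_exponent)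
      energyKernel_neg (setLIntegral_energyKernel_lt_top hβ₀ hβ₁ hX.measurable_exponent h0 hI
        t.coe_nonneg)
  have hpair := hX.isPotentialPair_same hc hγ hint
  have hex : ∀ ε δ : ℝ, ∃ F : Ω × Ω' → ℝ, MemLp F 2 (P.prod P') ∧ (0 < ε → 0 < δ →
      IsNoiseIntegral β₀ γ W P P' (fun ω' => approxDelta ρ ε δ t x fun s => X s ω') F) :=
    fun ε δ => by
      by_cases h : 0 < ε ∧ 0 < δ
      · obtain ⟨F, hF, hF2⟩ := hW.exists_isNoiseIntegral hγ hβ₁ hρ h.1 h.2 hX.measurable hc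
          (hpair.lintegral_noise_lt_top hint hfin hγ.measurable h0 hρ hβ₀ hβ₁ h.1 h.2 h.1 h.2)
          (t := t) (x := x)
        exact ⟨F, hF2, fun _ _ => hF⟩
      · exact ⟨0, MemLp.zero, fun h1 h2 => absurd ⟨h1, h2⟩ h⟩
  choose F hF2 hF using hex
  let f : ℝ × ℝ → Lp ℝ 2 (P.prod P') := fun e => (hF2 e.1 e.2).toLp _
  let L : Filter (ℝ × ℝ) := 𝓝[>] 0 ×ˢ 𝓝[>] 0
  have hpos : ∀ᶠ e in L, 0 < e.1 ∧ 0 < e.2 :=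
    (eventually_mem_nhdsWithin).prod_mk (eventually_mem_nhdsWithin)
  -- `‖F_e - F_e'‖² = c(e,e) - 2 c(e,e') + c(e',e')`, and all three terms tend to the mean energy.
  have hcauchy : Cauchy (map f L) := by
    refine cauchy_map_iff.2 ⟨inferInstance, ?_⟩
    rw [tendsto_uniformity_iff_dist_tendsto_zero]
    let M := ∫⁻ ω', mutualEnergy β₀ γ t (fun s => X s ω') (fun s => X s ω') ∂P'
    have hM : M < ∞ := hpair.lintegral_mutualEnergy_lt_top hint hfin hγ.measurable h0
    let c : ℝ × ℝ → ℝ × ℝ → ℝ := fun e e' => (∫⁻ ω', noiseLIntegral β₀ γ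
      (approxDelta ρ e.1 e.2 t x fun s => X s ω')
      (approxDelta ρ e'.1 e'.2 t x fun s => X s ω') ∂P').toReal
    have hlim : ∀ {a b : (ℝ × ℝ) × (ℝ × ℝ) → ℝ × ℝ}, Tendsto a (L ×ˢ L) L → Tendsto b (L ×ˢ L) L →
        Tendsto (fun q => c (a q) (b q)) (L ×ˢ L) (𝓝 M.toReal) := fun ha hb =>
      (ENNReal.tendsto_toReal hM.ne).comp (hpair.tendsto_lintegral_noise hint hfin hγ.measurable h0
        hρ hβ₀ hβ₁ (tendsto_fst.comp ha) (tendsto_snd.comp ha) (tendsto_fst.comp hb)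
        (tendsto_snd.comp hb))
    have h1 := ENNReal.tendsto_ofReal (((hlim tendsto_fst tendsto_fst).sub
      ((hlim tendsto_fst tendsto_snd).const_mul 2)).add (hlim tendsto_snd tendsto_snd))
    rw [show M.toReal - 2 * M.toReal + M.toReal = 0 by ring, ENNReal.ofReal_zero] at h1
    have h2 : Tendsto (fun q : (ℝ × ℝ) × (ℝ × ℝ) =>
        eLpNorm (F q.1.1 q.1.2 - F q.2.1 q.2.2) 2 (P.prod P')) (L ×ˢ L) (𝓝 0) := by
      refine tendsto_zero_of_sq (h1.congr' ?_)
      filter_upwards [hpos.prod_mk hpos] with q hq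
      have hmul := fun {e e' : ℝ × ℝ} (he : 0 < e.1 ∧ 0 < e.2) (he' : 0 < e'.1 ∧ 0 < e'.2) =>
        hW.integral_mul_noiseIntegral hγ hβ₁ hρ hX.measurable hc he.1 he.2 he'.1 he'.2
          (hF _ _ he.1 he.2) (hF _ _ he'.1 he'.2) (hF2 _ _) (hF2 _ _)
      rw [(hF2 _ _).eLpNorm_sub_two_sq (hF2 _ _), hmul hq.1 hq.1, hmul hq.1 hq.2, hmul hq.2 hq.2]
    have h3 := (ENNReal.tendsto_toReal ENNReal.zero_ne_top).comp h2
    refine h3.congr fun q => ?_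
    simp only [Function.comp_apply, f]
    rw [dist_edist, Lp.edist_toLp_toLp]
  obtain ⟨V, hV⟩ := cauchy_iff_exists_le_nhds.1 hcauchy
  refine ⟨V, Lp.memLp V, F, fun ε δ hε hδ => ⟨hF ε δ hε hδ, hF2 ε δ⟩, ?_⟩
  have h1 : Tendsto f L (𝓝 ((Lp.memLp V).toLp V)) := by
    rw [Lp.toLp_coeFn]
    exact hV
  exact (Lp.tendsto_Lp_iff_tendsto_eLpNorm'' (fun e : ℝ × ℝ => F e.1 e.2)
    (fun e => hF2 e.1 e.2) V (Lp.memLp V)).1 h1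

end Existence

/-! ### Covariances of the slices of the stochastic integral -/

section Identification

variable {d : ℕ} {Ω Ω' : Type*} [MeasurableSpace Ω] [MeasurableSpace Ω'] {P : Measure Ω}
  {P' : Measure Ω'} {β₀ : ℝ}
  {γ : Space d → ℝ≥0∞} {γhat : Space d → ℝ} {W : (ℝ × Space d → ℝ) → Ω → ℝ}
  {X : ℝ≥0 → Ω' → Space d} {Ψ : Space d → ℝ} {ρ : Space d → ℝ} {t : ℝ≥0} {x : Space d}
  {e : ℕ → ℝ}

/-- `v` is the limit in `L²(P)` of `W(Φ^{ε,ε}_f)` for a fixed path `f`, along the sequence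
`ε = e n`. -/
structure IsPathIntegral (W : (ℝ × Space d → ℝ) → Ω → ℝ) (P : Measure Ω) (ρ : Space d → ℝ)
    (t : ℝ≥0) (x : Space d) (e : ℕ → ℝ) (f : ℝ≥0 → Space d) (v : Ω → ℝ) : Prop where
  memLp : MemLp v 2 P
  tendsto : Tendsto (fun n => eLpNorm (W (approxDelta ρ (e n) (e n) t x f) - v) 2 P) atTop (𝓝 0)

/-- Along a subsequence of the diagonal `ε = δ`, convergence in `L²(Ω × Ω')` gives convergence in
`L²(P)` for almost every path. -/
theorem IsDeltaIntegral.exists_isPathIntegral [IsProbabilityMeasure P] [IsProbabilityMeasure P']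
    {V : Ω × Ω' → ℝ} (hV : IsDeltaIntegral β₀ γ W P X P' ρ t x V) :
    ∃ e : ℕ → ℝ, (∀ n, 0 < e n) ∧ Tendsto e atTop (𝓝[>] 0) ∧
      ∀ᵐ ω' ∂P', IsPathIntegral W P ρ t x e (fun s => X s ω') fun ω => V (ω, ω') := by
  obtain ⟨hV2, F, hF, hlim⟩ := hV
  obtain ⟨a, ha0, ha⟩ : ∃ a : ℕ → ℝ, (∀ n, 0 < a n) ∧ Tendsto a atTop (𝓝[>] 0) :=
    ⟨fun n => 1 / ((n : ℝ) + 1), fun n => by positivity, tendsto_nhdsWithin_iff.2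
      ⟨tendsto_one_div_add_atTop_nhds_zero_nat, Eventually.of_forall fun n => by
        simp only [mem_Ioi]; positivity⟩⟩
  have h1 := hlim.comp (ha.prodMk ha)
  simp only [Function.comp_def] at h1
  obtain ⟨ns, hns, hae⟩ := exists_subseq_slice_tendsto
    (fun n => (hF _ _ (ha0 n) (ha0 n)).2.1) hV2.1 h1
  refine ⟨fun n => a (ns n), fun n => ha0 _, ha.comp hns.tendsto_atTop, ?_⟩
  have hslice : ∀ᵐ ω' ∂P', MemLp (fun ω => V (ω, ω')) 2 P := by
    have hm : ∀ᵐ ω' ∂P', AEStronglyMeasurable (fun ω => V (ω, ω')) P :=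
      (hV2.1.prod_swap).prodMk_left
    have hfin : ∫⁻ ω', eLpNorm (fun ω => V (ω, ω')) 2 P ^ 2 ∂P' ≠ ∞ := by
      rw [← eLpNorm_prod_two_sq hV2.1]
      exact ENNReal.pow_ne_top hV2.2.ne
    filter_upwards [hm, ae_lt_top' (aemeasurable_eLpNorm_slice hV2.1) hfin] with ω' h1 h2
    refine ⟨h1, ?_⟩
    by_contra h
    rw [not_lt, top_le_iff] at h
    simp [h] at h2
  have heq : ∀ᵐ ω' ∂P', ∀ n, (fun ω => F (a n) (a n) (ω, ω')) =ᵐ[P]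
      W (approxDelta ρ (a n) (a n) t x fun s => X s ω') :=
    ae_all_iff.2 fun n => (hF _ _ (ha0 n) (ha0 n)).1.eq
  filter_upwards [hae, hslice, heq] with ω' h1 h2 h3
  refine ⟨h2, h1.congr fun n => eLpNorm_congr_ae ?_⟩
  filter_upwards [h3 (ns n)] with ω h
  simp only [Pi.sub_apply, h]

/-- Fatou's lemma for the energies of the approximating integrands. -/
theorem IsMollifier.mutualEnergy_le (hρ : IsMollifier ρ) (hγ : IsSpatialCovariance γ γhat)
    (he0 : ∀ n, 0 < e n) (he : Tendsto e atTop (𝓝[>] 0)) {f g : ℝ≥0 → Space d}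
    (hf : Measurable fun s : ℝ => f s.toNNReal) (hg : Measurable fun s : ℝ => g s.toNNReal)
    {c : ℝ≥0∞} (hc : Tendsto (fun n => noiseLIntegral β₀ γ (approxDelta ρ (e n) (e n) t x f)
      (approxDelta ρ (e n) (e n) t x g)) atTop (𝓝 c)) :
    mutualEnergy β₀ γ t f g ≤ c := by
  rw [mutualEnergy_eq hγ.measurable hf hg, ← hc.liminf_eq]
  simp only [hρ.noiseLIntegral_eq_timeSquare hγ.measurable (he0 _) (he0 _) (he0 _) (he0 _) hf hg]
  refine le_trans (lintegral_mono_ae ?_) (lintegral_liminf_le fun n => ?_)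
  · filter_upwards [ae_timeSquare t] with p hp
    have h1 := (tendsto_timeKernel (β := β₀) hp.1 hp.2.1 hp.2.2).comp (he.prodMk he)
    have h2 := (hρ.tendsto_spaceKernel hγ.continuous (f p.1.toNNReal - g p.2.toNNReal)).comp
      (he.prodMk he)
    have h3 : ENNReal.ofReal (|p.1 - p.2| ^ (-β₀)) ≠ 0 := by
      rw [Ne, ENNReal.ofReal_eq_zero, not_le]
      exact Real.rpow_pos_of_pos (abs_pos.2 (sub_ne_zero.2 hp.2.2)) _
    simp only [Function.comp_def] at h1 h2
    exact (ENNReal.Tendsto.mul h1 (Or.inl h3) h2 (Or.inr ENNReal.ofReal_ne_top)).liminf_eq.ge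
  · exact (measurable_timeKernel β₀ t _ _).mul ((measurable_spaceKernel hγ.measurable _ _).comp
      ((hf.comp measurable_fst).sub (hg.comp measurable_snd)))

theorem IsPathIntegral.tendsto_noiseInner (hW : IsNoise β₀ γ W P)
    (hγ : IsSpatialCovariance γ γhat) (hβ : β₀ < 1) (hρ : IsMollifier ρ) (he0 : ∀ n, 0 < e n)
    {f g : ℝ≥0 → Space d} (hf : IsCadlagPath f) (hg : IsCadlagPath g) {v w : Ω → ℝ}
    (hv : IsPathIntegral W P ρ t x e f v) (hw : IsPathIntegral W P ρ t x e g w) :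
    Tendsto (fun n => noiseInner β₀ γ (approxDelta ρ (e n) (e n) t x f)
      (approxDelta ρ (e n) (e n) t x g)) atTop (𝓝 (∫ ω, v ω * w ω ∂P)) := by
  have hfd := fun n => hρ.approxDelta_mem_noiseDomain (t := t) (x := x) hγ hβ (he0 n) (he0 n) hf
  have hgd := fun n => hρ.approxDelta_mem_noiseDomain (t := t) (x := x) hγ hβ (he0 n) (he0 n) hg
  refine (tendsto_integral_mul_of_eLpNorm (fun n => hW.memLp (hfd n)) (fun n => hW.memLp (hgd n))
    hv.memLp hw.memLp hv.tendsto hw.tendsto).congr fun n => hW.covariance _ (hfd n) _ (hgd n)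

theorem IsPathIntegral.integral_mul_nonneg (hW : IsNoise β₀ γ W P)
    (hγ : IsSpatialCovariance γ γhat) (hβ : β₀ < 1) (hρ : IsMollifier ρ) (he0 : ∀ n, 0 < e n)
    {f g : ℝ≥0 → Space d} (hf : IsCadlagPath f) (hg : IsCadlagPath g) {v w : Ω → ℝ}
    (hv : IsPathIntegral W P ρ t x e f v) (hw : IsPathIntegral W P ρ t x e g w) :
    0 ≤ ∫ ω, v ω * w ω ∂P := by
  refine ge_of_tendsto' (hv.tendsto_noiseInner hW hγ hβ hρ he0 hf hg hw) fun n => ?_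
  rw [hρ.noiseInner_approxDelta hγ hβ (he0 n) (he0 n) (he0 n) (he0 n) hf hg]
  exact ENNReal.toReal_nonneg

theorem IsPathIntegral.tendsto_noiseLIntegral (hW : IsNoise β₀ γ W P)
    (hγ : IsSpatialCovariance γ γhat) (hβ : β₀ < 1) (hρ : IsMollifier ρ) (he0 : ∀ n, 0 < e n)
    {f g : ℝ≥0 → Space d} (hf : IsCadlagPath f) (hg : IsCadlagPath g) {v w : Ω → ℝ}
    (hv : IsPathIntegral W P ρ t x e f v) (hw : IsPathIntegral W P ρ t x e g w) :
    Tendsto (fun n => noiseLIntegral β₀ γ (approxDelta ρ (e n) (e n) t x f)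
      (approxDelta ρ (e n) (e n) t x g)) atTop (𝓝 (ENNReal.ofReal (∫ ω, v ω * w ω ∂P))) := by
  refine (ENNReal.tendsto_ofReal (hv.tendsto_noiseInner hW hγ hβ hρ he0 hf hg hw)).congr fun n => ?_
  rw [hρ.noiseInner_approxDelta hγ hβ (he0 n) (he0 n) (he0 n) (he0 n) hf hg, ENNReal.ofReal_toReal
    (hρ.noiseLIntegral_approxDelta_lt_top hγ hβ (he0 n) (he0 n) (he0 n) (he0 n) hf hg).ne]

/-- The covariance of the path integrals along two paths is the mutual energy of the paths: it is
at least the energy by Fatou's lemma, and the two have the same mean. -/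
theorem IsPotentialPair.ae_covariance_eq (hW : IsNoise β₀ γ W P)
    (hγ : IsSpatialCovariance γ γhat) (hβ₀ : 0 < β₀) (hβ₁ : β₀ < 1) (hρ : IsMollifier ρ)
    (he0 : ∀ n, 0 < e n) (he : Tendsto e atTop (𝓝[>] 0)) {Θ : Type*} [MeasurableSpace Θ]
    {m : Measure Θ} [SFinite m] {A B : ℝ≥0 → Θ → Space d} {τ : ℝ → ℝ → ℝ}
    (h : IsPotentialPair γ γhat Ψ m A B τ) (h0 : ∀ ξ, 0 ≤ Ψ ξ)
    (hint : ∀ v : ℝ, 0 < v → Integrable (fun ξ => Real.exp (-(v * Ψ ξ))) (spectralMeasure γhat))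
    (hfin : ∫⁻ p, energyKernel β₀ γhat Ψ (p.1 - p.2) ∂(timeSquare t) < ∞)
    (hA : ∀ θ, IsCadlagPath fun s => A s θ) (hB : ∀ θ, IsCadlagPath fun s => B s θ)
    {va vb : Θ → Ω → ℝ} (hva : ∀ᵐ θ ∂m, IsPathIntegral W P ρ t x e (fun s => A s θ) (va θ))
    (hvb : ∀ᵐ θ ∂m, IsPathIntegral W P ρ t x e (fun s => B s θ) (vb θ)) :
    ∀ᵐ θ ∂m, mutualEnergy β₀ γ t (fun s => A s θ) (fun s => B s θ) < ∞ ∧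
      ∫ ω, va θ ω * vb θ ω ∂P =
        (mutualEnergy β₀ γ t (fun s => A s θ) (fun s => B s θ)).toReal := by
  let c : Θ → ℝ≥0∞ := fun θ => ENNReal.ofReal (∫ ω, va θ ω * vb θ ω ∂P)
  let N : ℕ → Θ → ℝ≥0∞ := fun n θ => noiseLIntegral β₀ γ
    (approxDelta ρ (e n) (e n) t x fun s => A s θ) (approxDelta ρ (e n) (e n) t x fun s => B s θ)
  have hN : ∀ n, Measurable (N n) := fun n => measurable_noiseLIntegral hγ.measurable
    h.measurable_left h.measurable_right hρ (he0 n) (he0 n) (he0 n) (he0 n)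
  have hlim : ∀ᵐ θ ∂m, Tendsto (fun n => N n θ) atTop (𝓝 (c θ)) := by
    filter_upwards [hva, hvb] with θ h1 h2
    exact h1.tendsto_noiseLIntegral hW hγ hβ₁ hρ he0 (hA θ) (hB θ) h2
  have hle : (fun θ => mutualEnergy β₀ γ t (fun s => A s θ) (fun s => B s θ)) ≤ᵐ[m] c := by
    filter_upwards [hlim] with θ h1
    exact hρ.mutualEnergy_le hγ he0 he (h.measurable_left.comp measurable_prodMk_right)
      (h.measurable_right.comp measurable_prodMk_right) h1
  have hc : AEMeasurable c m := aemeasurable_of_tendsto_metrizable_ae atTop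
    (fun n => (hN n).aemeasurable) hlim
  have hmean : ∫⁻ θ, c θ ∂m ≤ ∫⁻ θ, mutualEnergy β₀ γ t (fun s => A s θ) (fun s => B s θ) ∂m := by
    have hT := h.tendsto_lintegral_noise (t := t) (x := x) hint hfin hγ.measurable h0 hρ hβ₀ hβ₁
      he he he he
    calc ∫⁻ θ, c θ ∂m = ∫⁻ θ, liminf (fun n => N n θ) atTop ∂m :=
          lintegral_congr_ae (hlim.mono fun θ h => h.liminf_eq.symm)
      _ ≤ liminf (fun n => ∫⁻ θ, N n θ ∂m) atTop := lintegral_liminf_le hN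
      _ = _ := hT.liminf_eq
  -- Two functions, one below the other, with equal finite integrals agree almost everywhere.
  have heq := ae_eq_of_ae_le_of_lintegral_le hle
    (h.lintegral_mutualEnergy_lt_top hint hfin hγ.measurable h0).ne hc hmean
  filter_upwards [heq, hva, hvb] with θ h1 h2 h3
  rw [h1]
  exact ⟨ENNReal.ofReal_lt_top, (ENNReal.toReal_ofReal
    (h2.integral_mul_nonneg hW hγ hβ₁ hρ he0 (hA θ) (hB θ) h3)).symm⟩

/-- Sums of path integrals are centred Gaussian. -/
theorem IsPathIntegral.map_sum_eq_gaussianReal [IsProbabilityMeasure P] (hW : IsNoise β₀ γ W P)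
    (hγ : IsSpatialCovariance γ γhat) (hβ : β₀ < 1) (hρ : IsMollifier ρ) (he0 : ∀ n, 0 < e n)
    {p : ℕ} {f : Fin p → ℝ≥0 → Space d} (hf : ∀ j, IsCadlagPath (f j)) {v : Fin p → Ω → ℝ}
    (hv : ∀ j, IsPathIntegral W P ρ t x e (f j) (v j)) :
    P.map (fun ω => ∑ j, v j ω) = gaussianReal 0 (∑ j, ∑ k, ∫ ω, v j ω * v k ω ∂P).toNNReal := by
  let Φ : ℕ → Fin p → ℝ × Space d → ℝ := fun n j => approxDelta ρ (e n) (e n) t x (f j)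
  have hΦ : ∀ n j, Φ n j ∈ noiseDomain β₀ γ := fun n j =>
    hρ.approxDelta_mem_noiseDomain hγ hβ (he0 n) (he0 n) (hf j)
  let S : ℕ → Ω → ℝ := fun n ω => ∑ j, W (Φ n j) ω
  have hS2 : ∀ n, MemLp (S n) 2 P := fun n => memLp_finsetSum _ fun j _ => hW.memLp (hΦ n j)
  have hv2 : MemLp (fun ω => ∑ j, v j ω) 2 P := memLp_finsetSum _ fun j _ => (hv j).memLp
  have hmean : ∀ n, ∫ ω, S n ω ∂P = 0 := fun n => by
    simp only [S]
    rw [integral_finsetSum _ fun j _ => (hW.memLp (hΦ n j)).integrable (by norm_num)]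
    exact Finset.sum_eq_zero fun j _ => hW.centred _ (hΦ n j)
  have hlaw : ∀ n, P.map (S n) = gaussianReal 0 (∫ ω, S n ω * S n ω ∂P).toNNReal := fun n => by
    have h1 := (hW.gaussian.comp_right fun j : Fin p => ⟨Φ n j, hΦ n j⟩).hasGaussianLaw_fun_sum
      (I := Finset.univ)
    have h2 : HasGaussianLaw (S n) P := h1
    rw [h2.map_eq_gaussianReal, hmean n,
      variance_of_integral_eq_zero (hS2 n).1.aemeasurable (hmean n)]
    simp only [sq]
  have hlim : Tendsto (fun n => eLpNorm (S n - fun ω => ∑ j, v j ω) 2 P) atTop (𝓝 0) := by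
    have h1 : Tendsto (fun n => ∑ j, eLpNorm (W (Φ n j) - v j) 2 P) atTop (𝓝 (∑ j : Fin p, 0)) :=
      tendsto_finsetSum _ fun j _ => (hv j).tendsto
    rw [Finset.sum_const_zero] at h1
    refine tendsto_of_tendsto_of_tendsto_of_le_of_le tendsto_const_nhds h1
      (fun _ => zero_le) fun n => ?_
    have h2 : (S n - fun ω => ∑ j, v j ω) = ∑ j, (W (Φ n j) - v j) := by
      ext ω
      simp [S, Finset.sum_sub_distrib]
    simp only
    rw [h2]
    exact eLpNorm_sum_le (fun j _ => ((hW.memLp (hΦ n j)).sub (hv j).memLp).1) (by norm_num)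
  have hvar : ∫ ω, (∑ j, v j ω) * (∑ j, v j ω) ∂P = ∑ j, ∑ k, ∫ ω, v j ω * v k ω ∂P := by
    simp only [Finset.sum_mul_sum]
    have hi : ∀ j k, Integrable (fun ω => v j ω * v k ω) P := fun j k =>
      (hv j).memLp.integrable_mul (hv k).memLp
    rw [integral_finsetSum _ fun j _ => integrable_finsetSum _ fun k _ => hi j k]
    exact Finset.sum_congr rfl fun j _ => integral_finsetSum _ fun k _ => hi j k
  rw [← hvar]
  exact map_eq_gaussianReal_of_tendsto hS2 hv2 hlaw hlim ((continuous_real_toNNReal.tendsto _).comp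
    (tendsto_integral_mul_of_eLpNorm hS2 hS2 hv2 hv2 hlim hlim))

end Identification

theorem integral_exp_of_map_eq_gaussianReal {Ω : Type*} [MeasurableSpace Ω] {P : Measure Ω}
    {f : Ω → ℝ} {v : ℝ≥0} (hf : AEMeasurable f P) (h : P.map f = gaussianReal 0 v) (q : ℝ) :
    Integrable (fun ω => Real.exp (q * f ω)) P ∧
      ∫ ω, Real.exp (q * f ω) ∂P = Real.exp (v * q ^ 2 / 2) := by
  have hi := integrable_exp_mul_gaussianReal (μ := 0) (v := v) q
  rw [← h, integrable_map_measure (by fun_prop) hf] at hi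
  refine ⟨hi, ?_⟩
  have := mgf_gaussianReal h q
  rwa [zero_mul, zero_add] at this

/-! ### Independence of the increments from the past -/

section Past

variable {d : ℕ} {Ω' : Type*}

/-- The `σ`-algebra generated by the process up to time `m`. -/
@[reducible] def pastSigma (X : ℝ≥0 → Ω' → Space d) (m : ℝ≥0) : MeasurableSpace Ω' :=
  MeasurableSpace.comap (fun ω (s : Iic m) => X s ω) inferInstance

theorem measurable_pastSigma {X : ℝ≥0 → Ω' → Space d} {m s : ℝ≥0} (h : s ≤ m) :
    Measurable[pastSigma X m] (X s) := by
  have h1 : Measurable[pastSigma X m] fun ω (s : Iic m) => X s ω := comap_measurable _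
  exact (measurable_pi_apply (⟨s, h⟩ : Iic m)).comp h1

theorem pastSigma_le {X : ℝ≥0 → Ω' → Space d} {m : ℝ≥0} {F : MeasurableSpace Ω'}
    (h : ∀ s ≤ m, Measurable[F] (X s)) : pastSigma X m ≤ F :=
  measurable_iff_comap_le.1 (measurable_pi_lambda _ fun s => h s s.2)

theorem pastSigma_mono (X : ℝ≥0 → Ω' → Space d) {m m' : ℝ≥0} (h : m ≤ m') :
    pastSigma X m ≤ pastSigma X m' :=
  pastSigma_le fun _ hs => measurable_pastSigma (hs.trans h)

variable [MeasurableSpace Ω'] {P' : Measure Ω'} [IsProbabilityMeasure P']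
  {X : ℝ≥0 → Ω' → Space d}

omit [IsProbabilityMeasure P'] in
/-- Finitely many values of the process before time `m` are independent of an increment after `m`:
relative to `X 0` they are sums of increments over a grid that ends with `m, r`. -/
theorem IsLevyProcess.indepFun_finset (hX : IsLevyProcess X P') {m r : ℝ≥0} (hmr : m ≤ r)
    (I : Finset (Iic m)) :
    IndepFun (fun ω (s : I) => X (s : Iic m) ω - X 0 ω) (fun ω => X r ω - X m ω) P' := by
  let n := I.card
  let em := I.orderEmbOfFin (rfl : I.card = n)
  -- The grid `0, s₁, …, s_n, m, r, r, …` through the sorted elements of `I`.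
  let τ : ℕ → ℝ≥0 := fun k => if k = 0 then 0 else if h : k - 1 < n then (em ⟨k - 1, h⟩ : Iic m)
    else if k = n + 1 then m else r
  have hτ : Monotone τ := by
    refine monotone_nat_of_le_succ fun k => ?_
    rcases Nat.eq_zero_or_pos k with rfl | hk
    · simp [τ]
    · have h0 : k ≠ 0 := hk.ne'
      simp only [τ, h0, if_false, Nat.succ_ne_zero, Nat.add_sub_cancel]
      by_cases h1 : k < n
      · have h2 : k - 1 < n := by omega
        simp only [h1, h2, dif_pos]
        exact em.monotone (Fin.mk_le_mk.2 (by omega))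
      · by_cases h2 : k - 1 < n
        · have h3 : k = n := by omega
          rw [dif_pos h2, dif_neg h1, if_pos (by omega)]
          exact (em _).2
        · have h4 : k ≠ n := by omega
          simp only [h1, h2, dif_neg, not_false_eq_true, Nat.add_right_cancel_iff, h4, if_false]
          split_ifs
          · exact hmr
          · exact le_rfl
  have hind := (hX.indep.nat hτ).indepFun_finset (Finset.range (n + 1)) {n + 1} (by simp)
    fun k => (hX.measurable _).sub (hX.measurable _)
  have hτ0 : τ 0 = 0 := by simp [τ]
  have hτm : τ (n + 1) = m := by simp [τ]
  have hτr : τ (n + 1 + 1) = r := by simp [τ]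
  -- the index of an element of `I` in the grid
  have hidx : ∀ s : I, ∃ k : Fin n, em k = s := fun s => by
    have : (s : Iic m) ∈ Set.range em := by
      rw [Finset.range_orderEmbOfFin]; exact s.2
    exact this
  choose k hk using hidx
  have hτk : ∀ s : I, τ (k s + 1) = (s : Iic m) := fun s => by
    simp [τ, hk]
  let G : (Finset.range (n + 1) → Space d) → I → Space d := fun y s =>
    ∑ i : Finset.range (n + 1), if (i : ℕ) ≤ k s then y i else 0
  have hG : Measurable G := measurable_pi_lambda _ fun s => Finset.measurable_fun_sum _ fun i _ => by
    split_ifs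
    · exact measurable_pi_apply _
    · exact measurable_const
  have h := hind.comp hG (measurable_pi_apply (⟨n + 1, by simp⟩ : ({n + 1} : Finset ℕ)))
  convert h using 1
  · ext1 ω
    ext1 s
    have e1 : ∑ i ∈ Finset.range (k s + 1), (X (τ (i + 1)) ω - X (τ i) ω) =
        X (s : Iic m) ω - X 0 ω := by
      rw [Finset.sum_range_sub (fun i => X (τ i) ω), hτk, hτ0]
    rw [← e1]
    simp only [G, Function.comp_apply]
    rw [Finset.sum_coe_sort (Finset.range (n + 1)) fun i =>
      if i ≤ (k s : ℕ) then X (τ (i + 1)) ω - X (τ i) ω else 0, ← Finset.sum_filter]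
    refine Finset.sum_congr ?_ fun _ _ => rfl
    ext i
    have := (k s).2
    simp only [Finset.mem_range, Finset.mem_filter]
    omega
  · ext1 ω
    simp only [Function.comp_apply, hτm, hτr]

/-- The increment after time `m` is independent of the whole path up to time `m`. (The starting
point is almost surely `0`.) -/
theorem IsLevyProcess.indepFun_past (hX : IsLevyProcess X P') {m r : ℝ≥0} (hmr : m ≤ r) :
    IndepFun (fun ω (s : Iic m) => X s ω) (fun ω => X r ω - X m ω) P' := by
  have h : IndepFun (fun ω (s : Iic m) => X s ω - X 0 ω) (fun ω => X r ω - X m ω) P' :=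
    IndepFun.process_indepFun (fun s => (hX.measurable _).sub (hX.measurable _))
      ((hX.measurable _).sub (hX.measurable _)) fun I => hX.indepFun_finset hmr I
  refine h.process_congr_left (X' := fun (s : Iic m) ω => X s ω) fun s => ?_
  filter_upwards [hX.start] with ω hω
  simp [hω]

/-- Averaging over an increment which is independent of the past. -/
theorem IsLevyProcess.lintegral_past (hX : IsLevyProcess X P') {m r : ℝ≥0} (hmr : m ≤ r)
    {Z : Ω' → ℝ≥0∞} (hZ : Measurable[pastSigma X m] Z) {D : Ω' → Space d}
    (hD : Measurable[pastSigma X m] D) {g : Space d → ℝ≥0∞} (hg : Measurable g) :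
    ∫⁻ ω, Z ω * g (D ω + (X r ω - X m ω)) ∂P' =
      ∫⁻ ω, Z ω * (∫⁻ ω', g (D ω + (X r ω' - X m ω')) ∂P') ∂P' := by
  have hle : pastSigma X m ≤ ‹MeasurableSpace Ω'› := pastSigma_le fun s _ => hX.measurable s
  have hZ' : Measurable Z := hZ.mono hle le_rfl
  have hD' : Measurable D := hD.mono hle le_rfl
  have hY : Measurable fun ω => X r ω - X m ω := (hX.measurable _).sub (hX.measurable _)
  have hZD : Measurable[pastSigma X m] fun ω => (Z ω, D ω) := hZ.prodMk hD
  have hind : IndepFun (fun ω => (Z ω, D ω)) (fun ω => X r ω - X m ω) P' :=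
    (IndepFun_iff_Indep _ _ _).2 (indep_of_indep_of_le_left
      ((IndepFun_iff_Indep _ _ _).1 (hX.indepFun_past hmr)) hZD.comap_le)
  have hmap := (indepFun_iff_map_prod_eq_prod_map_map (hZ'.prodMk hD').aemeasurable
    hY.aemeasurable).1 hind
  have hG : Measurable fun q : (ℝ≥0∞ × Space d) × Space d => q.1.1 * g (q.1.2 + q.2) :=
    measurable_fst.fst.mul (hg.comp (measurable_fst.snd.add measurable_snd))
  calc ∫⁻ ω, Z ω * g (D ω + (X r ω - X m ω)) ∂P'
      = ∫⁻ q, q.1.1 * g (q.1.2 + q.2)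
          ∂(P'.map fun ω => ((Z ω, D ω), X r ω - X m ω)) := by
        rw [lintegral_map hG ((hZ'.prodMk hD').prodMk hY)]
    _ = ∫⁻ a, ∫⁻ y, a.1 * g (a.2 + y) ∂(P'.map fun ω => X r ω - X m ω)
          ∂(P'.map fun ω => (Z ω, D ω)) := by
        have := Measure.isProbabilityMeasure_map hY.aemeasurable (μ := P')
        rw [hmap, lintegral_prod _ hG.aemeasurable]
    _ = _ := by
        have := Measure.isProbabilityMeasure_map hY.aemeasurable (μ := P')
        rw [lintegral_map hG.lintegral_prod_right' (hZ'.prodMk hD')]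
        refine lintegral_congr fun ω => ?_
        have hgm : Measurable fun y => g (D ω + y) := hg.comp (measurable_const_add _)
        rw [lintegral_const_mul _ hgm, lintegral_map hgm hY]

variable {Ψ : Space d → ℝ} {γ : Space d → ℝ≥0∞} {γhat : Space d → ℝ}

/-- For `s ≤ m < r`, the conditional mean of `γ(X_r - X_s)` given the past up to time `m` is at most
the mean of `γ(X_r - X_m)`: the increment `X_m - X_s` is a shift known at time `m`, and the
potential is largest at the origin. -/
theorem IsSymmetricLevyProcess.lintegral_past_mul_le (hX : IsSymmetricLevyProcess X Ψ P')
    (hγ : IsSpatialCovariance γ γhat)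
    (hint : ∀ v : ℝ, 0 < v → Integrable (fun ξ => Real.exp (-(v * Ψ ξ))) (spectralMeasure γhat))
    {m s r : ℝ≥0} (hs : s ≤ m) (hr : m < r) {Z : Ω' → ℝ≥0∞}
    (hZ : Measurable[pastSigma X m] Z) :
    ∫⁻ ω, Z ω * γ (X r ω - X s ω) ∂P' ≤
      ENNReal.ofReal (potential γhat Ψ (r - m) 0) * ∫⁻ ω, Z ω ∂P' := by
  have h1 : ∫⁻ ω, Z ω * γ (X r ω - X s ω) ∂P' =
      ∫⁻ ω, Z ω * γ ((X m ω - X s ω) + (X r ω - X m ω)) ∂P' :=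
    lintegral_congr fun ω => by congr 2; abel
  have hD : Measurable[pastSigma X m] fun ω => X m ω - X s ω :=
    (measurable_pastSigma le_rfl).sub (measurable_pastSigma hs)
  rw [h1, hX.lintegral_past hr.le hZ hD hγ.measurable]
  simp only [hX.lintegral_increment hγ hint hr]
  rw [← lintegral_const_mul' _ _ ENNReal.ofReal_ne_top]
  refine lintegral_mono fun ω => ?_
  rw [mul_comm]
  gcongr
  exact potential_le_zero (hint _ (sub_pos.2 (NNReal.coe_lt_coe.2 hr))) _

end Past

/-! ### Iterated integrals -/

/-- The iterated integrals `∫_{u < r₁ < ⋯ < r_k ≤ v} a(r₁) ⋯ a(r_k) dr`. -/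
noncomputable def iterIntegral (a : ℝ → ℝ≥0∞) (v : ℝ) : ℕ → ℝ → ℝ≥0∞
  | 0, _ => 1
  | k + 1, u => ∫⁻ r in Ioc u v, a r * iterIntegral a v k r

theorem measurable_setLIntegral_Ioc {Θ : Type*} [MeasurableSpace Θ] {b : ℝ × Θ → ℝ≥0∞}
    (hb : Measurable b) (v : ℝ) :
    Measurable fun q : ℝ × Θ => ∫⁻ r in Ioc q.1 v, b (r, q.2) := by
  have h : ∀ q : ℝ × Θ, ∫⁻ r in Ioc q.1 v, b (r, q.2) =
      ∫⁻ r, {p : (ℝ × Θ) × ℝ | p.1.1 < p.2 ∧ p.2 ≤ v}.indicator (fun p => b (p.2, p.1.2)) (q, r) :=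
    fun q => by
      rw [← lintegral_indicator measurableSet_Ioc]
      rfl
  simp only [h]
  refine Measurable.lintegral_prod_right' (f := {p : (ℝ × Θ) × ℝ | p.1.1 < p.2 ∧ p.2 ≤ v}.indicator
    (fun p => b (p.2, p.1.2))) ?_
  refine Measurable.indicator (by fun_prop) ?_
  exact (measurableSet_lt measurable_fst.fst measurable_snd).inter
    (measurableSet_le measurable_snd measurable_const)

theorem measurable_iterIntegral_uncurry {Θ : Type*} [MeasurableSpace Θ] {a : ℝ × Θ → ℝ≥0∞}
    (ha : Measurable a) (v : ℝ) (k : ℕ) :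
    Measurable fun q : ℝ × Θ => iterIntegral (fun r => a (r, q.2)) v k q.1 := by
  induction k with
  | zero => exact measurable_const
  | succ k ih => exact measurable_setLIntegral_Ioc (ha.mul ih) v

theorem measurable_iterIntegral {a : ℝ → ℝ≥0∞} (ha : Measurable a) (v : ℝ) (k : ℕ) :
    Measurable (iterIntegral a v k) := by
  have h := measurable_iterIntegral_uncurry (Θ := Unit) (a := fun q => a q.1)
    (ha.comp measurable_fst) v k
  exact h.comp (measurable_id.prodMk measurable_const : Measurable fun u : ℝ => (u, ()))

/-- Tonelli's theorem on a triangle. -/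
theorem lintegral_Ioc_triangle {f : ℝ × ℝ → ℝ≥0∞} (hf : Measurable f) (u v : ℝ) :
    ∫⁻ r in Ioc u v, ∫⁻ s in Ioc u r, f (r, s) = ∫⁻ s in Ioc u v, ∫⁻ r in Ioc s v, f (r, s) := by
  let T : Set (ℝ × ℝ) := {p | u < p.2 ∧ p.2 ≤ p.1 ∧ p.1 ≤ v}
  let T' : Set (ℝ × ℝ) := {p | u < p.2 ∧ p.2 < p.1 ∧ p.1 ≤ v}
  have hT : MeasurableSet T := (measurableSet_lt measurable_const measurable_snd).inter
    ((measurableSet_le measurable_snd measurable_fst).inter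
      (measurableSet_le measurable_fst measurable_const))
  have h1 : ∫⁻ r in Ioc u v, ∫⁻ s in Ioc u r, f (r, s) = ∫⁻ r, ∫⁻ s, T.indicator f (r, s) := by
    rw [← lintegral_indicator measurableSet_Ioc]
    refine lintegral_congr fun r => ?_
    by_cases hr : r ∈ Ioc u v
    · rw [indicator_of_mem hr, ← lintegral_indicator measurableSet_Ioc]
      refine lintegral_congr fun s => ?_
      by_cases hs : s ∈ Ioc u r
      · rw [indicator_of_mem hs, indicator_of_mem]
        exact ⟨hs.1, hs.2, hr.2⟩
      · rw [indicator_of_notMem hs, indicator_of_notMem]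
        exact fun h => hs ⟨h.1, h.2.1⟩
    · rw [indicator_of_notMem hr]
      refine (lintegral_eq_zero_of_ae_eq_zero (ae_of_all _ fun s => ?_)).symm
      exact indicator_of_notMem (fun h => hr ⟨h.1.trans_le h.2.1, h.2.2⟩) f
  have h2 : ∫⁻ s in Ioc u v, ∫⁻ r in Ioc s v, f (r, s) = ∫⁻ s, ∫⁻ r, T'.indicator f (r, s) := by
    rw [← lintegral_indicator measurableSet_Ioc]
    refine lintegral_congr fun s => ?_
    by_cases hs : s ∈ Ioc u v
    · rw [indicator_of_mem hs, ← lintegral_indicator measurableSet_Ioc]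
      refine lintegral_congr fun r => ?_
      by_cases hr : r ∈ Ioc s v
      · rw [indicator_of_mem hr, indicator_of_mem]
        exact ⟨hs.1, hr.1, hr.2⟩
      · rw [indicator_of_notMem hr, indicator_of_notMem]
        exact fun h => hr ⟨h.2.1, h.2.2⟩
    · rw [indicator_of_notMem hs]
      refine (lintegral_eq_zero_of_ae_eq_zero (ae_of_all _ fun r => ?_)).symm
      exact indicator_of_notMem (fun h => hs ⟨h.1, h.2.1.le.trans h.2.2⟩) f
  rw [h1, h2, lintegral_lintegral_swap (f := fun r s => T.indicator f (r, s))
    (hf.indicator hT).aemeasurable]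
  refine lintegral_congr fun s => lintegral_congr_ae ?_
  filter_upwards [Measure.ae_ne volume s] with r hr
  by_cases h : (r, s) ∈ T'
  · have h' : (r, s) ∈ T := ⟨h.1, h.2.1.le, h.2.2⟩
    rw [indicator_of_mem h, indicator_of_mem h']
  · rw [indicator_of_notMem h, indicator_of_notMem]
    exact fun h' => h ⟨h'.1, lt_of_le_of_ne h'.2.1 (Ne.symm hr), h'.2.2⟩

/-- `(∫_u^v a) J_k = (k+1) J_{k+1}` for the iterated integrals `J_k`: one splits the new variable
according to its position relative to the smallest one. -/
theorem lintegral_mul_iterIntegral {a : ℝ → ℝ≥0∞} (ha : Measurable a) (v : ℝ) (k : ℕ) (u : ℝ) :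
    (∫⁻ r in Ioc u v, a r) * iterIntegral a v k u = (k + 1) * iterIntegral a v (k + 1) u := by
  induction k generalizing u with
  | zero => simp [iterIntegral]
  | succ k ih =>
    have hJ : ∀ k, Measurable fun r => a r * iterIntegral a v k r := fun k =>
      ha.mul (measurable_iterIntegral ha v k)
    have hJ' : Measurable fun r => a r * ((k + 1) * iterIntegral a v (k + 1) r) :=
      ha.mul ((measurable_iterIntegral ha v (k + 1)).const_mul _)
    calc (∫⁻ r in Ioc u v, a r) * iterIntegral a v (k + 1) u
        = ∫⁻ r in Ioc u v, (∫⁻ s in Ioc u v, a s) * (a r * iterIntegral a v k r) := by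
          rw [iterIntegral, lintegral_const_mul _ (hJ k)]
      _ = ∫⁻ r in Ioc u v, (a r * ((k + 1) * iterIntegral a v (k + 1) r) +
            ∫⁻ s in Ioc u r, a s * (a r * iterIntegral a v k r)) := by
          refine setLIntegral_congr_fun measurableSet_Ioc fun r hr => ?_
          rw [← ih r, lintegral_mul_const _ ha, ← Ioc_union_Ioc_eq_Ioc hr.1.le hr.2,
            lintegral_union measurableSet_Ioc (Ioc_disjoint_Ioc_of_le le_rfl)]
          ring
      _ = (k + 1) * iterIntegral a v (k + 2) u +
            ∫⁻ s in Ioc u v, ∫⁻ r in Ioc s v, a s * (a r * iterIntegral a v k r) := by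
          rw [lintegral_add_left hJ']
          congr 1
          · rw [iterIntegral, ← lintegral_const_mul _ (hJ (k + 1))]
            refine lintegral_congr fun r => ?_
            ring
          · exact lintegral_Ioc_triangle (f := fun p => a p.2 * (a p.1 * iterIntegral a v k p.1))
              ((ha.comp measurable_snd).mul ((hJ k).comp measurable_fst)) u v
      _ = (k + 1) * iterIntegral a v (k + 2) u + iterIntegral a v (k + 2) u := by
          congr 1
          rw [iterIntegral]
          refine lintegral_congr fun s => ?_
          rw [lintegral_const_mul _ (hJ k), iterIntegral]
      _ = _ := by push_cast; ring

/-- The power of an integral is `k!` times the integral over the ordered simplex. -/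
theorem lintegral_pow_eq_iterIntegral {a : ℝ → ℝ≥0∞} (ha : Measurable a) (u v : ℝ) (k : ℕ) :
    (∫⁻ r in Ioc u v, a r) ^ k = k.factorial * iterIntegral a v k u := by
  induction k with
  | zero => simp [iterIntegral]
  | succ k ih =>
    calc (∫⁻ r in Ioc u v, a r) ^ (k + 1)
        = k.factorial * ((∫⁻ r in Ioc u v, a r) * iterIntegral a v k u) := by
          rw [pow_succ, ih]; ring
      _ = _ := by
          rw [lintegral_mul_iterIntegral ha, Nat.factorial_succ]
          push_cast
          ring

/-- The exponential series. At `y = ∞` the left side is `1`, since `toReal` sends `∞` to `0`; hence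
an inequality. -/
theorem ofReal_exp_le_tsum {c : ℝ} (hc : 0 ≤ c) (y : ℝ≥0∞) :
    ENNReal.ofReal (Real.exp (c * y.toReal)) ≤
      ∑' k : ℕ, ENNReal.ofReal c ^ k * (y ^ k / k.factorial) := by
  by_cases hy : y = ∞
  · refine le_trans ?_ (ENNReal.le_tsum 0)
    simp [hy]
  · have h1 : Real.exp (c * y.toReal) = ∑' k : ℕ, (c * y.toReal) ^ k / k.factorial := by
      rw [Real.exp_eq_exp_ℝ, NormedSpace.exp_eq_tsum_div]
    rw [h1, ENNReal.ofReal_tsum_of_nonneg (fun k => by positivity)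
      (Real.summable_pow_div_factorial _)]
    refine ENNReal.tsum_le_tsum fun k => le_of_eq ?_
    rw [ENNReal.ofReal_div_of_pos (by positivity), ENNReal.ofReal_pow (by positivity),
      ENNReal.ofReal_mul hc, ENNReal.ofReal_toReal hy, ENNReal.ofReal_natCast, mul_pow, mul_div_assoc]

/-! ### Exponential moments of the energy of the Lévy path -/

section EnergyRate

variable {d : ℕ} {β₀ : ℝ} {γ : Space d → ℝ≥0∞}

/-- The energy density `|r-s|^{-β₀} γ(f(r) - f(s))` of a path, for `0 < s < r`. -/
noncomputable def energyDensity (β₀ : ℝ) (γ : Space d → ℝ≥0∞) (f : ℝ≥0 → Space d) (r s : ℝ) :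
    ℝ≥0∞ :=
  if 0 < s ∧ s < r then ENNReal.ofReal (|r - s| ^ (-β₀)) * γ (f r.toNNReal - f s.toNNReal) else 0

/-- `∫_0^r |r-s|^{-β₀} γ(f(r) - f(s)) ds`, the rate of growth of half the energy of a path. -/
noncomputable def energyRate (β₀ : ℝ) (γ : Space d → ℝ≥0∞) (f : ℝ≥0 → Space d) (r : ℝ) : ℝ≥0∞ :=
  ∫⁻ s, energyDensity β₀ γ f r s

theorem energyRate_congr {f g : ℝ≥0 → Space d} {r : ℝ}
    (h : ∀ s : ℝ, 0 < s → s ≤ r → f s.toNNReal = g s.toNNReal) :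
    energyRate β₀ γ f r = energyRate β₀ γ g r := by
  refine lintegral_congr fun s => ?_
  unfold energyDensity
  split_ifs with hs
  · rw [h s hs.1 hs.2.le, h r (hs.1.trans hs.2) le_rfl]
  · rfl

theorem measurable_energyDensity_uncurry {Θ : Type*} [MeasurableSpace Θ] (hγ : Measurable γ)
    {A : ℝ≥0 → Θ → Space d} (hA : Measurable fun p : ℝ × Θ => A p.1.toNNReal p.2) :
    Measurable fun q : (ℝ × Θ) × ℝ => energyDensity β₀ γ (fun s => A s q.1.2) q.1.1 q.2 := by
  unfold energyDensity
  refine Measurable.ite ?_ (Measurable.mul (by fun_prop) (hγ.comp (Measurable.sub ?_ ?_)))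
    measurable_const
  · exact (measurableSet_lt measurable_const measurable_snd).inter
      (measurableSet_lt measurable_snd measurable_fst.fst)
  · exact hA.comp measurable_fst
  · exact hA.comp (measurable_snd.prodMk measurable_fst.snd)

theorem measurable_energyRate {Θ : Type*} [MeasurableSpace Θ] (hγ : Measurable γ)
    {A : ℝ≥0 → Θ → Space d} (hA : Measurable fun p : ℝ × Θ => A p.1.toNNReal p.2) :
    Measurable fun q : ℝ × Θ => energyRate β₀ γ (fun s => A s q.2) q.1 :=
  (measurable_energyDensity_uncurry hγ hA).lintegral_prod_right'

/-- Up to time `m` the energy depends on the past up to `m` only. -/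
theorem measurable_energyRate_pastSigma {Ω' : Type*} (hγ : Measurable γ)
    {X : ℝ≥0 → Ω' → Space d} (hc : ∀ ω, IsCadlagPath fun s => X s ω) (m : ℝ≥0) :
    Measurable[(inferInstance : MeasurableSpace ℝ).prod (pastSigma X m)]
      fun q : ℝ × Ω' => if q.1 ≤ m then energyRate β₀ γ (fun s => X s q.2) q.1 else 0 := by
  let F : MeasurableSpace Ω' := pastSigma X m
  let Y : ℝ≥0 → Ω' → Space d := fun s ω => X (min s m) ω
  have hY : ∀ s, Measurable[F] (Y s) := fun s => measurable_pastSigma (min_le_right _ _)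
  have hYc : ∀ ω s, ContinuousWithinAt (fun s => Y s ω) (Ici s) s := fun ω s =>
    ContinuousWithinAt.comp (g := fun s => X s ω) (t := Ici (min s m)) (hc ω (min s m)).1
      (by fun_prop) fun r hr => min_le_min_right m hr
  have h1 : Measurable[(inferInstance : MeasurableSpace ℝ).prod F]
      fun q : ℝ × Ω' => energyRate β₀ γ (fun s => Y s q.2) q.1 :=
    @measurable_energyRate d β₀ γ Ω' F hγ Y (@measurable_uncurry_of_rightCont d Ω' F Y hY hYc)
  have h2 : (fun q : ℝ × Ω' => if q.1 ≤ m then energyRate β₀ γ (fun s => X s q.2) q.1 else 0) =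
      fun q : ℝ × Ω' => if q.1 ≤ m then energyRate β₀ γ (fun s => Y s q.2) q.1 else 0 := by
    ext q
    split_ifs with h
    · refine energyRate_congr fun s _ hs => ?_
      simp only [Y]
      rw [min_eq_left (Real.toNNReal_le_iff_le_coe.2 (hs.trans h))]
    · rfl
  rw [h2]
  refine Measurable.ite ?_ h1 measurable_const
  exact measurableSet_le (@measurable_fst ℝ Ω' _ F) measurable_const

theorem measurable_energyRate_past {Ω' : Type*} (hγ : Measurable γ)
    {X : ℝ≥0 → Ω' → Space d} (hc : ∀ ω, IsCadlagPath fun s => X s ω) {r : ℝ} (hr : 0 ≤ r) :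
    Measurable[pastSigma X r.toNNReal] fun ω => energyRate β₀ γ (fun s => X s ω) r := by
  have h := (measurable_energyRate_pastSigma (β₀ := β₀) hγ hc r.toNNReal).comp
    (@measurable_prodMk_left ℝ Ω' _ (pastSigma X r.toNNReal) r)
  simpa [Function.comp_def, Real.coe_toNNReal _ hr] using h

theorem measurable_setLIntegral_energyRate_past {Ω' : Type*} (hγ : Measurable γ)
    {X : ℝ≥0 → Ω' → Space d} (hc : ∀ ω, IsCadlagPath fun s => X s ω) {v : ℝ} (hv : 0 ≤ v) :
    Measurable[pastSigma X v.toNNReal] fun ω =>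
      ∫⁻ r in Ioc 0 v, energyRate β₀ γ (fun s => X s ω) r := by
  have h := @Measurable.lintegral_prod_left' ℝ Ω' _ (pastSigma X v.toNNReal)
    (volume.restrict (Ioc 0 v)) _ _ (measurable_energyRate_pastSigma (β₀ := β₀) hγ hc v.toNNReal)
  have e : (fun ω => ∫⁻ r in Ioc 0 v, energyRate β₀ γ (fun s => X s ω) r) = fun ω =>
      ∫⁻ r in Ioc 0 v,
        if r ≤ (v.toNNReal : ℝ) then energyRate β₀ γ (fun s => X s ω) r else 0 := by
    ext ω
    refine setLIntegral_congr_fun measurableSet_Ioc fun r hr => ?_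
    simp only [Real.coe_toNNReal _ hv, hr.2, if_true]
  rw [e]
  exact h

/-- The energy of a path is twice the integral of its rate. -/
theorem mutualEnergy_self_le (hγ : Measurable γ) (hs : ∀ z, γ (-z) = γ z) {f : ℝ≥0 → Space d}
    (hf : Measurable fun s : ℝ => f s.toNNReal) (t : ℝ≥0) :
    mutualEnergy β₀ γ t f f ≤ 2 * ∫⁻ r in Ioc (0 : ℝ) t, energyRate β₀ γ f r := by
  have hf' : Measurable fun p : ℝ × Unit => (fun s (_ : Unit) => f s) p.1.toNNReal p.2 :=
    hf.comp measurable_fst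
  have hD : Measurable fun p : ℝ × ℝ => energyDensity β₀ γ f p.1 p.2 :=
    (measurable_energyDensity_uncurry (β₀ := β₀) hγ (A := fun s (_ : Unit) => f s) hf').comp
      ((measurable_fst.prodMk measurable_const).prodMk measurable_snd :
        Measurable fun p : ℝ × ℝ => ((p.1, ()), p.2))
  have hD' : Measurable fun p : ℝ × ℝ => energyDensity β₀ γ f p.2 p.1 :=
    hD.comp measurable_swap
  have e1 : ∫⁻ p, energyDensity β₀ γ f p.1 p.2 ∂(timeSquare t) ≤
      ∫⁻ r in Ioc (0 : ℝ) t, energyRate β₀ γ f r := by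
    rw [timeSquare, lintegral_prod _ hD.aemeasurable, Measure.restrict_congr_set Ioo_ae_eq_Ioc]
    exact lintegral_mono fun r => setLIntegral_le_lintegral _ _
  have e2 : ∫⁻ p, energyDensity β₀ γ f p.2 p.1 ∂(timeSquare t) ≤
      ∫⁻ r in Ioc (0 : ℝ) t, energyRate β₀ γ f r := by
    rw [timeSquare, lintegral_prod_symm _ hD'.aemeasurable,
      Measure.restrict_congr_set Ioo_ae_eq_Ioc]
    exact lintegral_mono fun r => setLIntegral_le_lintegral _ _
  rw [mutualEnergy_eq hγ hf hf, two_mul]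
  refine le_trans ?_ (add_le_add e1 e2)
  rw [← lintegral_add_left hD]
  refine lintegral_mono_ae ?_
  filter_upwards [ae_timeSquare t] with p hp
  rcases lt_or_gt_of_ne hp.2.2 with h | h
  · refine le_add_left (le_of_eq ?_)
    rw [energyDensity, if_pos ⟨hp.1.1, h⟩, abs_sub_comm, ← hs]
    congr 2
    abel
  · refine le_add_right (le_of_eq ?_)
    rw [energyDensity, if_pos ⟨hp.2.1.1, h⟩]

end EnergyRate

section Khasminskii

variable {d : ℕ} {Ω' : Type*} [MeasurableSpace Ω'] {P' : Measure Ω'} [IsProbabilityMeasure P']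
  {X : ℝ≥0 → Ω' → Space d} {Ψ : Space d → ℝ} {γ : Space d → ℝ≥0∞} {γhat : Space d → ℝ} {β₀ : ℝ}

theorem IsSymmetricLevyProcess.lintegral_mul_energyDensity_le (hX : IsSymmetricLevyProcess X Ψ P')
    (hγ : IsSpatialCovariance γ γhat) (hβ₀ : 0 < β₀)
    (hint : ∀ v : ℝ, 0 < v → Integrable (fun ξ => Real.exp (-(v * Ψ ξ))) (spectralMeasure γhat))
    {u s r : ℝ} (hu : 0 ≤ u) (hur : u < r) (hs : 0 < s) (hsr : s < r) {Z : Ω' → ℝ≥0∞}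
    (hZ : Measurable[pastSigma X u.toNNReal] Z) :
    ∫⁻ ω, Z ω * energyDensity β₀ γ (fun s => X s ω) r s ∂P' ≤
      energyKernel β₀ γhat Ψ (r - max u s) * ∫⁻ ω, Z ω ∂P' := by
  have hm : max u s < r := max_lt hur hsr
  have hm0 : 0 ≤ max u s := hu.trans (le_max_left _ _)
  have h1 := hX.lintegral_past_mul_le hγ hint (m := (max u s).toNNReal) (s := s.toNNReal)
    (r := r.toNNReal) (Real.toNNReal_le_toNNReal (le_max_right _ _))
    ((Real.toNNReal_lt_toNNReal_iff (hs.trans hsr)).2 hm)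
    (hZ.mono (pastSigma_mono X (Real.toNNReal_le_toNNReal (le_max_left _ _))) le_rfl)
  rw [Real.coe_toNNReal _ hm0, Real.coe_toNNReal _ (hs.trans hsr).le] at h1
  rw [energyKernel_eq hint (sub_pos.2 hm).ne', abs_of_pos (sub_pos.2 hm), mul_assoc]
  calc ∫⁻ ω, Z ω * energyDensity β₀ γ (fun s => X s ω) r s ∂P'
      = ENNReal.ofReal (|r - s| ^ (-β₀)) *
          ∫⁻ ω, Z ω * γ (X r.toNNReal ω - X s.toNNReal ω) ∂P' := by
        rw [← lintegral_const_mul' _ _ ENNReal.ofReal_ne_top]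
        refine lintegral_congr fun ω => ?_
        rw [energyDensity, if_pos ⟨hs, hsr⟩]
        ring
    _ ≤ _ := by
        refine mul_le_mul' (ENNReal.ofReal_le_ofReal ?_) h1
        rw [abs_of_pos (sub_pos.2 hsr)]
        exact Real.rpow_le_rpow_of_nonpos (sub_pos.2 hm)
          (sub_le_sub_left (le_max_right _ _) _) (by linarith)

theorem setLIntegral_Ioc_sub_max_le (k : ℝ → ℝ≥0∞) {u s v : ℝ} :
    ∫⁻ r in Ioc u v, (Ioi s).indicator (fun r => k (r - max u s)) r ≤
      ∫⁻ h in Ioc 0 (v - u), k h := by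
  rw [setLIntegral_indicator measurableSet_Ioi, inter_comm]
  have e1 : Ioc u v ∩ Ioi s = Ioc (max u s) v := by
    ext r
    simp only [mem_inter_iff, mem_Ioc, mem_Ioi, max_lt_iff]
    tauto
  have e2 : ∫⁻ r in Ioc (max u s) v, k (r - max u s) = ∫⁻ h in Ioc 0 (v - max u s), k h := by
    have := (measurePreserving_add_right (volume : Measure ℝ)
      (max u s)).setLIntegral_comp_preimage_emb
      (MeasurableEquiv.addRight (max u s)).measurableEmbedding (fun r => k (r - max u s))
      (Ioc (max u s) v)
    rw [← this]
    simp only [preimage_add_const_Ioc, sub_self, add_sub_cancel_right]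
  rw [e1, e2]
  exact lintegral_mono_set (Ioc_subset_Ioc_right (sub_le_sub_left (le_max_left _ _) _))

/-- Khasminskii's condition: given the past up to time `u`, the mean growth of the energy over
`[u,v]` is at most `v ∫_0^{v-u} k`, where `k` is the energy kernel. -/
theorem IsSymmetricLevyProcess.lintegral_mul_energyRate_le (hX : IsSymmetricLevyProcess X Ψ P')
    (hc : ∀ ω, IsCadlagPath fun s => X s ω) (hγ : IsSpatialCovariance γ γhat) (hβ₀ : 0 < β₀)
    (hint : ∀ v : ℝ, 0 < v → Integrable (fun ξ => Real.exp (-(v * Ψ ξ))) (spectralMeasure γhat))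
    {u v : ℝ} (hu : 0 ≤ u) {Z : Ω' → ℝ≥0∞} (hZ : Measurable[pastSigma X u.toNNReal] Z) :
    ∫⁻ r in Ioc u v, ∫⁻ ω, Z ω * energyRate β₀ γ (fun s => X s ω) r ∂P' ≤
      (ENNReal.ofReal v * ∫⁻ h in Ioc 0 (v - u), energyKernel β₀ γhat Ψ h) * ∫⁻ ω, Z ω ∂P' := by
  have hXm := measurable_uncurry_real_of_cadlag hX.measurable hc
  have hZ' : Measurable Z := hZ.mono (pastSigma_le fun s _ => hX.measurable s) le_rfl
  have hD := measurable_energyDensity_uncurry (β₀ := β₀) hγ.measurable hXm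
  have hZD : Measurable fun q : (ℝ × ℝ) × Ω' =>
      Z q.2 * energyDensity β₀ γ (fun s => X s q.2) q.1.1 q.1.2 :=
    (hZ'.comp measurable_snd).mul (hD.comp
      ((measurable_fst.fst.prodMk measurable_snd).prodMk measurable_fst.snd))
  have hM : Measurable fun p : ℝ × ℝ =>
      ∫⁻ ω, Z ω * energyDensity β₀ γ (fun s => X s ω) p.1 p.2 ∂P' := hZD.lintegral_prod_right'
  calc ∫⁻ r in Ioc u v, ∫⁻ ω, Z ω * energyRate β₀ γ (fun s => X s ω) r ∂P'
      = ∫⁻ r in Ioc u v, ∫⁻ s, ∫⁻ ω, Z ω * energyDensity β₀ γ (fun s => X s ω) r s ∂P' := by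
        refine lintegral_congr fun r => ?_
        rw [lintegral_lintegral_swap (f := fun (s : ℝ) ω =>
          Z ω * energyDensity β₀ γ (fun s => X s ω) r s)]
        · refine lintegral_congr fun ω => ?_
          have : Measurable fun s => energyDensity β₀ γ (fun s => X s ω) r s :=
            hD.comp (measurable_prodMk_left : Measurable fun s : ℝ => ((r, ω), s))
          rw [lintegral_const_mul _ this, energyRate]
        · exact (hZD.comp ((measurable_const.prodMk measurable_fst).prodMk measurable_snd :
            Measurable fun q : ℝ × Ω' => ((r, q.1), q.2))).aemeasurable
    _ = ∫⁻ s, ∫⁻ r in Ioc u v, ∫⁻ ω, Z ω * energyDensity β₀ γ (fun s => X s ω) r s ∂P' :=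
        lintegral_lintegral_swap (f := fun r s =>
          ∫⁻ ω, Z ω * energyDensity β₀ γ (fun s => X s ω) r s ∂P') hM.aemeasurable
    _ ≤ ∫⁻ s, (Ioc 0 v).indicator (fun _ => (∫⁻ h in Ioc 0 (v - u), energyKernel β₀ γhat Ψ h) *
          ∫⁻ ω, Z ω ∂P') s := by
        refine lintegral_mono fun s => ?_
        by_cases hs : s ∈ Ioc 0 v
        · rw [indicator_of_mem hs]
          have hk : Measurable fun r => (Ioi s).indicator
              (fun r => energyKernel β₀ γhat Ψ (r - max u s)) r :=
            ((measurable_energyKernel hX.measurable_exponent).comp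
              (measurable_id.sub_const _)).indicator measurableSet_Ioi
          refine le_trans ?_ (mul_le_mul_left (setLIntegral_Ioc_sub_max_le
            (energyKernel β₀ γhat Ψ) (u := u) (s := s) (v := v)) _)
          rw [← lintegral_mul_const _ hk]
          refine setLIntegral_mono (hk.mul_const _) fun r hr => ?_
          by_cases hsr : s < r
          · rw [indicator_of_mem (by exact hsr)]
            exact hX.lintegral_mul_energyDensity_le hγ hβ₀ hint hu hr.1 hs.1 hsr hZ
          · have : ∀ ω, energyDensity β₀ γ (fun s => X s ω) r s = 0 := fun ω =>
              if_neg fun h => hsr h.2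
            simp [this]
        · refine le_of_eq_of_le ?_ zero_le
          refine setLIntegral_eq_zero measurableSet_Ioc fun r hr => ?_
          have : ∀ ω, energyDensity β₀ γ (fun s => X s ω) r s = 0 := fun ω =>
            if_neg fun h => hs ⟨h.1, h.2.le.trans hr.2⟩
          simp [this]
    _ = _ := by
        rw [lintegral_indicator_const measurableSet_Ioc, Real.volume_Ioc, sub_zero]
        ring

/-- Khasminskii's lemma for the iterated integrals of the energy rate. -/
theorem IsSymmetricLevyProcess.lintegral_mul_iterIntegral_le (hX : IsSymmetricLevyProcess X Ψ P')
    (hc : ∀ ω, IsCadlagPath fun s => X s ω) (hγ : IsSpatialCovariance γ γhat) (hβ₀ : 0 < β₀)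
    (hint : ∀ v : ℝ, 0 < v → Integrable (fun ξ => Real.exp (-(v * Ψ ξ))) (spectralMeasure γhat))
    {u₀ v : ℝ} (hu₀ : 0 ≤ u₀) (k : ℕ) {u : ℝ} (hu : u₀ ≤ u) {Z : Ω' → ℝ≥0∞}
    (hZ : Measurable[pastSigma X u.toNNReal] Z) :
    ∫⁻ ω, Z ω * iterIntegral (energyRate β₀ γ fun s => X s ω) v k u ∂P' ≤
      (ENNReal.ofReal v * ∫⁻ h in Ioc 0 (v - u₀), energyKernel β₀ γhat Ψ h) ^ k *
        ∫⁻ ω, Z ω ∂P' := by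
  have hXm := measurable_uncurry_real_of_cadlag hX.measurable hc
  have hR := measurable_energyRate (β₀ := β₀) hγ.measurable hXm
  induction k generalizing u Z with
  | zero => simp [iterIntegral]
  | succ k ih =>
    have hu0 := hu₀.trans hu
    have hZ' : Measurable Z := hZ.mono (pastSigma_le fun s _ => hX.measurable s) le_rfl
    have hJ : Measurable fun q : ℝ × Ω' =>
        iterIntegral (energyRate β₀ γ fun s => X s q.2) v k q.1 :=
      measurable_iterIntegral_uncurry hR v k
    have hRJ : Measurable fun q : ℝ × Ω' => energyRate β₀ γ (fun s => X s q.2) q.1 *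
        iterIntegral (energyRate β₀ γ fun s => X s q.2) v k q.1 := hR.mul hJ
    calc ∫⁻ ω, Z ω * iterIntegral (energyRate β₀ γ fun s => X s ω) v (k + 1) u ∂P'
        = ∫⁻ ω, (∫⁻ r in Ioc u v, Z ω * (energyRate β₀ γ (fun s => X s ω) r *
            iterIntegral (energyRate β₀ γ fun s => X s ω) v k r)) ∂P' := by
          refine lintegral_congr fun ω => ?_
          have : Measurable fun r => energyRate β₀ γ (fun s => X s ω) r *
            iterIntegral (energyRate β₀ γ fun s => X s ω) v k r := hRJ.comp measurable_prodMk_right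
          rw [lintegral_const_mul _ this, iterIntegral]
      _ = ∫⁻ r in Ioc u v, ∫⁻ ω, (Z ω * energyRate β₀ γ (fun s => X s ω) r) *
            iterIntegral (energyRate β₀ γ fun s => X s ω) v k r ∂P' := by
          rw [lintegral_lintegral_swap (f := fun ω r => Z ω *
            (energyRate β₀ γ (fun s => X s ω) r *
            iterIntegral (energyRate β₀ γ fun s => X s ω) v k r))]
          · simp only [mul_assoc]
          · exact ((hZ'.comp measurable_fst).mul (hRJ.comp measurable_swap)).aemeasurable
      _ ≤ ∫⁻ r in Ioc u v, (ENNReal.ofReal v *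
            ∫⁻ h in Ioc 0 (v - u₀), energyKernel β₀ γhat Ψ h) ^ k *
              ∫⁻ ω, Z ω * energyRate β₀ γ (fun s => X s ω) r ∂P' := by
          refine setLIntegral_mono' measurableSet_Ioc fun r hr => ih (hu.trans hr.1.le) ?_
          exact (hZ.mono (pastSigma_mono X (Real.toNNReal_le_toNNReal hr.1.le)) le_rfl).mul
            (measurable_energyRate_past hγ.measurable hc (hu0.trans hr.1.le))
      _ = (ENNReal.ofReal v * ∫⁻ h in Ioc 0 (v - u₀), energyKernel β₀ γhat Ψ h) ^ k *
            ∫⁻ r in Ioc u v, ∫⁻ ω, Z ω * energyRate β₀ γ (fun s => X s ω) r ∂P' := by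
          have : Measurable fun r => ∫⁻ ω, Z ω * energyRate β₀ γ (fun s => X s ω) r ∂P' :=
            ((hZ'.comp measurable_snd).mul hR).lintegral_prod_right'
          rw [lintegral_const_mul _ this]
      _ ≤ (ENNReal.ofReal v * ∫⁻ h in Ioc 0 (v - u₀), energyKernel β₀ γhat Ψ h) ^ k *
            ((ENNReal.ofReal v * ∫⁻ h in Ioc 0 (v - u₀), energyKernel β₀ γhat Ψ h) *
              ∫⁻ ω, Z ω ∂P') := by
          refine mul_le_mul_right ((hX.lintegral_mul_energyRate_le hc hγ hβ₀ hint hu0 hZ).trans ?_) _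
          gcongr
      _ = _ := by ring

end Khasminskii

section ExponentialMoments

variable {d : ℕ} {Ω' : Type*} [MeasurableSpace Ω'] {P' : Measure Ω'} [IsProbabilityMeasure P']
  {X : ℝ≥0 → Ω' → Space d} {Ψ : Space d → ℝ} {γ : Space d → ℝ≥0∞} {γhat : Space d → ℝ} {β₀ : ℝ}

/-- Khasminskii's lemma: over a time interval on which the mean growth of the energy is small, an
exponential moment of the growth costs at most a factor `2`, given the past. -/
theorem IsSymmetricLevyProcess.lintegral_mul_exp_energyRate_le (hX : IsSymmetricLevyProcess X Ψ P')
    (hc : ∀ ω, IsCadlagPath fun s => X s ω) (hγ : IsSpatialCovariance γ γhat) (hβ₀ : 0 < β₀)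
    (hint : ∀ v : ℝ, 0 < v → Integrable (fun ξ => Real.exp (-(v * Ψ ξ))) (spectralMeasure γhat))
    {c : ℝ} (hc0 : 0 ≤ c) {u v : ℝ} (hu : 0 ≤ u)
    (hsmall : ENNReal.ofReal c * (ENNReal.ofReal v *
      ∫⁻ h in Ioc 0 (v - u), energyKernel β₀ γhat Ψ h) ≤ 2⁻¹)
    {Z : Ω' → ℝ≥0∞} (hZ : Measurable[pastSigma X u.toNNReal] Z) :
    ∫⁻ ω, Z ω * ENNReal.ofReal (Real.exp (c *
      (∫⁻ r in Ioc u v, energyRate β₀ γ (fun s => X s ω) r).toReal)) ∂P' ≤ 2 * ∫⁻ ω, Z ω ∂P' := by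
  have hXm := measurable_uncurry_real_of_cadlag hX.measurable hc
  have hR : Measurable fun q : ℝ × Ω' => energyRate β₀ γ (fun s => X s q.2) q.1 :=
    measurable_energyRate hγ.measurable hXm
  have hZ' : Measurable Z := hZ.mono (pastSigma_le fun s _ => hX.measurable s) le_rfl
  have hJ : ∀ k, Measurable fun ω => iterIntegral (energyRate β₀ γ fun s => X s ω) v k u :=
    fun k => (measurable_iterIntegral_uncurry hR v k).comp
      (measurable_prodMk_left : Measurable fun ω : Ω' => (u, ω))
  have hRω : ∀ ω, Measurable (energyRate β₀ γ fun s => X s ω) := fun ω =>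
    hR.comp (measurable_prodMk_right : Measurable fun r : ℝ => (r, ω))
  set κ := ENNReal.ofReal v * ∫⁻ h in Ioc 0 (v - u), energyKernel β₀ γhat Ψ h
  calc ∫⁻ ω, Z ω * ENNReal.ofReal (Real.exp (c *
        (∫⁻ r in Ioc u v, energyRate β₀ γ (fun s => X s ω) r).toReal)) ∂P'
      ≤ ∫⁻ ω, (∑' k : ℕ, ENNReal.ofReal c ^ k *
          (Z ω * iterIntegral (energyRate β₀ γ fun s => X s ω) v k u)) ∂P' := by
        refine lintegral_mono fun ω => ?_
        refine (mul_le_mul_right (ofReal_exp_le_tsum hc0 _) _).trans (le_of_eq ?_)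
        rw [← ENNReal.tsum_mul_left]
        refine tsum_congr fun k => ?_
        rw [lintegral_pow_eq_iterIntegral (hRω ω), mul_comm (k.factorial : ℝ≥0∞),
          ENNReal.mul_div_cancel_right (by exact_mod_cast k.factorial_ne_zero)
            (ENNReal.natCast_ne_top _), mul_left_comm]
    _ = ∑' k : ℕ, ENNReal.ofReal c ^ k *
          ∫⁻ ω, Z ω * iterIntegral (energyRate β₀ γ fun s => X s ω) v k u ∂P' := by
        have hZJ : ∀ k, Measurable fun ω => Z ω *
            iterIntegral (energyRate β₀ γ fun s => X s ω) v k u := fun k => hZ'.mul (hJ k)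
        rw [lintegral_tsum fun k => ((hZJ k).const_mul _).aemeasurable]
        exact tsum_congr fun k => lintegral_const_mul _ (hZJ k)
    _ ≤ ∑' k : ℕ, 2⁻¹ ^ k * ∫⁻ ω, Z ω ∂P' := by
        refine ENNReal.tsum_le_tsum fun k => ?_
        refine (mul_le_mul_right
          (hX.lintegral_mul_iterIntegral_le hc hγ hβ₀ hint hu k le_rfl hZ) _).trans ?_
        rw [← mul_assoc, ← mul_pow]
        gcongr
    _ = 2 * ∫⁻ ω, Z ω ∂P' := by
        rw [ENNReal.tsum_mul_right, ENNReal.tsum_geometric, ENNReal.one_sub_inv_two, inv_inv]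

/-- All exponential moments of the energy accumulated along the Lévy path are finite. -/
theorem IsSymmetricLevyProcess.lintegral_exp_energyRate_lt_top
    (hX : IsSymmetricLevyProcess X Ψ P') (hc : ∀ ω, IsCadlagPath fun s => X s ω)
    (hγ : IsSpatialCovariance γ γhat) (hβ₀ : 0 < β₀) (hβ₁ : β₀ < 1)
    (hI : SpectralCondition β₀ Ψ (spectralMeasure γhat))
    {c : ℝ} (hc0 : 0 ≤ c) {t : ℝ} (ht : 0 ≤ t) :
    ∫⁻ ω, ENNReal.ofReal (Real.exp (c *
      (∫⁻ r in Ioc 0 t, energyRate β₀ γ (fun s => X s ω) r).toReal)) ∂P' < ∞ := by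
  have hint := fun (v : ℝ) (hv : 0 < v) => hX.integrable_exp hβ₀ hβ₁ hI hv
  have hXm := measurable_uncurry_real_of_cadlag hX.measurable hc
  have hk := setLIntegral_energyKernel_lt_top hβ₀ hβ₁ hX.measurable_exponent
    hX.exponent_nonneg hI zero_le_one
  -- Absolute continuity of the integral makes the energy kernel small on short intervals. The `+ 1`
  -- keeps the denominator from vanishing when `c t = 0`.
  obtain ⟨η, hη, hη'⟩ := exists_pos_setLIntegral_lt_of_measure_lt hk.ne
    (ε := (2 * (ENNReal.ofReal c * ENNReal.ofReal t) + 1)⁻¹)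
    (ENNReal.inv_ne_zero.2 (by finiteness))
  obtain ⟨δ, hδ0, hδη⟩ : ∃ δ : ℝ, 0 < δ ∧ δ ≤ 1 ∧ ENNReal.ofReal δ < η := by
    rcases eq_or_ne η ∞ with rfl | hη2
    · exact ⟨1, one_pos, le_rfl, ENNReal.ofReal_lt_top⟩
    · have : 0 < η.toReal := ENNReal.toReal_pos hη.ne' hη2
      refine ⟨min 1 (η.toReal / 2), by positivity, min_le_left _ _, ?_⟩
      rw [ENNReal.ofReal_lt_iff_lt_toReal (by positivity) hη2]
      exact (min_le_right _ _).trans_lt (by linarith)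
  -- On intervals of length at most `δ` inside `[0,t]` the smallness condition holds.
  have hstep : ∀ u v : ℝ, v ≤ t → v - u ≤ δ → ENNReal.ofReal c * (ENNReal.ofReal v *
      ∫⁻ h in Ioc 0 (v - u), energyKernel β₀ γhat Ψ h) ≤ 2⁻¹ := by
    intro u v hv huv
    have h1 : ∫⁻ h in Ioc 0 δ, energyKernel β₀ γhat Ψ h ≤
        (2 * (ENNReal.ofReal c * ENNReal.ofReal t) + 1)⁻¹ := by
      have := hη' (Ioc 0 δ) (by
        refine (Measure.restrict_apply_le _ _).trans_lt ?_
        rw [Real.volume_Ioc, sub_zero]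
        exact hδη.2)
      rw [Measure.restrict_restrict measurableSet_Ioc, Ioc_inter_Ioc, max_self,
        min_eq_left hδη.1] at this
      exact this.le
    have h2 : ∫⁻ h in Ioc 0 (v - u), energyKernel β₀ γhat Ψ h ≤
        (2 * (ENNReal.ofReal c * ENNReal.ofReal t) + 1)⁻¹ :=
      (lintegral_mono_set (Ioc_subset_Ioc_right huv)).trans h1
    calc ENNReal.ofReal c * (ENNReal.ofReal v *
          ∫⁻ h in Ioc 0 (v - u), energyKernel β₀ γhat Ψ h)
        ≤ ENNReal.ofReal c * (ENNReal.ofReal t *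
          (2 * (ENNReal.ofReal c * ENNReal.ofReal t) + 1)⁻¹) := by gcongr
      _ = 2⁻¹ * ((2 * (ENNReal.ofReal c * ENNReal.ofReal t)) *
          (2 * (ENNReal.ofReal c * ENNReal.ofReal t) + 1)⁻¹) := by
          rw [← mul_assoc 2⁻¹, ← mul_assoc 2⁻¹, ENNReal.inv_mul_cancel two_ne_zero
            ENNReal.ofNat_ne_top, one_mul, mul_assoc]
      _ ≤ 2⁻¹ * 1 := by
          gcongr
          rw [← div_eq_mul_inv]
          exact ENNReal.div_le_of_le_mul (by rw [one_mul]; exact le_self_add)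
      _ = 2⁻¹ := mul_one _
  -- Each step of length `δ` costs a factor `2`: the weight accumulated so far is measurable with
  -- respect to the past.
  have hiter : ∀ n : ℕ, ∫⁻ ω, ENNReal.ofReal (Real.exp (c *
      (∫⁻ r in Ioc 0 (min (n * δ) t), energyRate β₀ γ (fun s => X s ω) r).toReal)) ∂P' ≤
        2 ^ n := by
    intro n
    induction n with
    | zero => simp [ht]
    | succ n ih =>
      have hu : 0 ≤ min (n * δ) t := le_min (by positivity) ht
      have huv : min (n * δ) t ≤ min ((n + 1 : ℕ) * δ) t :=
        min_le_min_right _ (by push_cast; nlinarith)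
      have hd : min ((n + 1 : ℕ) * δ) t - min (n * δ) t ≤ δ := by
        push_cast
        rcases le_total (n * δ) t with h | h
        · rw [min_eq_left h]
          linarith [min_le_left ((n + 1 : ℝ) * δ) t]
        · rw [min_eq_right h]
          linarith [min_le_right ((n + 1 : ℝ) * δ) t]
      set u := min (n * δ) t
      set v := min ((n + 1 : ℕ) * δ) t
      have hZ : Measurable[pastSigma X u.toNNReal] fun ω => ENNReal.ofReal (Real.exp (c *
          (∫⁻ r in Ioc 0 u, energyRate β₀ γ (fun s => X s ω) r).toReal)) := by
        have h := measurable_setLIntegral_energyRate_past (β₀ := β₀) hγ.measurable hc hu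
        exact ENNReal.measurable_ofReal.comp
          (Real.measurable_exp.comp ((ENNReal.measurable_toReal.comp h).const_mul c))
      calc ∫⁻ ω, ENNReal.ofReal (Real.exp (c *
            (∫⁻ r in Ioc 0 v, energyRate β₀ γ (fun s => X s ω) r).toReal)) ∂P'
          ≤ ∫⁻ ω, ENNReal.ofReal (Real.exp (c *
              (∫⁻ r in Ioc 0 u, energyRate β₀ γ (fun s => X s ω) r).toReal)) *
            ENNReal.ofReal (Real.exp (c *
              (∫⁻ r in Ioc u v, energyRate β₀ γ (fun s => X s ω) r).toReal)) ∂P' := by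
            refine lintegral_mono fun ω => ?_
            rw [← ENNReal.ofReal_mul (Real.exp_pos _).le, ← Real.exp_add, ← mul_add,
              ← Ioc_union_Ioc_eq_Ioc hu huv,
              lintegral_union measurableSet_Ioc (Ioc_disjoint_Ioc_of_le le_rfl)]
            gcongr
            exact ENNReal.toReal_add_le
        _ ≤ 2 * ∫⁻ ω, ENNReal.ofReal (Real.exp (c *
              (∫⁻ r in Ioc 0 u, energyRate β₀ γ (fun s => X s ω) r).toReal)) ∂P' :=
            hX.lintegral_mul_exp_energyRate_le hc hγ hβ₀ hint hc0 hu
              (hstep u v (min_le_right _ _) hd) hZ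
        _ ≤ 2 * 2 ^ n := by gcongr
        _ = 2 ^ (n + 1) := (pow_succ' _ _).symm
  obtain ⟨n, hn⟩ := exists_nat_ge (t / δ)
  have := hiter n
  rw [min_eq_right ((div_le_iff₀ hδ0).1 hn)] at this
  exact this.trans_lt (by finiteness)

/-- All exponential moments of the energy of the Lévy path are finite. -/
theorem IsSymmetricLevyProcess.lintegral_exp_mutualEnergy_lt_top
    (hX : IsSymmetricLevyProcess X Ψ P') (hc : ∀ ω, IsCadlagPath fun s => X s ω)
    (hγ : IsSpatialCovariance γ γhat) (hβ₀ : 0 < β₀) (hβ₁ : β₀ < 1)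
    (hI : SpectralCondition β₀ Ψ (spectralMeasure γhat)) {c : ℝ} (hc0 : 0 ≤ c) (t : ℝ≥0) :
    ∫⁻ ω, ENNReal.ofReal (Real.exp (c *
      (mutualEnergy β₀ γ t (fun s => X s ω) (fun s => X s ω)).toReal)) ∂P' < ∞ := by
  have hint := fun (v : ℝ) (hv : 0 < v) => hX.integrable_exp hβ₀ hβ₁ hI hv
  have hXm := measurable_uncurry_real_of_cadlag hX.measurable hc
  have hR : Measurable fun q : ℝ × Ω' => energyRate β₀ γ (fun s => X s q.2) q.1 :=
    measurable_energyRate hγ.measurable hXm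
  have hA : Measurable fun ω => ∫⁻ r in Ioc (0 : ℝ) t, energyRate β₀ γ (fun s => X s ω) r :=
    hR.lintegral_prod_left'
  have hk := setLIntegral_energyKernel_lt_top hβ₀ hβ₁ hX.measurable_exponent
    hX.exponent_nonneg hI t.coe_nonneg
  -- Needed because `toReal` sends `∞` to `0`.
  have hfin : ∀ᵐ ω ∂P', ∫⁻ r in Ioc (0 : ℝ) t, energyRate β₀ γ (fun s => X s ω) r < ∞ := by
    refine ae_lt_top hA ?_
    have h := hX.lintegral_mul_energyRate_le hc hγ hβ₀ hint (u := 0) (v := t) le_rfl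
      (Z := fun _ => 1) measurable_const
    simp only [one_mul, lintegral_const, measure_univ, mul_one, sub_zero] at h
    rw [lintegral_lintegral_swap (f := fun ω r => energyRate β₀ γ (fun s => X s ω) r)
      (hR.comp measurable_swap).aemeasurable]
    exact (h.trans_lt (ENNReal.mul_lt_top ENNReal.ofReal_lt_top hk)).ne
  refine lt_of_le_of_lt (lintegral_mono_ae ?_)
    (hX.lintegral_exp_energyRate_lt_top hc hγ hβ₀ hβ₁ hI (c := c * 2) (by positivity) t.coe_nonneg)
  filter_upwards [hfin] with ω hω
  have hm : Measurable fun s : ℝ => X s.toNNReal ω :=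
    hXm.comp (measurable_prodMk_right : Measurable fun s : ℝ => (s, ω))
  rw [mul_assoc]
  gcongr
  have := ENNReal.toReal_mono (by finiteness)
    (mutualEnergy_self_le (β₀ := β₀) hγ.measurable hγ.symmetric hm t)
  simpa using this

end ExponentialMoments

/-! ### Moments of the Feynman–Kac functional -/

section Assembly

/-- Two distinct coordinates of a power of a probability space are independent. -/
theorem measurePreserving_pi_pair {Ω' : Type*} [MeasurableSpace Ω'] (P' : Measure Ω')
    [IsProbabilityMeasure P'] {p : ℕ} {j k : Fin p} (hjk : j ≠ k) :
    MeasurePreserving (fun θ : Fin p → Ω' => (θ j, θ k)) (Measure.pi fun _ => P')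
      (P'.prod P') := by
  have h : IndepFun (Function.eval j) (Function.eval k) (Measure.pi fun _ : Fin p => P') :=
    (iIndepFun_pi (μ := fun _ : Fin p => P') (X := fun _ => (id : Ω' → Ω'))
      fun _ => aemeasurable_id).indepFun hjk
  have hj := measurePreserving_eval (fun _ : Fin p => P') j
  have hk := measurePreserving_eval (fun _ : Fin p => P') k
  rw [indepFun_iff_map_prod_eq_prod_map_map hj.measurable.aemeasurable
    hk.measurable.aemeasurable, hj.map_eq, hk.map_eq] at h
  exact ⟨hj.measurable.prodMk hk.measurable, h⟩

variable {d : ℕ} {Ω Ω' : Type*} [MeasurableSpace Ω] [MeasurableSpace Ω'] {P : Measure Ω}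
  [IsProbabilityMeasure P] {P' : Measure Ω'} [IsProbabilityMeasure P'] {β₀ : ℝ}
  {γ : Space d → ℝ≥0∞} {γhat : Space d → ℝ} {W : (ℝ × Space d → ℝ) → Ω → ℝ}
  {X : ℝ≥0 → Ω' → Space d} {Ψ : Space d → ℝ} {ρ : Space d → ℝ} {t : ℝ≥0} {x : Space d}
  {V : Ω × Ω' → ℝ} {u₀ : Space d →ᵇ ℝ}

/-- The sum of the mutual energies of all pairs among finitely many paths. -/
noncomputable def totalEnergy {p : ℕ} (β₀ : ℝ) (γ : Space d → ℝ≥0∞) (t : ℝ≥0)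
    (f : Fin p → ℝ≥0 → Space d) : ℝ :=
  ∑ j, ∑ k, (mutualEnergy β₀ γ t (f j) (f k)).toReal

theorem totalEnergy_nonneg {p : ℕ} (f : Fin p → ℝ≥0 → Space d) : 0 ≤ totalEnergy β₀ γ t f :=
  Finset.sum_nonneg fun _ _ => Finset.sum_nonneg fun _ _ => ENNReal.toReal_nonneg

/-- Given almost every family of paths, the stochastic integrals along them are jointly Gaussian
with the mutual energies as covariances. -/
theorem IsDeltaIntegral.ae_map_sum_eq_gaussianReal (hV : IsDeltaIntegral β₀ γ W P X P' ρ t x V)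
    (hW : IsNoise β₀ γ W P) (hγ : IsSpatialCovariance γ γhat) (hβ₀ : 0 < β₀) (hβ₁ : β₀ < 1)
    (hρ : IsMollifier ρ) (hX : IsSymmetricLevyProcess X Ψ P')
    (hc : ∀ ω, IsCadlagPath fun s => X s ω) (hI : SpectralCondition β₀ Ψ (spectralMeasure γhat))
    (p : ℕ) :
    ∀ᵐ θ ∂(Measure.pi fun _ : Fin p => P'),
      (∀ j k, mutualEnergy β₀ γ t (fun s => X s (θ j)) (fun s => X s (θ k)) < ∞) ∧
      AEMeasurable (fun ω => ∑ j, V (ω, θ j)) P ∧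
      P.map (fun ω => ∑ j, V (ω, θ j)) =
        gaussianReal 0 (totalEnergy β₀ γ t fun j s => X s (θ j)).toNNReal := by
  have h0 := hX.exponent_nonneg
  have hint : ∀ v : ℝ, 0 < v → Integrable (fun ξ => Real.exp (-(v * Ψ ξ)))
    (spectralMeasure γhat) := fun v hv => hX.integrable_exp hβ₀ hβ₁ hI hv
  have hfin : ∫⁻ p, energyKernel β₀ γhat Ψ (p.1 - p.2) ∂(timeSquare t) < ∞ :=
    lintegral_timeSquare_sub_lt_top (measurable_energyKernel hX.measurable_exponent)
      energyKernel_neg (setLIntegral_energyKernel_lt_top hβ₀ hβ₁ hX.measurable_exponent h0 hI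
        t.coe_nonneg)
  obtain ⟨e, he0, he, hae⟩ := hV.exists_isPathIntegral
  have hself := IsPotentialPair.ae_covariance_eq hW hγ hβ₀ hβ₁ hρ he0 he
    (hX.isPotentialPair_same hc hγ hint) h0 hint hfin hc hc hae hae
  have hcross := IsPotentialPair.ae_covariance_eq hW hγ hβ₀ hβ₁ hρ he0 he
    (hX.isPotentialPair_indep hc hγ hint) h0 hint hfin (fun θ => hc θ.1) (fun θ => hc θ.2)
    (Measure.quasiMeasurePreserving_fst.ae hae) (Measure.quasiMeasurePreserving_snd.ae hae)
  have h1 : ∀ᵐ θ ∂(Measure.pi fun _ : Fin p => P'), ∀ j,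
      IsPathIntegral W P ρ t x e (fun s => X s (θ j)) fun ω => V (ω, θ j) :=
    ae_all_iff.2 fun j =>
      (measurePreserving_eval (fun _ : Fin p => P') j).quasiMeasurePreserving.ae hae
  -- Diagonal terms involve one path, off-diagonal terms two independent ones.
  have h2 : ∀ᵐ θ ∂(Measure.pi fun _ : Fin p => P'), ∀ j k,
      mutualEnergy β₀ γ t (fun s => X s (θ j)) (fun s => X s (θ k)) < ∞ ∧
        ∫ ω, V (ω, θ j) * V (ω, θ k) ∂P =
          (mutualEnergy β₀ γ t (fun s => X s (θ j)) (fun s => X s (θ k))).toReal := by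
    refine ae_all_iff.2 fun j => ae_all_iff.2 fun k => ?_
    rcases eq_or_ne j k with rfl | hjk
    · exact (measurePreserving_eval (fun _ : Fin p => P') j).quasiMeasurePreserving.ae hself
    · exact (measurePreserving_pi_pair P' hjk).quasiMeasurePreserving.ae hcross
  filter_upwards [h1, h2] with θ hθ1 hθ2
  refine ⟨fun j k => (hθ2 j k).1, ?_, ?_⟩
  · exact Finset.aemeasurable_fun_sum _ fun j _ => (hθ1 j).memLp.1.aemeasurable
  · rw [IsPathIntegral.map_sum_eq_gaussianReal hW hγ hβ₁ hρ he0 (fun j => hc (θ j)) hθ1,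
      totalEnergy]
    simp only [(hθ2 _ _).2]

/-- The stochastic integral has exponential moments of all orders. -/
theorem IsDeltaIntegral.integrable_exp (hV : IsDeltaIntegral β₀ γ W P X P' ρ t x V)
    (hW : IsNoise β₀ γ W P) (hγ : IsSpatialCovariance γ γhat) (hβ₀ : 0 < β₀) (hβ₁ : β₀ < 1)
    (hρ : IsMollifier ρ) (hX : IsSymmetricLevyProcess X Ψ P')
    (hc : ∀ ω, IsCadlagPath fun s => X s ω) (hI : SpectralCondition β₀ Ψ (spectralMeasure γhat))
    (q : ℝ) : Integrable (fun z => Real.exp (q * V z)) (P.prod P') := by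
  have hm : AEStronglyMeasurable (fun z => Real.exp (q * V z)) (P.prod P') :=
    Real.continuous_exp.comp_aestronglyMeasurable (hV.1.1.const_mul q)
  refine ⟨hm, ?_⟩
  rw [hasFiniteIntegral_iff_enorm, lintegral_prod_symm _ hm.enorm]
  refine lt_of_eq_of_lt ?_ (hX.lintegral_exp_mutualEnergy_lt_top hc hγ hβ₀ hβ₁ hI
    (c := q ^ 2 / 2) (by positivity) t)
  -- The law of a single slice is the case of one path.
  have h := hV.ae_map_sum_eq_gaussianReal hW hγ hβ₀ hβ₁ hρ hX hc hI 1
  have hmp := measurePreserving_funUnique P' (Fin 1)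
  have h' := (hmp.symm _).quasiMeasurePreserving.ae h
  refine lintegral_congr_ae ?_
  filter_upwards [h'] with ω' hω'
  obtain ⟨-, h1, h2⟩ := hω'
  simp only [Finset.univ_unique, Finset.sum_singleton, totalEnergy] at h1 h2
  change AEMeasurable (fun ω => V (ω, ω')) P at h1
  change P.map (fun ω => V (ω, ω')) =
    gaussianReal 0 (mutualEnergy β₀ γ t (fun s => X s ω') fun s => X s ω').toReal.toNNReal at h2
  obtain ⟨h3, h4⟩ := integral_exp_of_map_eq_gaussianReal h1 h2 q
  change ∫⁻ ω, ‖Real.exp (q * V (ω, ω'))‖ₑ ∂P = _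
  simp only [Real.enorm_eq_ofReal (Real.exp_pos _).le]
  rw [← ofReal_integral_eq_lintegral_ofReal h3 (Eventually.of_forall fun _ => (Real.exp_pos _).le)]
  refine congrArg ENNReal.ofReal (h4.trans ?_)
  rw [Real.coe_toNNReal _ ENNReal.toReal_nonneg]
  congr 1
  ring

/-- The random variable `u₀(X_t + x) exp V` on `Ω × Ω'`. -/
noncomputable def feynmanKacIntegrand (X : ℝ≥0 → Ω' → Space d) (u₀ : Space d →ᵇ ℝ) (t : ℝ≥0)
    (x : Space d) (V : Ω × Ω' → ℝ) (z : Ω × Ω') : ℝ :=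
  u₀ (X t z.2 + x) * Real.exp (V z)

omit [IsProbabilityMeasure P] [IsProbabilityMeasure P'] in
theorem memLp_feynmanKacIntegrand (hV : AEStronglyMeasurable V (P.prod P'))
    (hexp : ∀ q : ℝ, Integrable (fun z => Real.exp (q * V z)) (P.prod P'))
    (hX : Measurable (X t)) {n : ℕ} (hn : n ≠ 0) :
    MemLp (feynmanKacIntegrand X u₀ t x V) n (P.prod P') := by
  have hm : AEStronglyMeasurable (fun z => Real.exp (V z)) (P.prod P') :=
    Real.continuous_exp.comp_aestronglyMeasurable hV
  have h1 : MemLp (fun z => Real.exp (V z)) n (P.prod P') := by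
    refine (integrable_norm_rpow_iff hm (by exact_mod_cast hn) (ENNReal.natCast_ne_top n)).1 ?_
    refine (hexp n).congr (Eventually.of_forall fun z => ?_)
    simp only [Real.norm_eq_abs, Real.abs_exp, ENNReal.toReal_natCast]
    rw [← Real.exp_mul, mul_comm]
  have h2 : Measurable fun z : Ω × Ω' => u₀ (X t z.2 + x) :=
    u₀.continuous.measurable.comp ((hX.comp measurable_snd).add_const x)
  refine h1.of_le_mul (c := ‖u₀‖) (h2.aestronglyMeasurable.mul hm)
    (Eventually.of_forall fun z => ?_)
  rw [feynmanKacIntegrand, norm_mul]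
  gcongr
  exact u₀.norm_coe_le_norm _

omit [IsProbabilityMeasure P] in
/-- Averaging over the second factor of a product of probability spaces does not increase
`Lⁿ` norms. -/
theorem memLp_integral_prod_right {f : Ω × Ω' → ℝ} {n : ℕ} (hn : n ≠ 0)
    (hf : MemLp f n (P.prod P')) : MemLp (fun ω => ∫ ω', f (ω, ω') ∂P') n P := by
  have hn1 : (1 : ℝ≥0∞) ≤ n := by exact_mod_cast Nat.one_le_iff_ne_zero.2 hn
  have hn0 : (n : ℝ≥0∞) ≠ 0 := by exact_mod_cast hn
  refine ⟨hf.1.integral_prod_right', ?_⟩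
  have h := hf.2
  rw [eLpNorm_lt_top_iff_lintegral_rpow_enorm_lt_top hn0 (ENNReal.natCast_ne_top n)] at h ⊢
  simp only [ENNReal.toReal_natCast, ENNReal.rpow_natCast] at h ⊢
  rw [lintegral_prod _ (hf.1.enorm.pow_const n)] at h
  refine lt_of_le_of_lt (lintegral_mono_ae ?_) h
  filter_upwards [hf.1.prodMk_left] with ω hω
  calc ‖∫ ω', f (ω, ω') ∂P'‖ₑ ^ n ≤ (∫⁻ ω', ‖f (ω, ω')‖ₑ ∂P') ^ n := by
        gcongr
        exact enorm_integral_le_lintegral_enorm _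
    _ ≤ (eLpNorm (fun ω' => f (ω, ω')) n P') ^ n := by
        gcongr
        rw [← eLpNorm_one_eq_lintegral_enorm]
        exact eLpNorm_le_eLpNorm_of_exponent_le hn1 hω
    _ = ∫⁻ ω', ‖f (ω, ω')‖ₑ ^ n ∂P' := by
        rw [eLpNorm_eq_lintegral_rpow_enorm_toReal hn0 (ENNReal.natCast_ne_top n),
          ← ENNReal.rpow_natCast, ← ENNReal.rpow_mul]
        simp [hn]

theorem memLp_feynmanKac (hV : AEStronglyMeasurable V (P.prod P'))
    (hexp : ∀ q : ℝ, Integrable (fun z => Real.exp (q * V z)) (P.prod P'))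
    (hX : Measurable (X t)) {q : ℝ≥0∞} (hq : q ≠ ∞) : MemLp (feynmanKac X P' u₀ t x V) q P := by
  obtain ⟨n, hn⟩ := ENNReal.exists_nat_gt hq
  exact (memLp_integral_prod_right n.succ_ne_zero
    (memLp_feynmanKacIntegrand (u₀ := u₀) (x := x) hV hexp hX n.succ_ne_zero)).mono_exponent
      (hn.le.trans (by exact_mod_cast n.le_succ))

/-- `E[u(t,x)^p]` as an expectation over `p` independent copies of the Lévy process, realized on
the `p`-fold power of its probability space. -/
theorem IsDeltaIntegral.integral_feynmanKac_pow (hV : IsDeltaIntegral β₀ γ W P X P' ρ t x V)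
    (hW : IsNoise β₀ γ W P) (hγ : IsSpatialCovariance γ γhat) (hβ₀ : 0 < β₀) (hβ₁ : β₀ < 1)
    (hρ : IsMollifier ρ) (hX : IsSymmetricLevyProcess X Ψ P')
    (hc : ∀ ω, IsCadlagPath fun s => X s ω) (hI : SpectralCondition β₀ Ψ (spectralMeasure γhat))
    {p : ℕ} (hp : p ≠ 0) :
    Integrable (fun θ : Fin p → Ω' => (∏ j, u₀ (X t (θ j) + x)) *
      Real.exp ((1 / 2) * totalEnergy β₀ γ t fun j s => X s (θ j))) (Measure.pi fun _ => P') ∧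
    ∫ ω, feynmanKac X P' u₀ t x V ω ^ p ∂P =
      ∫ θ : Fin p → Ω', (∏ j, u₀ (X t (θ j) + x)) *
        Real.exp ((1 / 2) * totalEnergy β₀ γ t fun j s => X s (θ j)) ∂(Measure.pi fun _ => P') := by
  let m : Measure (Fin p → Ω') := Measure.pi fun _ => P'
  let f : Ω × Ω' → ℝ := feynmanKacIntegrand X u₀ t x V
  have hf : MemLp f p (P.prod P') := memLp_feynmanKacIntegrand hV.1.1
    (hV.integrable_exp hW hγ hβ₀ hβ₁ hρ hX hc hI) (hX.measurable t) hp
  -- By Hölder's inequality, as each of the `p` factors is in `L^p`.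
  have hint : Integrable (fun z : Ω × (Fin p → Ω') => ∏ j, f (z.1, z.2 j)) (P.prod m) := by
    have hj : ∀ j ∈ (Finset.univ : Finset (Fin p)),
        MemLp (fun z : Ω × (Fin p → Ω') => f (z.1, z.2 j)) p (P.prod m) := fun j _ =>
      hf.comp_measurePreserving
        ((MeasurePreserving.id P).prod (measurePreserving_eval (fun _ : Fin p => P') j))
    have h := MemLp.prod' hj
    rw [Finset.sum_const, Finset.card_univ, Fintype.card_fin, nsmul_eq_mul,
      ENNReal.mul_inv_cancel (by exact_mod_cast hp) (ENNReal.natCast_ne_top p), inv_one] at h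
    exact memLp_one_iff_integrable.1 h
  have hslice : ∀ᵐ θ ∂m, ∫ ω, ∏ j, f (ω, θ j) ∂P = (∏ j, u₀ (X t (θ j) + x)) *
      Real.exp ((1 / 2) * totalEnergy β₀ γ t fun j s => X s (θ j)) := by
    filter_upwards [hV.ae_map_sum_eq_gaussianReal hW hγ hβ₀ hβ₁ hρ hX hc hI p] with θ hθ
    have h := (integral_exp_of_map_eq_gaussianReal hθ.2.1 hθ.2.2 1).2
    simp only [f, feynmanKacIntegrand, Finset.prod_mul_distrib, ← Real.exp_sum]
    rw [integral_const_mul]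
    simp only [one_mul] at h
    rw [h, Real.coe_toNNReal _ (totalEnergy_nonneg _)]
    congr 2
    ring
  refine ⟨hint.integral_prod_right.congr hslice, ?_⟩
  calc ∫ ω, feynmanKac X P' u₀ t x V ω ^ p ∂P
      = ∫ ω, (∫ θ : Fin p → Ω', ∏ j, f (ω, θ j) ∂m) ∂P := by
        refine integral_congr_ae (Eventually.of_forall fun ω => ?_)
        have h := integral_fintype_prod_eq_pow (ι := Fin p) (μ := P') fun ω' => f (ω, ω')
        rw [Fintype.card_fin] at h
        exact h.symm
    _ = ∫ θ : Fin p → Ω', (∫ ω, ∏ j, f (ω, θ j) ∂P) ∂m := integral_integral_swap hint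
    _ = _ := integral_congr_ae hslice

end Assembly

/-! ### Passage to arbitrary independent copies -/

section PathSpace

variable {d : ℕ}

/-- The right-continuous regularization of a path, a measurable function of the path (for the
product `σ`-algebra) which fixes the càdlàg paths. -/
noncomputable def pathRegularization (f : ℝ≥0 → Space d) (s : ℝ≥0) : Space d :=
  limUnder atTop fun n => f (gridTime n s)

theorem IsCadlagPath.pathRegularization_eq {f : ℝ≥0 → Space d} (hf : IsCadlagPath f) :
    pathRegularization f = f :=
  funext fun s => (hf.tendsto_gridTime s).limUnder_eq

theorem measurable_pathRegularization :
    Measurable fun q : ℝ × (ℝ≥0 → Space d) => pathRegularization q.2 q.1.toNNReal := by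
  have h1 : ∀ n, StronglyMeasurable fun q : ℝ≥0 × (ℝ≥0 → Space d) => q.2 (gridTime n q.1) :=
    fun n => (measurable_comp_gridTime (X := fun s (f : ℝ≥0 → Space d) => f s)
      (fun s => measurable_pi_apply s) n).stronglyMeasurable
  have h2 : Measurable fun q : ℝ≥0 × (ℝ≥0 → Space d) => pathRegularization q.2 q.1 :=
    (StronglyMeasurable.limUnder (l := atTop) h1).measurable
  exact h2.comp ((measurable_real_toNNReal.comp measurable_fst).prodMk measurable_snd)

variable {β₀ : ℝ} {γ : Space d → ℝ≥0∞} {t : ℝ≥0} {p : ℕ}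

theorem measurable_mutualEnergy_pathRegularization (hγ : Measurable γ) (j k : Fin p) :
    Measurable fun y : Fin p → ℝ≥0 → Space d =>
      mutualEnergy β₀ γ t (pathRegularization (y j)) (pathRegularization (y k)) := by
  let A : Fin p → ℝ≥0 → (Fin p → ℝ≥0 → Space d) → Space d :=
    fun j s y => pathRegularization (y j) s
  have h : ∀ j, Measurable fun q : ℝ × (Fin p → ℝ≥0 → Space d) => A j q.1.toNNReal q.2 :=
    fun j => by
      have h1 : Measurable fun q : ℝ × (Fin p → ℝ≥0 → Space d) => (q.1, q.2 j) :=
        measurable_fst.prodMk ((measurable_pi_apply j).comp measurable_snd)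
      have h2 := measurable_pathRegularization.comp h1
      simp only [Function.comp_def] at h2
      exact h2
  exact measurable_mutualEnergy (A := A j) (B := A k) hγ (h j) (h k)

/-- The weight in the moment formula, as a measurable function of the paths. -/
noncomputable def momentWeight (β₀ : ℝ) (γ : Space d → ℝ≥0∞) (u₀ : Space d →ᵇ ℝ) (t : ℝ≥0)
    (x : Space d) (y : Fin p → ℝ≥0 → Space d) : ℝ :=
  (∏ j, u₀ (y j t + x)) *
    Real.exp ((1 / 2) * totalEnergy β₀ γ t fun j => pathRegularization (y j))

theorem measurable_momentWeight (hγ : Measurable γ) (u₀ : Space d →ᵇ ℝ) (x : Space d) :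
    Measurable (momentWeight (p := p) β₀ γ u₀ t x) := by
  have h1 : Measurable fun y : Fin p → ℝ≥0 → Space d => ∏ j, u₀ (y j t + x) := by
    refine Finset.measurable_fun_prod _ fun j _ => ?_
    have h : Measurable fun y : Fin p → ℝ≥0 → Space d => y j t :=
      (measurable_pi_apply t).comp (measurable_pi_apply j)
    exact u₀.continuous.measurable.comp (h.add_const x)
  have h2 : Measurable fun y : Fin p → ℝ≥0 → Space d =>
      totalEnergy β₀ γ t fun j => pathRegularization (y j) :=
    Finset.measurable_fun_sum _ fun j _ => Finset.measurable_fun_sum _ fun k _ =>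
      (measurable_mutualEnergy_pathRegularization hγ j k).ennreal_toReal
  exact h1.mul (Real.measurable_exp.comp (h2.const_mul _))

/-- The joint law, on path space, of independent copies of `X` is that of `X` along the coordinates
of `Ω'^p`. -/
theorem AreIndependentCopies.map_eq {Ω Ω' : Type*} [MeasurableSpace Ω] [MeasurableSpace Ω']
    {Y : Fin p → ℝ≥0 → Ω' → Space d} {Q : Measure Ω'} [IsProbabilityMeasure Q]
    {X : ℝ≥0 → Ω → Space d} {P : Measure Ω} [IsProbabilityMeasure P]
    (hY : AreIndependentCopies Y Q X P) (hX : ∀ s, Measurable (X s)) :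
    Q.map (fun ω j s => Y j s ω) = (Measure.pi fun _ : Fin p => P).map fun θ j s => X s (θ j) := by
  have hm : ∀ j, AEMeasurable (fun ω s => Y j s ω) Q := fun j =>
    (measurable_pi_lambda _ fun s => (hY.levy j).measurable s).aemeasurable
  have hXm : AEMeasurable (fun ω s => X s ω) P := (measurable_pi_lambda _ hX).aemeasurable
  rw [(iIndepFun_iff_map_fun_eq_pi_map hm).1 hY.indep]
  simp only [hY.law]
  rw [Measure.pi_map_pi (f := fun _ ω s => X s ω) fun _ => hXm]

/-- On càdlàg paths, `pathRegularization` may be dropped. -/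
theorem momentWeight_eq {y : Fin p → ℝ≥0 → Space d} (hy : ∀ j, IsCadlagPath (y j))
    (u₀ : Space d →ᵇ ℝ) (x : Space d) :
    momentWeight β₀ γ u₀ t x y =
      (∏ j, u₀ (y j t + x)) * Real.exp ((1 / 2) * totalEnergy β₀ γ t y) := by
  have : (fun j => pathRegularization (y j)) = y := funext fun j => (hy j).pathRegularization_eq
  rw [momentWeight, this]

end PathSpace

/-! ### Modification with càdlàg paths -/

section Modification

variable {d : ℕ} {Ω' : Type*} [MeasurableSpace Ω'] {P' : Measure Ω'}
  {X X₁ : ℝ≥0 → Ω' → Space d} {Ψ : Space d → ℝ}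

/-- A Lévy process agrees, off a null event, with a process all of whose paths are càdlàg. -/
theorem IsLevyProcess.exists_cadlag (hX : IsLevyProcess X P') :
    ∃ X₁ : ℝ≥0 → Ω' → Space d, (∀ t, Measurable (X₁ t)) ∧ (∀ ω, IsCadlagPath fun s => X₁ s ω) ∧
      ∀ᵐ ω ∂P', ∀ s, X₁ s ω = X s ω := by
  classical
  obtain ⟨N, hN, hNm, hN0⟩ := exists_measurable_superset_of_null (ae_iff.1 hX.cadlag)
  refine ⟨fun s ω => if ω ∈ N then 0 else X s ω,
    fun s => Measurable.ite hNm measurable_const (hX.measurable s), fun ω => ?_, ?_⟩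
  · by_cases h : ω ∈ N
    · simp only [h, if_true]
      exact fun s => ⟨continuousWithinAt_const, 0, tendsto_const_nhds⟩
    · simp only [h, if_false]
      by_contra hc
      exact h (hN hc)
  · filter_upwards [measure_eq_zero_iff_ae_notMem.1 hN0] with ω hω s
    rw [if_neg hω]

theorem IsSymmetricLevyProcess.congr (hX : IsSymmetricLevyProcess X Ψ P')
    (hm : ∀ t, Measurable (X₁ t)) (hc : ∀ ω, IsCadlagPath fun s => X₁ s ω)
    (h : ∀ᵐ ω ∂P', ∀ s, X₁ s ω = X s ω) : IsSymmetricLevyProcess X₁ Ψ P' := by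
  have hs : ∀ s, X s =ᵐ[P'] X₁ s := fun s => h.mono fun ω hω => (hω s).symm
  have hlaw : ∀ s, P'.map (X₁ s) = P'.map (X s) := fun s => Measure.map_congr (hs s).symm
  have hid : ∀ s, IdentDistrib (X s) (X₁ s) P' P' := fun s =>
    IdentDistrib.of_ae_eq (hX.measurable s).aemeasurable (hs s)
  exact
    { measurable := hm
      start := by
        filter_upwards [hX.start, h] with ω h1 h2
        rw [h2, h1]
      indep := by
        intro n τ hτ
        refine (hX.indep n τ hτ).congr fun i => ?_
        filter_upwards [h] with ω hω
        simp [hω]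
      stationary := fun s r => by
        refine IdentDistrib.trans (IdentDistrib.of_ae_eq ((hm _).sub (hm _)).aemeasurable ?_)
          ((hX.stationary s r).trans (hid r))
        filter_upwards [h] with ω hω
        simp [hω]
      cadlag := Eventually.of_forall hc
      symmetric := fun s => by
        refine IdentDistrib.trans (IdentDistrib.of_ae_eq (hm s).neg.aemeasurable ?_)
          ((hX.symmetric s).trans (hid s))
        filter_upwards [h] with ω hω
        simp [hω]
      density := fun s hs => by rw [hlaw]; exact hX.density s hs
      exponent := fun s ξ => by rw [hlaw]; exact hX.exponent s ξ }

theorem IsDeltaIntegral.congr {Ω : Type*} [MeasurableSpace Ω] {P : Measure Ω} {β₀ : ℝ}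
    {γ : Space d → ℝ≥0∞} {W : (ℝ × Space d → ℝ) → Ω → ℝ} {ρ : Space d → ℝ} {t : ℝ≥0} {x : Space d}
    {V : Ω × Ω' → ℝ} (hV : IsDeltaIntegral β₀ γ W P X P' ρ t x V)
    (h : ∀ᵐ ω ∂P', ∀ s, X₁ s ω = X s ω) : IsDeltaIntegral β₀ γ W P X₁ P' ρ t x V := by
  obtain ⟨hV2, F, hF, hlim⟩ := hV
  have he : ∀ᵐ ω ∂P', (fun s => X₁ s ω) = fun s => X s ω := h.mono fun ω hω => funext hω
  refine ⟨hV2, F, fun ε δ hε hδ => ⟨⟨(hF ε δ hε hδ).1.measurable, ?_, ?_⟩, (hF ε δ hε hδ).2⟩, hlim⟩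
  · filter_upwards [(hF ε δ hε hδ).1.domain, he] with ω h1 h2
    rw [h2]
    exact h1
  · filter_upwards [(hF ε δ hε hδ).1.eq, he] with ω h1 h2
    rw [h2]
    exact h1

end Modification

/-! ### The moment formula for arbitrary copies -/

section Copies

variable {d p : ℕ} {Ω' Ω'' : Type*} [MeasurableSpace Ω'] [MeasurableSpace Ω''] {P' : Measure Ω'}
  [IsProbabilityMeasure P'] {Q : Measure Ω''} [IsProbabilityMeasure Q] {β₀ : ℝ}
  {γ : Space d → ℝ≥0∞} {X : ℝ≥0 → Ω' → Space d} {Y : Fin p → ℝ≥0 → Ω'' → Space d} {t : ℝ≥0}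

/-- Finiteness of the mutual energies depends on the joint law of the paths only. -/
theorem AreIndependentCopies.ae_mutualEnergy_lt_top (hY : AreIndependentCopies Y Q X P')
    (hX : ∀ s, Measurable (X s)) (hc : ∀ ω, IsCadlagPath fun s => X s ω) (hγ : Measurable γ)
    (h : ∀ᵐ θ ∂(Measure.pi fun _ : Fin p => P'), ∀ j k,
      mutualEnergy β₀ γ t (fun s => X s (θ j)) (fun s => X s (θ k)) < ∞) :
    ∀ᵐ ω ∂Q, ∀ j k, mutualEnergy β₀ γ t (fun s => Y j s ω) (fun s => Y k s ω) < ∞ := by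
  let S : Set (Fin p → ℝ≥0 → Space d) := {y | ∀ j k,
    mutualEnergy β₀ γ t (pathRegularization (y j)) (pathRegularization (y k)) < ∞}
  have hS : MeasurableSet S := by
    simp only [S, ofPred_forall]
    exact MeasurableSet.iInter fun j => MeasurableSet.iInter fun k =>
      measurableSet_lt (measurable_mutualEnergy_pathRegularization hγ j k) measurable_const
  have hXm : Measurable fun (θ : Fin p → Ω') j s => X s (θ j) := measurable_pi_lambda _ fun j =>
    measurable_pi_lambda _ fun s => (hX s).comp (measurable_pi_apply j)
  have hYm : Measurable fun ω j s => Y j s ω := measurable_pi_lambda _ fun j =>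
    measurable_pi_lambda _ fun s => (hY.levy j).measurable s
  have h1 : ∀ᵐ y ∂(Q.map fun ω j s => Y j s ω), y ∈ S := by
    rw [hY.map_eq hX]
    refine (ae_map_iff (p := (· ∈ S)) hXm.aemeasurable hS).2 ?_
    filter_upwards [h] with θ hθ j k
    rw [(hc (θ j)).pathRegularization_eq, (hc (θ k)).pathRegularization_eq]
    exact hθ j k
  filter_upwards [(ae_map_iff (p := (· ∈ S)) hYm.aemeasurable hS).1 h1,
    ae_all_iff.2 fun j => (hY.levy j).cadlag] with ω h2 h3 j k
  have h4 := h2 j k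
  rwa [(h3 j).pathRegularization_eq, (h3 k).pathRegularization_eq] at h4

/-- The expectation in the moment formula depends on the joint law of the paths only. -/
theorem AreIndependentCopies.integrable_and_integral_eq (hY : AreIndependentCopies Y Q X P')
    (hX : ∀ s, Measurable (X s)) (hc : ∀ ω, IsCadlagPath fun s => X s ω) (hγ : Measurable γ)
    {u₀ : Space d →ᵇ ℝ} {x : Space d}
    (h : Integrable (fun θ : Fin p → Ω' => (∏ j, u₀ (X t (θ j) + x)) *
      Real.exp ((1 / 2) * totalEnergy β₀ γ t fun j s => X s (θ j))) (Measure.pi fun _ => P')) :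
    Integrable (fun ω => (∏ j, u₀ (Y j t ω + x)) *
      Real.exp ((1 / 2) * totalEnergy β₀ γ t fun j s => Y j s ω)) Q ∧
    ∫ ω, (∏ j, u₀ (Y j t ω + x)) *
        Real.exp ((1 / 2) * totalEnergy β₀ γ t fun j s => Y j s ω) ∂Q =
      ∫ θ : Fin p → Ω', (∏ j, u₀ (X t (θ j) + x)) *
        Real.exp ((1 / 2) * totalEnergy β₀ γ t fun j s => X s (θ j)) ∂(Measure.pi fun _ => P') := by
  have hXm : Measurable fun (θ : Fin p → Ω') j s => X s (θ j) := measurable_pi_lambda _ fun j =>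
    measurable_pi_lambda _ fun s => (hX s).comp (measurable_pi_apply j)
  have hYm : Measurable fun ω j s => Y j s ω := measurable_pi_lambda _ fun j =>
    measurable_pi_lambda _ fun s => (hY.levy j).measurable s
  have hw := measurable_momentWeight (p := p) (β₀ := β₀) (t := t) hγ u₀ x
  have eX : ∀ θ : Fin p → Ω', momentWeight β₀ γ u₀ t x (fun j s => X s (θ j)) =
      (∏ j, u₀ (X t (θ j) + x)) *
        Real.exp ((1 / 2) * totalEnergy β₀ γ t fun j s => X s (θ j)) := fun θ =>
    momentWeight_eq (fun j => hc (θ j)) u₀ x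
  have eY : ∀ᵐ ω ∂Q, momentWeight β₀ γ u₀ t x (fun j s => Y j s ω) =
      (∏ j, u₀ (Y j t ω + x)) *
        Real.exp ((1 / 2) * totalEnergy β₀ γ t fun j s => Y j s ω) := by
    filter_upwards [ae_all_iff.2 fun j => (hY.levy j).cadlag] with ω hω
    exact momentWeight_eq hω u₀ x
  simp only [← eX] at h ⊢
  have h1 : Integrable (momentWeight β₀ γ u₀ t x) (Q.map fun ω j s => Y j s ω) := by
    rw [hY.map_eq hX]
    exact (integrable_map_measure hw.aestronglyMeasurable hXm.aemeasurable).2 h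
  refine ⟨((integrable_map_measure hw.aestronglyMeasurable hYm.aemeasurable).1 h1).congr eY, ?_⟩
  rw [← integral_congr_ae eY,
    ← integral_map hYm.aemeasurable (f := momentWeight β₀ γ u₀ t x) hw.aestronglyMeasurable,
    hY.map_eq hX, integral_map hXm.aemeasurable hw.aestronglyMeasurable]

end Copies

theorem theorem4p5 {d : ℕ} (hd : 0 < d)
    {Ω Ω' : Type*} [MeasurableSpace Ω] [MeasurableSpace Ω']
    (P : Measure Ω) [IsProbabilityMeasure P] (P' : Measure Ω') [IsProbabilityMeasure P']
    (β₀ : ℝ) (hβ₀ : 0 < β₀) (hβ₁ : β₀ < 1)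
    (γ : Space d → ℝ≥0∞) (γhat : Space d → ℝ) (hγ : IsSpatialCovariance γ γhat)
    (W : (ℝ × Space d → ℝ) → Ω → ℝ) (hW : IsNoise β₀ γ W P)
    (X : ℝ≥0 → Ω' → Space d) (Ψ : Space d → ℝ) (hX : IsSymmetricLevyProcess X Ψ P')
    (hI : SpectralCondition β₀ Ψ (spectralMeasure γhat))
    (ρ : Space d → ℝ) (hρ : IsMollifier ρ)
    (u₀ : Space d →ᵇ ℝ) (t : ℝ≥0) (x : Space d) :
    (∃ V : Ω × Ω' → ℝ, IsDeltaIntegral β₀ γ W P X P' ρ t x V) ∧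
    ∀ V : Ω × Ω' → ℝ, IsDeltaIntegral β₀ γ W P X P' ρ t x V →
      (∀ᵐ ω ∂P, Integrable (fun ω' => u₀ (X t ω' + x) * Real.exp (V (ω, ω'))) P') ∧
      (∀ q : ℝ≥0∞, q ≠ ∞ → MemLp (feynmanKac X P' u₀ t x V) q P) ∧
      ∀ p : ℕ, 1 ≤ p → ∀ (Ω'' : Type*) [MeasurableSpace Ω''] (Q : Measure Ω'')
        [IsProbabilityMeasure Q] (Y : Fin p → ℝ≥0 → Ω'' → Space d),
        AreIndependentCopies Y Q X P' →
          (∀ᵐ ω ∂Q, ∀ j k, mutualEnergy β₀ γ t (fun s => Y j s ω) (fun s => Y k s ω) < ∞) ∧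
          Integrable (fun ω => (∏ j, u₀ (Y j t ω + x)) * Real.exp ((1 / 2) * ∑ j, ∑ k,
            (mutualEnergy β₀ γ t (fun s => Y j s ω) (fun s => Y k s ω)).toReal)) Q ∧
          ∫ ω, feynmanKac X P' u₀ t x V ω ^ p ∂P =
            ∫ ω, (∏ j, u₀ (Y j t ω + x)) * Real.exp ((1 / 2) * ∑ j, ∑ k,
              (mutualEnergy β₀ γ t (fun s => Y j s ω) (fun s => Y k s ω)).toReal) ∂Q := by
  -- All measurability in `ω'` of path functionals is for a version with càdlàg paths everywhere.
  obtain ⟨X₁, hm, hc, hXX⟩ := hX.exists_cadlag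
  have hX₁ : IsSymmetricLevyProcess X₁ Ψ P' := hX.congr hm hc hXX
  have hXX' : ∀ᵐ ω ∂P', ∀ s, X s ω = X₁ s ω := hXX.mono fun ω h s => (h s).symm
  refine ⟨?_, fun V hV => ?_⟩
  · obtain ⟨V, hV⟩ := hW.exists_isDeltaIntegral hγ hβ₀ hβ₁ hρ hX₁ hc hI (t := t) (x := x)
    exact ⟨V, hV.congr hXX'⟩
  have hV₁ : IsDeltaIntegral β₀ γ W P X₁ P' ρ t x V := hV.congr hXX
  have hexp := hV₁.integrable_exp hW hγ hβ₀ hβ₁ hρ hX₁ hc hI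
  refine ⟨?_, fun q hq => memLp_feynmanKac hV.1.1 hexp (hX.measurable t) hq,
    fun p hp Ω'' _ Q _ Y hY => ?_⟩
  · have h := memLp_feynmanKacIntegrand (u₀ := u₀) (x := x) (n := 1) hV.1.1 hexp
      (hX.measurable t) one_ne_zero
    rw [Nat.cast_one, memLp_one_iff_integrable] at h
    exact h.prod_right_ae
  · have hY₁ : AreIndependentCopies Y Q X₁ P' :=
      ⟨hY.levy, fun j => (hY.law j).trans
        (Measure.map_congr (hXX'.mono fun ω h => funext h)), hY.indep⟩
    have hu : ∀ ω, feynmanKac X P' u₀ t x V ω = feynmanKac X₁ P' u₀ t x V ω := fun ω =>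
      integral_congr_ae (hXX'.mono fun ω' h => by simp only [h])
    obtain ⟨h1, h2⟩ := hV₁.integral_feynmanKac_pow hW hγ hβ₀ hβ₁ hρ hX₁ hc hI (u₀ := u₀) (p := p)
      (Nat.one_le_iff_ne_zero.1 hp)
    obtain ⟨h3, h4⟩ := hY₁.integrable_and_integral_eq hm hc hγ.measurable h1
    refine ⟨hY₁.ae_mutualEnergy_lt_top hm hc hγ.measurable
      ((hV₁.ae_map_sum_eq_gaussianReal hW hγ hβ₀ hβ₁ hρ hX₁ hc hI p).mono fun θ h => h.1), h3, ?_⟩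
    simp only [hu]
    exact h2.trans h4.symm
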